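/- Let $\Phi$ be an irreducible reduced crystallographic root system in a real vector space $E$, with Weyl group $W$, a basis of simple roots $\Delta=\{\alpha_1,\dots,\alpha_\ell\}$ numbered as in Bourbaki, positive roots $\Phi^+$, highest root $\tilde\alpha=\sum_i n_i\alpha_i$, and $\alpha_0=-\tilde\alpha$. Let $J=\{0\}\cup\{i\ge 1 : n_i=1\}$. For $j\in J\setminus\{0\}$ let $w_0$ be the longest element of $W$, let $w_j$ be the longest element of the subgroup generated by the simple reflections $s_{\alpha_i}$, $i\ne j$, and put $\omega=\omega_j=w_jw_0$, of order $o(\omega)$. For $x\in E$ put $x^\omega=\frac1{o(\omega)}\sum_{t=1}^{o(\omega)}\omega^t(x)$, and let $$\Phi_{\omega,0}^+=\{\beta\in\Phi^+ : \beta^\omega=0\}.$$ Let $S_0\subseteq\{0,1,\dots,\ell\}$ be the set of all $s$ such that $\alpha_s$ lies in the $\langle\omega\rangle$-orbit of $\alpha_0$. For $\gamma=\sum_{i=1}^\ell c_i\alpha_i$ put $(\gamma,\pi_0)=\sum_{s\in S_0\setminus\{0\}}c_s$ (the pairing with the sum $\pi_0$ of the fundamental coweights $\varpi_s^\vee$,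 $s\in S_0$, where $\varpi_0^\vee=0$), and let $$P(0)=\{(\gamma,\pi_0) : \gamma\in\Phi,\ \gamma^\omega=0\}.$$ Below, $e_1,e_2,\dots$ is the standard basis of $\mathbb R^n$. In each case the second description of $\Phi^+_{\omega,0}$ refers to the stated realization of the simple roots in $\mathbb R^n$. An empty sum is $0$, and $\sqcup$ denotes disjoint union. 1. Type $A_\ell$ ($\ell\ge1$), $n=\ell+1$, $\alpha_i=e_i-e_{i+1}$. Here $J=\{0,\dots,\ell\}$, and for every $j\in\{1,\dots,\ell\}$, with $g=\gcd(\ell+1,j)$, $$\Phi_{\omega,0}^+=\{\alpha_{i_1}+\dots+\alpha_{i_2} : i_1,i_2\in\{1,\dots,\ell\},\ i_2-i_1+1\in g\mathbb Z_{>0}\}=\{e_{p_1}-e_{p_2} : p_1,p_2\in\{1,\dots,\ell+1\},\ p_2-p_1\in g\mathbb Z_{>0}\},$$ and $P(0)=\{\pm1,\dots,\pm(o(\omega)-1)\}$. 2. Type $B_\ell$ ($\ell\ge2$), $n=\ell$, $\alpha_i=e_i-e_{i+1}$ for $i<\ell$, $\alpha_\ell=e_\ell$. Here $J=\{0,1\}$,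 and for $j=1$: $\Phi_{\omega,0}^+=\{\alpha_1+\dots+\alpha_\ell\}=\{e_1\}$ and $P(0)=\{\pm1\}$. 3. Type $C_\ell$ ($\ell\ge3$), $n=\ell$, $\alpha_i=e_i-e_{i+1}$ for $i<\ell$, $\alpha_\ell=2e_\ell$. Here $J=\{0,\ell\}$, and for $j=\ell$: $$\Phi_{\omega,0}^+=\{\alpha_i+\dots+\alpha_{\ell-i}+2\alpha_{\ell-i+1}+\dots+2\alpha_{\ell-1}+\alpha_\ell : 1\le i\le\lfloor\tfrac{\ell+1}2\rfloor\}=\{e_p+e_{\ell-p+1} : 1\le p\le\lfloor\tfrac{\ell+1}2\rfloor\}$$ and $P(0)=\{\pm1\}$. 4. Type $D_\ell$ ($\ell\ge4$), $n=\ell$, $\alpha_i=e_i-e_{i+1}$ for $i<\ell$, $\alpha_\ell=e_{\ell-1}+e_\ell$. Here $J=\{0,1,\ell-1,\ell\}$. (a) For $j=1$: $\Phi_{\omega,0}^+=\{\alpha_1+\dots+\alpha_{\ell-1},\ \alpha_1+\dots+\alpha_{\ell-2}+\alpha_\ell\}=\{e_1-e_\ell,\ e_1+e_\ell\}$ and $P(0)=\{\pm1\}$.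 (b) For $\ell$ even and $j\in\{\ell-1,\ell\}$: $$\Phi_{\omega,0}^+=\{\alpha_1+\dots+\alpha_{\ell-2}+\alpha_j\}\sqcup\{\alpha_i+\dots+\alpha_{\ell-i}+2\alpha_{\ell-i+1}+\dots+2\alpha_{\ell-2}+\alpha_{\ell-1}+\alpha_\ell : 2\le i\le\tfrac\ell2\},$$ which is $\{e_1-e_\ell\}\sqcup\{e_i+e_{\ell-i+1} : 2\le i\le\frac\ell2\}$ if $j=\ell-1$ and $\{e_i+e_{\ell-i+1} : 1\le i\le\frac\ell2\}$ if $j=\ell$; and $P(0)=\{\pm1\}$. (c) For $\ell$ odd and $j\in\{\ell-1,\ell\}$: $$\begin{aligned}\Phi_{\omega,0}^+={}&\{\alpha_1+\dots+\alpha_{\frac{\ell-1}2}\}\sqcup\{\alpha_{\frac{\ell+1}2}+\dots+\alpha_{\ell-2}+\alpha_p : p\in\{\ell-1,\ell\}\}\sqcup\{\alpha_1+\dots+\alpha_{\ell-2}+\alpha_p : p\in\{\ell-1,\ell\}\}\\&\sqcup\{\alpha_i+\dots+\alpha_{\ell-i}+2\alpha_{\ell-i+1}+\dots+2\alpha_{\ell-2}+\alpha_{\ell-1}+\alpha_\ell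 : 2\le i\le\tfrac{\ell-1}2\}\\&\sqcup\{\alpha_1+\dots+\alpha_{\frac{\ell-1}2}+2\alpha_{\frac{\ell+1}2}+\dots+2\alpha_{\ell-2}+\alpha_{\ell-1}+\alpha_\ell\}\\={}&\{e_1\pm e_{\frac{\ell+1}2},\ e_{\frac{\ell+1}2}\pm e_\ell,\ e_1\pm e_\ell\}\sqcup\{e_i+e_{\ell-i+1} : 2\le i\le\tfrac{\ell-1}2\}\end{aligned}$$ and $P(0)=\{\pm1,\pm2,\pm3\}$. 5. Type $E_6$, $n=8$, $\alpha_1=\frac12(e_1-e_2-e_3-e_4-e_5-e_6-e_7+e_8)$, $\alpha_2=e_1+e_2$, $\alpha_3=e_2-e_1$, $\alpha_4=e_3-e_2$, $\alpha_5=e_4-e_3$, $\alpha_6=e_5-e_4$. Here $J=\{0,1,6\}$, and for $j\in\{1,6\}$, $\Phi_{\omega,0}^+$ consists of $\alpha_1+\alpha_2+\alpha_3+\alpha_4$, $\alpha_1+\alpha_3+\alpha_4+\alpha_5$, $\alpha_2+\alpha_4+\alpha_5+\alpha_6$, $\alpha_3+\alpha_4+\alpha_5+\alpha_6$, $\alpha_1+\alpha_2+2\alpha_3+2\alpha_4+\alpha_5+\alpha_6$,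 $\alpha_1+\alpha_2+\alpha_3+2\alpha_4+2\alpha_5+\alpha_6$; that is, of $\frac12(e_1+e_2+e_3-e_4-e_5-e_6-e_7+e_8)$, $\frac12(-e_1-e_2-e_3+e_4-e_5-e_6-e_7+e_8)$, $e_5+e_1$, $e_5-e_1$, $\frac12(-e_1+e_2+e_3-e_4+e_5-e_6-e_7+e_8)$, $\frac12(e_1-e_2-e_3+e_4+e_5-e_6-e_7+e_8)$; and $P(0)=\{\pm1,\pm2\}$. 6. Type $E_7$, $n=8$, $\alpha_1,\dots,\alpha_6$ as in 5 and $\alpha_7=e_6-e_5$. Here $J=\{0,7\}$, and for $j=7$, $\Phi_{\omega,0}^+$ consists of $\alpha_2+\alpha_3+2\alpha_4+2\alpha_5+2\alpha_6+\alpha_7$, $\alpha_1+\alpha_2+2\alpha_3+2\alpha_4+\alpha_5+\alpha_6+\alpha_7$, $\alpha_1+\alpha_2+\alpha_3+2\alpha_4+2\alpha_5+\alpha_6+\alpha_7$; that is, of $e_6+e_5$, $\frac12(-e_1+e_2+e_3-e_4-e_5+e_6-e_7+e_8)$, $\frac12(e_1-e_2-e_3+e_4-e_5+e_6-e_7+e_8)$;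 and $P(0)=\{\pm1\}$. -/

import Mathlib

/-! Folding of a finite root system by an element of the group `Ω` of symmetries of its extended
Dynkin diagram. Root systems, bases, heights, positivity and the standard Cartan matrices are
Mathlib's; everything is relative to a base `b` of a root system `P` over `ℝ`. -/

namespace Folding

section

variable {ι M N : Type*} [AddCommGroup M] [Module ℝ M] [AddCommGroup N] [Module ℝ N]

/-- The subgroup of the Weyl group generated by the reflections in the roots indexed by `K`. For
the set `K` of all simple roots this is the Weyl group; for a set of simple roots it is the
(parabolic) Weyl group corresponding to `K`. -/
def reflectionGroup (P : RootPairing ι ℝ M N) (K : Set ι) : Subgroup (M ≃ₗ[ℝ] M) :=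
  Subgroup.closure (P.reflection '' K)

/-- The length of `w` with respect to the reflections indexed by `K`: the least number of such
reflections whose product is `w`. -/
noncomputable def length (P : RootPairing ι ℝ M N) (K : Set ι) (w : M ≃ₗ[ℝ] M) : ℕ :=
  sInf {n | ∃ l : List ι, (∀ i ∈ l, i ∈ K) ∧ l.length = n ∧ (l.map P.reflection).prod = w}

/-- `w` is an element of maximal length of the group generated by the reflections in `K`. -/
def IsLongest (P : RootPairing ι ℝ M N) (K : Set ι) (w : M ≃ₗ[ℝ] M) : Prop :=
  w ∈ reflectionGroup P K ∧ ∀ w' ∈ reflectionGroup P K, length P K w' ≤ length P K w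

theorem image_range_root_of_mem (P : RootPairing ι ℝ M N) (K : Set ι) {w : M ≃ₗ[ℝ] M}
    (hw : w ∈ reflectionGroup P K) : w '' Set.range P.root = Set.range P.root := by
  induction hw using Subgroup.closure_induction with
  | mem x hx =>
    obtain ⟨i, -, rfl⟩ := hx
    exact P.reflection_image_eq i
  | one => simp
  | mul x y _ _ hx hy =>
    have : (⇑(x * y) : M → M) = x ∘ y := rfl
    rw [this, Set.image_comp, hy, hx]
  | inv x _ hx =>
    have h : (⇑(x⁻¹) : M → M) ∘ x = id := by
      funext m
      exact x.symm_apply_apply m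
    conv_lhs => rw [← hx]
    rw [← Set.image_comp, h, Set.image_id]

theorem finite_reflectionGroup [Finite ι] (P : RootPairing ι ℝ M N) [P.IsRootSystem]
    (K : Set ι) : (reflectionGroup P K : Set (M ≃ₗ[ℝ] M)).Finite := by
  have hex : ∀ (w : reflectionGroup P K) (i : ι), ∃ j, P.root j = w.1 (P.root i) := by
    intro w i
    have : w.1 (P.root i) ∈ w.1 '' Set.range P.root := ⟨_, ⟨i, rfl⟩, rfl⟩
    rwa [image_range_root_of_mem P K w.2] at this
  choose f hf using hex
  have hinj : Function.Injective f := by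
    intro v w hvw
    apply Subtype.ext
    apply LinearEquiv.toLinearMap_injective
    refine LinearMap.ext_on_range (v := P.root) RootPairing.IsRootSystem.span_root_eq_top ?_
    intro i
    change v.1 (P.root i) = w.1 (P.root i)
    rw [← hf, ← hf, hvw]
  have : Finite (reflectionGroup P K) := Finite.of_injective f hinj
  exact Set.toFinite _

theorem exists_isLongest [Finite ι] (P : RootPairing ι ℝ M N) [P.IsRootSystem] (K : Set ι) :
    ∃ w, IsLongest P K w := by
  obtain ⟨w, hw, hmax⟩ := Set.exists_max_image _ (length P K) (finite_reflectionGroup P K)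
    ⟨1, one_mem _⟩
  exact ⟨w, hw, hmax⟩

/-- The longest element of the group generated by the reflections in `K`. -/
noncomputable def longestElement [Finite ι] (P : RootPairing ι ℝ M N) [P.IsRootSystem]
    (K : Set ι) : M ≃ₗ[ℝ] M :=
  (exists_isLongest P K).choose

variable {P : RootPairing ι ℝ M N}

/-- The highest root: the root of maximal height. -/
noncomputable def highestRoot [Finite ι] [Nonempty ι] (b : P.Base) : ι :=
  (Finite.exists_max b.height).choose

/-- The set `J ∖ {0}`: the simple roots whose coefficient in the highest root is `1`. -/
def minuscule [Finite ι] [Nonempty ι] [P.IsRootSystem] (b : P.Base) : Set ι :=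
  {j | ∃ h : j ∈ b.support, b.toWeightBasis.coord ⟨j, h⟩ (P.root (highestRoot b)) = 1}

/-- `ω_j = w_j w_0`, where `w_0` is the longest element of the Weyl group and `w_j` is the longest
element of the Weyl group corresponding to the simple roots other than the `j`-th. -/
noncomputable def omega [Finite ι] [P.IsRootSystem] (b : P.Base) (j : ι) : M ≃ₗ[ℝ] M :=
  longestElement P ((b.support : Set ι) \ {j}) * longestElement P (b.support : Set ι)

/-- `x^ω`: the average of `x` over the cyclic group generated by `ω`. -/
noncomputable def fold (ω : M ≃ₗ[ℝ] M) (x : M) : M :=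
  (orderOf ω : ℝ)⁻¹ • ∑ t ∈ Finset.Icc 1 (orderOf ω), (ω ^ t) x

/-- `Φ_{ω,0}^+`: the positive roots that disappear under folding by `ω`. -/
def disappearing (b : P.Base) (ω : M ≃ₗ[ℝ] M) : Set M :=
  {x | ∃ i, b.IsPos i ∧ P.root i = x ∧ fold ω x = 0}

open Classical in
/-- Pairing with `π_0`, the sum of the fundamental coweights `ϖ_s^∨` over all `s` in the `ω`-orbit
of `0`, where `ϖ_0^∨ = 0`. The nonzero elements of the orbit are those `s` for which the simple root
`α_s` lies in the `⟨ω⟩`-orbit of `α_0`, the negative of the highest root. Pairing with `ϖ_s^∨` is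
taking the coefficient at `α_s`. -/
noncomputable def pairingPiZero [Finite ι] [Nonempty ι] [P.IsRootSystem] (b : P.Base)
    (ω : M ≃ₗ[ℝ] M) : M →ₗ[ℝ] ℝ :=
  ∑ s : {s : b.support // ∃ t : ℤ, (ω ^ t) (-P.root (highestRoot b)) = P.root s},
    b.toWeightBasis.coord s

/-- `P(x)`: the integers `(γ, π_0)` for the roots `γ` with `γ^ω = x`. -/
def extraSet [Finite ι] [Nonempty ι] [P.IsRootSystem] (b : P.Base) (ω : M ≃ₗ[ℝ] M) (x : M) :
    Set ℤ :=
  {p | ∃ i, fold ω (P.root i) = x ∧ pairingPiZero b ω (P.root i) = p}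

/-- `α 1, …, α ℓ` is an enumeration of the simple roots for which the Cartan matrix
`(⟨α_i, α_j^∨⟩)_{ij}` is `C`. -/
structure IsLabelling [P.IsCrystallographic] (b : P.Base) {ℓ : ℕ}
    (C : Matrix (Fin ℓ) (Fin ℓ) ℤ) (α : ℕ → ι) : Prop where
  bijOn : Set.BijOn α (Set.Icc 1 ℓ) b.support
  pairing : ∀ i j : Fin ℓ, P.pairingIn ℤ (α (i + 1)) (α (j + 1)) = C i j

/-- `α_p + α_{p+1} + ⋯ + α_q`, which is `0` if `q < p`. -/
def str (P : RootPairing ι ℝ M N) (α : ℕ → ι) (p q : ℕ) : M :=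
  ∑ i ∈ Finset.Icc p q, P.root (α i)

end

/-- The standard basis vector `e_p` of `ℝⁿ`, where `p` runs from `1` to `n`. -/
noncomputable def e (n p : ℕ) : EuclideanSpace ℝ (Fin n) :=
  WithLp.toLp 2 fun k => if (k : ℕ) + 1 = p then 1 else 0

/-- `S` is the disjoint union of the sets in the list `L`. -/
def IsDisjointUnion {X : Type*} (S : Set X) (L : List (Set X)) : Prop :=
  L.Pairwise Disjoint ∧ S = {x | ∃ T ∈ L, x ∈ T}

end Folding

namespace Folding

open Set

/-! ### Words, deletion and the characterisation of `ω_j` in the Weyl group -/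

section Coxeter

variable {ι M N : Type*} [AddCommGroup M] [Module ℝ M] [AddCommGroup N] [Module ℝ N]
variable {P : RootPairing ι ℝ M N} {K : Set ι}

/-! The element `ω_j = w_j w_0` is determined by what it does to simple roots: it permutes the
extended simple system, sending exactly one simple root to `α_0`. The converse drives the proof.
Suppose that `w` in the Weyl group sends every simple root either to a simple root other than `α_j`
or to a vector with negative `α_j`-coefficient. Then `w_j⁻¹ w` makes all simple roots negative,
because `w_j⁻¹` makes the simple roots other than `α_j` negative and does not change
`α_j`-coefficients. An element that makes all positive roots negative is `w_0`, so `w = ω_j`. This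
is `omega_eq_of_forall`; it rests on the deletion property of words in simple reflections.

So `ω_j` can be guessed in coordinates and verified. A `Realization` transports roots, heights,
coefficients and simple reflections to a concrete space; there one finds the set of all roots,
exhibits a map `T` induced by the Weyl group, and checks it on simple roots (`Realization.f_omega`).
The condition `β^ω = 0` becomes the vanishing of the sum of the iterates of `T` on a vector
(`mem_disappearing_iff`), and `π_0` is read off from the orbit of `α_0` under `T`
(`pairingPiZero_apply`).

In type A, with coordinates indexed by `ℤ/(ℓ+1)`, `T` is the rotation by `j`. The root `e_p - e_q`
disappears exactly when `p` and `q` lie in one coset of the subgroup generated by `j`, that is,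
modulo `g = gcd(ℓ+1, j)`, and its pairing with `π_0` counts the multiples of `g` in `[p, q)`. In
type B, `T` changes the sign of `x_1`; in type C it is `x_r ↦ -x_{ℓ+1-r}`; in type D, `ω_1` changes
the signs of `x_1` and `x_ℓ`. The other two elements of type D act on the inner coordinates as in
type C and exchange `x_1` and `x_ℓ` up to signs. The signs must be even in number, which forces
order 2 for even `ℓ` and order 4 for odd `ℓ`; in the latter case the coordinates `1`, `(ℓ+1)/2` and
`ℓ` satisfy no condition, so all roots supported there disappear.

For `E₆` and `E₇` roots are integral coefficient vectors, and every requirement is a finite check on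
an explicit list of positive roots and an explicit matrix (`IsPosRootList`, `FoldingData`). -/

theorem mem_reflectionGroup_iff_exists_list {w : M ≃ₗ[ℝ] M} :
    w ∈ reflectionGroup P K ↔ ∃ l : List ι, (∀ i ∈ l, i ∈ K) ∧ (l.map P.reflection).prod = w := by
  constructor
  · intro hw
    induction hw using Subgroup.closure_induction with
    | mem x hx =>
      obtain ⟨i, hi, rfl⟩ := hx
      exact ⟨[i], by simpa using hi, by simp⟩
    | one => exact ⟨[], by simp, by simp⟩
    | mul x y _ _ hx hy =>
      obtain ⟨l, hl, rfl⟩ := hx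
      obtain ⟨l', hl', rfl⟩ := hy
      refine ⟨l ++ l', ?_, by simp⟩
      intro i hi
      rcases List.mem_append.mp hi with h | h
      exacts [hl i h, hl' i h]
    | inv x _ hx =>
      obtain ⟨l, hl, rfl⟩ := hx
      refine ⟨l.reverse, by simpa using hl, ?_⟩
      rw [List.prod_inv_reverse, List.map_map, List.map_reverse]
      rfl
  · rintro ⟨l, hl, rfl⟩
    refine Subgroup.list_prod_mem _ fun x hx => ?_
    obtain ⟨i, hi, rfl⟩ := List.mem_map.mp hx
    exact Subgroup.subset_closure ⟨i, hl i hi, rfl⟩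

theorem reflection_mem_reflectionGroup {i : ι} (hi : i ∈ K) :
    P.reflection i ∈ reflectionGroup P K :=
  Subgroup.subset_closure ⟨i, hi, rfl⟩

theorem reflectionGroup_mono {K' : Set ι} (h : K ⊆ K') :
    reflectionGroup P K ≤ reflectionGroup P K' :=
  Subgroup.closure_mono (image_mono h)

theorem exists_root_eq_of_mem_reflectionGroup {w : M ≃ₗ[ℝ] M} (hw : w ∈ reflectionGroup P K)
    (i : ι) : ∃ j, P.root j = w (P.root i) := by
  have : w (P.root i) ∈ w '' range P.root := ⟨_, ⟨i, rfl⟩, rfl⟩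
  rwa [image_range_root_of_mem P K hw] at this

theorem length_le_of_list {l : List ι} (hl : ∀ i ∈ l, i ∈ K) :
    length P K (l.map P.reflection).prod ≤ l.length :=
  Nat.sInf_le ⟨l, hl, rfl, rfl⟩

theorem exists_reduced_list {w : M ≃ₗ[ℝ] M} (hw : w ∈ reflectionGroup P K) :
    ∃ l : List ι, (∀ i ∈ l, i ∈ K) ∧ l.length = length P K w ∧ (l.map P.reflection).prod = w := by
  obtain ⟨l, hl, rfl⟩ := mem_reflectionGroup_iff_exists_list.mp hw
  exact Nat.sInf_mem (s := {n | ∃ l' : List ι, (∀ i ∈ l', i ∈ K) ∧ l'.length = n ∧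
    (l'.map P.reflection).prod = (l.map P.reflection).prod}) ⟨l.length, l, hl, rfl, rfl⟩

theorem length_inv (w : M ≃ₗ[ℝ] M) : length P K w⁻¹ = length P K w := by
  unfold length
  congr 1
  ext n
  have key : ∀ v : M ≃ₗ[ℝ] M,
      (∃ l : List ι, (∀ i ∈ l, i ∈ K) ∧ l.length = n ∧ (l.map P.reflection).prod = v) →
      ∃ l : List ι, (∀ i ∈ l, i ∈ K) ∧ l.length = n ∧ (l.map P.reflection).prod = v⁻¹ := by
    rintro v ⟨l, hl, hn, rfl⟩
    refine ⟨l.reverse, by simpa using hl, by simpa using hn, ?_⟩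
    rw [List.prod_inv_reverse, List.map_map, List.map_reverse]
    rfl
  exact ⟨fun h => by simpa using key _ h, key w⟩

theorem IsLongest.inv {w : M ≃ₗ[ℝ] M} (hw : IsLongest P K w) : IsLongest P K w⁻¹ :=
  ⟨inv_mem hw.1, fun w' hw' => by rw [length_inv]; exact hw.2 w' hw'⟩

/-- Conjugation of a reflection by a product of reflections. -/
theorem reflection_mul_of_root_eq {w : M ≃ₗ[ℝ] M} (hw : w ∈ reflectionGroup P K) {i q : ι}
    (h : P.root q = w (P.root i)) : P.reflection q * w = w * P.reflection i := by
  obtain ⟨l, hl, rfl⟩ := mem_reflectionGroup_iff_exists_list.mp hw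
  clear hw
  induction l generalizing q with
  | nil =>
    have : q = i := P.root.injective (by simpa using h)
    simp [this]
  | cons k l ih =>
    have hl2 : ∀ i ∈ l, i ∈ K := fun i hi => hl i (by simp [hi])
    obtain ⟨m, hm⟩ := exists_root_eq_of_mem_reflectionGroup
      (mem_reflectionGroup_iff_exists_list.mpr ⟨l, hl2, rfl⟩ :
        (l.map P.reflection).prod ∈ reflectionGroup P K) i
    have hq : q = P.reflectionPerm k m := P.root.injective (by
      rw [h, P.root_reflectionPerm, hm]
      simp)
    simp only [List.map_cons, List.prod_cons]
    rw [hq, P.reflection_reflectionPerm, mul_assoc, mul_assoc, mul_assoc,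
      ← mul_assoc (P.reflection k) (P.reflection k), ← sq, P.reflection_sq, one_mul,
      ih hl2 hm]

variable {b : P.Base}

theorem exists_root_eq_neg (P : RootPairing ι ℝ M N) (i : ι) : ∃ j, P.root j = -P.root i := by
  let := P.indexNeg
  exact ⟨-i, by simp⟩

theorem exists_isPos_root_eq_neg {i : ι} (h : ¬ b.IsPos i) :
    ∃ j, b.IsPos j ∧ P.root j = -P.root i := by
  let := P.indexNeg
  exact ⟨-i, (RootPairing.Base.IsPos.neg_iff_not b i).mpr h, by simp⟩

theorem isPos_iff_not_of_root_eq_neg {i j : ι} (h : P.root j = -P.root i) :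
    b.IsPos j ↔ ¬ b.IsPos i := by
  let := P.indexNeg
  have : j = -i := P.root.injective (by simpa using h)
  rw [this]
  exact RootPairing.Base.IsPos.neg_iff_not b i

variable [Finite ι] [P.IsCrystallographic] [P.IsReduced]

/-- The deletion property. -/
theorem exists_list_of_isPos_of_not_isPos (hK : K ⊆ b.support) {l : List ι}
    (hl : ∀ i ∈ l, i ∈ K) {i m : ι} (hi : b.IsPos i) (hm : ¬ b.IsPos m)
    (h : (l.map P.reflection).prod (P.root i) = P.root m) :
    ∃ l' : List ι, (∀ i ∈ l', i ∈ K) ∧ l'.length + 1 = l.length ∧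
      (l'.map P.reflection).prod = (l.map P.reflection).prod * P.reflection i := by
  induction l generalizing m with
  | nil =>
    have : i = m := P.root.injective (by simpa using h)
    exact absurd (this ▸ hi) hm
  | cons k l ih =>
    have hl2 : ∀ i ∈ l, i ∈ K := fun i hi => hl i (by simp [hi])
    have hk : k ∈ K := hl k (by simp)
    obtain ⟨q, hq⟩ := exists_root_eq_of_mem_reflectionGroup
      (mem_reflectionGroup_iff_exists_list.mpr ⟨l, hl2, rfl⟩ :
        (l.map P.reflection).prod ∈ reflectionGroup P K) i
    by_cases hpos : b.IsPos q
    · have h1 : P.root m = P.root (P.reflectionPerm k q) := by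
        rw [P.root_reflectionPerm, hq, ← h]
        simp
      -- A simple reflection makes only one positive root negative, namely its own.
      have hqk : q = k := by
        by_contra hne
        rw [P.root.injective h1] at hm
        exact hm (hpos.reflectionPerm (hK hk) hne)
      subst hqk
      -- With `w` the product of the remaining letters, `s_q w = w s_i`, so `(s_q w) s_i = w`: the
      -- letter deleted is this first one.
      refine ⟨l, hl2, by simp, ?_⟩
      set w := (l.map P.reflection).prod with hw
      have hc : P.reflection q * w = w * P.reflection i :=
        reflection_mul_of_root_eq (mem_reflectionGroup_iff_exists_list.mpr ⟨l, hl2, hw.symm⟩) hq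
      simp only [List.map_cons, List.prod_cons]
      rw [hc, mul_assoc, ← sq, P.reflection_sq, mul_one]
    · obtain ⟨l', h1, h2, h3⟩ := ih hl2 hpos hq.symm
      refine ⟨k :: l', ?_, by simp [h2], by simp [h3, mul_assoc]⟩
      intro i hi
      rcases List.mem_cons.mp hi with rfl | h
      exacts [hk, h1 i h]

/-- If `w(α_k)` were positive, then `w s_k` would make `α_k` negative, and deletion would shorten a
reduced word of `w s_k` to a word of `w`. So `w s_k` would be longer than `w`. -/
theorem IsLongest.not_isPos (hK : K ⊆ b.support) {w : M ≃ₗ[ℝ] M} (hw : IsLongest P K w)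
    {k m : ι} (hk : k ∈ K) (h : P.root m = w (P.root k)) : ¬ b.IsPos m := by
  intro hm
  have hwk : w * P.reflection k ∈ reflectionGroup P K :=
    mul_mem hw.1 (reflection_mem_reflectionGroup hk)
  obtain ⟨l, hl, hlen, hprod⟩ := exists_reduced_list hwk
  obtain ⟨m', hm'⟩ := exists_root_eq_neg P m
  obtain ⟨l', h1, h2, h3⟩ := exists_list_of_isPos_of_not_isPos (m := m') hK hl
    (b.isPos_of_mem_support (hK hk))
    (by rw [isPos_iff_not_of_root_eq_neg hm']; exact not_not.mpr hm)
    (by rw [hprod, hm', h]; simp)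
  rw [hprod, mul_assoc, ← sq, P.reflection_sq, mul_one] at h3
  have := length_le_of_list (P := P) h1
  have := hw.2 _ hwk
  rw [h3] at *
  omega

/-- A reduced word of `w ≠ 1` ends in some `s_k`. Without that letter it sends `α_k` to the negative
root `-w(α_k)`, so deletion produces a word of `w` with two letters fewer than the reduced one. -/
theorem eq_one_of_forall_isPos {w : M ≃ₗ[ℝ] M} (hw : w ∈ reflectionGroup P b.support)
    (h : ∀ k ∈ b.support, ∃ m, b.IsPos m ∧ P.root m = w (P.root k)) : w = 1 := by
  obtain ⟨l, hl, hlen, rfl⟩ := exists_reduced_list hw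
  rcases List.eq_nil_or_concat l with rfl | ⟨l, k, rfl⟩
  · simp
  exfalso
  have hk : k ∈ b.support := hl k (by simp)
  have hl2 : ∀ i ∈ l, i ∈ (b.support : Set ι) := fun i hi => hl i (by simp [hi])
  obtain ⟨m, hm, hmk⟩ := h k hk
  obtain ⟨m', hm'⟩ := exists_root_eq_neg P m
  obtain ⟨l', h1, h2, h3⟩ := exists_list_of_isPos_of_not_isPos (m := m') subset_rfl hl2
    (b.isPos_of_mem_support hk)
    (by rw [isPos_iff_not_of_root_eq_neg hm']; exact not_not.mpr hm)
    (by rw [hm', hmk]; simp)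
  have := length_le_of_list (P := P) h1
  rw [h3] at this
  simp only [List.map_append, List.map_cons, List.map_nil, List.prod_append, List.prod_cons,
    List.prod_nil, mul_one, List.concat_eq_append, List.length_append, List.length_cons,
    List.length_nil] at this hlen
  omega

/-- Every positive root is built by adding simple roots one at a time, and heights of images add up.
-/
theorem forall_isPos_of_forall_mem_support {w : M ≃ₗ[ℝ] M}
    (hw : w ∈ reflectionGroup P b.support)
    (h : ∀ k ∈ b.support, ∀ m, P.root m = w (P.root k) → ¬ b.IsPos m) {i m : ι} (hi : b.IsPos i)
    (hm : P.root m = w (P.root i)) : ¬ b.IsPos m := by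
  suffices ∀ m, P.root m = w (P.root i) → b.height m < 0 by
    have := this m hm
    rw [b.isPos_iff]
    omega
  clear hm m
  refine hi.induction_on_add (p := fun i => ∀ m, P.root m = w (P.root i) → b.height m < 0) ?_ ?_
  · intro k hk m hm
    have := h k hk m hm
    rw [b.isPos_iff'] at this
    omega
  · intro i j k hk hi hj m hm
    obtain ⟨p, hp⟩ := exists_root_eq_of_mem_reflectionGroup hw i
    obtain ⟨q, hq⟩ := exists_root_eq_of_mem_reflectionGroup hw j
    have := h j hj q hq
    rw [b.isPos_iff'] at this
    have := hi p hp
    rw [b.height_add (i := p) (j := q) (by rw [hm, hk, hp, hq, map_add])]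
    omega

variable [P.IsRootSystem]

theorem longestElement_isLongest (P : RootPairing ι ℝ M N) [P.IsRootSystem] (K : Set ι) :
    IsLongest P K (longestElement P K) :=
  (exists_isLongest P K).choose_spec

theorem coord_nonneg_of_isPos (j : b.support) {i : ι} (hi : b.IsPos i) :
    0 ≤ b.toWeightBasis.coord j (P.root i) := by
  classical
  have hs : ∀ k : b.support, 0 ≤ b.toWeightBasis.coord j (P.root k) := by
    intro k
    rw [Module.Basis.coord_apply, b.toWeightBasis_repr_root, Finsupp.single_apply]
    split_ifs <;> simp
  refine hi.induction_on_add (p := fun i => 0 ≤ b.toWeightBasis.coord j (P.root i)) ?_ ?_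
  · exact fun k hk => hs ⟨k, hk⟩
  · intro i l k hk hi hl
    rw [hk, map_add]
    exact add_nonneg hi (hs ⟨l, hl⟩)

/-- A reflection in another simple root subtracts a multiple of that root, which has no `j`-th
coefficient. -/
theorem coord_apply_of_mem_reflectionGroup (j : b.support) {w : M ≃ₗ[ℝ] M}
    (hw : w ∈ reflectionGroup P ((b.support : Set ι) \ {j.1})) (x : M) :
    b.toWeightBasis.coord j (w x) = b.toWeightBasis.coord j x := by
  obtain ⟨l, hl, rfl⟩ := mem_reflectionGroup_iff_exists_list.mp hw
  clear hw
  induction l with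
  | nil => simp
  | cons k l ih =>
    have hk := hl k (by simp)
    have hkj : (⟨k, hk.1⟩ : b.support) ≠ j := fun h => hk.2 (by simp [← h])
    simp only [List.map_cons, List.prod_cons, LinearEquiv.mul_apply, P.reflection_apply, map_sub,
      map_smul]
    rw [ih fun i hi => hl i (by simp [hi]), Module.Basis.coord_apply _ _ (P.root k),
      b.toWeightBasis_repr_root ⟨k, hk.1⟩, Finsupp.single_eq_of_ne hkj.symm]
    simp

/-- A criterion for an element of the Weyl group to be `ω_j`. -/
theorem omega_eq_of_forall (j : b.support) {w : M ≃ₗ[ℝ] M}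
    (hw : w ∈ reflectionGroup P b.support)
    (h : ∀ i ∈ b.support, (∃ k ∈ b.support, k ≠ j.1 ∧ w (P.root i) = P.root k) ∨
      b.toWeightBasis.coord j (w (P.root i)) < 0) :
    omega b j = w := by
  set K : Set ι := (b.support : Set ι) \ {j.1}
  have hKs : K ⊆ b.support := sdiff_subset
  have h0 := longestElement_isLongest P (b.support : Set ι)
  have hj := longestElement_isLongest P K
  set w0 := longestElement P (b.support : Set ι)
  set wj := longestElement P K
  have hv : wj⁻¹ * w ∈ reflectionGroup P b.support :=
    mul_mem (reflectionGroup_mono hKs hj.inv.1) hw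
  -- Both alternatives of the hypothesis lead to a negative root: `wj⁻¹` makes the simple roots
  -- other than the `j`-th negative, and it keeps a negative `j`-th coefficient.
  have hneg : ∀ k ∈ b.support, ∀ m, P.root m = (wj⁻¹ * w) (P.root k) → ¬ b.IsPos m := by
    intro i hi m hm
    rw [LinearEquiv.mul_apply] at hm
    rcases h i hi with ⟨k, hk, hkj, hik⟩ | hlt
    · rw [hik] at hm
      exact hj.inv.not_isPos hKs (k := k) ⟨hk, hkj⟩ hm
    · intro hpos
      have := coord_nonneg_of_isPos j hpos
      rw [hm, coord_apply_of_mem_reflectionGroup j hj.inv.1] at this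
      linarith
  -- Both factors exchange positive and negative roots, so the product keeps simple roots positive
  -- and is therefore trivial.
  have hone : (wj⁻¹ * w) * w0⁻¹ = 1 := by
    refine eq_one_of_forall_isPos (mul_mem hv h0.inv.1) fun k hk => ?_
    obtain ⟨q, hq⟩ := exists_root_eq_of_mem_reflectionGroup h0.inv.1 k
    have hqneg := h0.inv.not_isPos subset_rfl (k := k) hk hq
    obtain ⟨q', hq', hqq⟩ := exists_isPos_root_eq_neg hqneg
    obtain ⟨m, hm⟩ := exists_root_eq_of_mem_reflectionGroup hv q'
    have hmneg := forall_isPos_of_forall_mem_support hv hneg hq' hm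
    obtain ⟨m', hm', hmm⟩ := exists_isPos_root_eq_neg hmneg
    refine ⟨m', hm', ?_⟩
    rw [hmm, hm, hqq, map_neg, neg_neg, hq]
    rfl
  have : wj⁻¹ * w = w0 := by rwa [mul_inv_eq_one] at hone
  change wj * w0 = w
  rw [← this, mul_inv_cancel_left]

end Coxeter

end Folding

namespace Folding

open Set

/-! ### Transfer to a coordinate space -/

section Realization

variable {ι M N : Type*} [AddCommGroup M] [Module ℝ M] [AddCommGroup N] [Module ℝ N]
variable {P : RootPairing ι ℝ M N}

/-- A realization in `V` of a root system with simple roots `α 1, …, α ℓ`: a linear map `f` to `V`,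
the images `a i` of the simple roots, functionals `k i` on `V` that give the coefficients of a root,
and functionals `c i` on `V` that give the pairing with the simple coroots. -/
structure Realization (b : P.Base) (ℓ : ℕ) (α : ℕ → ι) (V : Type*) [AddCommGroup V]
    [Module ℝ V] where
  bijOn : BijOn α (Icc 1 ℓ) b.support
  f : M →ₗ[ℝ] V
  a : ℕ → V
  k : ℕ → V →ₗ[ℝ] ℝ
  c : ℕ → V →ₗ[ℝ] ℝ
  map_root : ∀ i ∈ Icc 1 ℓ, f (P.root (α i)) = a i
  k_apply : ∀ i ∈ Icc 1 ℓ, ∀ j ∈ Icc 1 ℓ, k i (a j) = if i = j then 1 else 0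
  c_apply : ∀ i ∈ Icc 1 ℓ, ∀ j ∈ Icc 1 ℓ, c j (a i) = P.pairing (α i) (α j)

variable {b : P.Base} {ℓ : ℕ} {α : ℕ → ι} {V : Type*} [AddCommGroup V] [Module ℝ V]

open Classical in
/-- The realization determined by the images of the simple roots. -/
noncomputable def IsLabelling.realization [P.IsCrystallographic] [P.IsRootSystem]
    {C : Matrix (Fin ℓ) (Fin ℓ) ℤ}
    (h : IsLabelling b C α) (a : ℕ → V) (k c : ℕ → V →ₗ[ℝ] ℝ)
    (hk : ∀ i ∈ Icc 1 ℓ, ∀ j ∈ Icc 1 ℓ, k i (a j) = if i = j then 1 else 0)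
    (hc : ∀ i j : Fin ℓ, c (j + 1) (a (i + 1)) = C i j) : Realization b ℓ α V where
  bijOn := h.bijOn
  f := b.toWeightBasis.constr ℝ fun s => a (Function.invFunOn α (Icc 1 ℓ) s)
  a := a
  k := k
  c := c
  map_root i hi := by
    have := b.toWeightBasis.constr_basis ℝ
      (fun s => a (Function.invFunOn α (Icc 1 ℓ) s)) ⟨α i, h.bijOn.mapsTo hi⟩
    rw [b.toWeightBasis_apply] at this
    rw [this]
    exact congrArg a (h.bijOn.injOn.leftInvOn_invFunOn hi)
  k_apply := hk
  c_apply i hi j hj := by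
    have h1 := h.pairing ⟨i - 1, by have := hi.1; have := hi.2; omega⟩
      ⟨j - 1, by have := hj.1; have := hj.2; omega⟩
    have h2 := hc ⟨i - 1, by have := hi.1; have := hi.2; omega⟩
      ⟨j - 1, by have := hj.1; have := hj.2; omega⟩
    simp only [Nat.sub_add_cancel hi.1, Nat.sub_add_cancel hj.1] at h1 h2
    rw [h2, ← h1, ← P.algebraMap_pairingIn ℤ]
    rfl

namespace Realization

variable (r : Realization b ℓ α V)
include r

theorem mem_support {i : ℕ} (hi : i ∈ Icc 1 ℓ) : α i ∈ b.support :=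
  r.bijOn.mapsTo hi

theorem exists_eq {s : ι} (hs : s ∈ b.support) : ∃ i ∈ Icc 1 ℓ, α i = s :=
  r.bijOn.surjOn hs

theorem a_injOn : InjOn r.a (Icc 1 ℓ) := by
  intro i hi j hj h
  by_contra hne
  have h1 := r.k_apply i hi i hi
  rw [h, r.k_apply i hi j hj] at h1
  simp [hne] at h1

/-- The height of an element of the realization. -/
noncomputable def ht : V →ₗ[ℝ] ℝ := ∑ i ∈ Finset.Icc 1 ℓ, r.k i

theorem ht_a {i : ℕ} (hi : i ∈ Icc 1 ℓ) : r.ht (r.a i) = 1 := by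
  simp only [ht, LinearMap.sum_apply]
  rw [Finset.sum_eq_single_of_mem i (by simpa using hi), r.k_apply i hi i hi, if_pos rfl]
  intro j hj hne
  rw [r.k_apply j (by simpa using hj) i hi, if_neg hne]

theorem ht_f_root (i : ι) : r.ht (r.f (P.root i)) = b.height i := by
  obtain ⟨g, -, -, hg⟩ := b.exists_root_eq_sum_int i
  rw [RootPairing.Base.height_eq_sum hg, hg, map_sum, map_sum, Int.cast_sum]
  refine Finset.sum_congr rfl fun s hs => ?_
  obtain ⟨j, hj, rfl⟩ := r.exists_eq hs
  rw [map_zsmul, map_zsmul, r.map_root j hj, r.ht_a hj]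
  simp

theorem isPos_iff {i : ι} : b.IsPos i ↔ 0 < r.ht (r.f (P.root i)) := by
  rw [r.ht_f_root, b.isPos_iff, Int.cast_pos]

/-- The set of roots in the realization. -/
def roots : Set V := r.f '' range P.root

theorem f_root_mem (i : ι) : r.f (P.root i) ∈ r.roots := ⟨_, ⟨i, rfl⟩, rfl⟩

theorem a_mem_roots {i : ℕ} (hi : i ∈ Icc 1 ℓ) : r.a i ∈ r.roots :=
  r.map_root i hi ▸ r.f_root_mem _

theorem neg_mem_roots {v : V} (hv : v ∈ r.roots) : -v ∈ r.roots := by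
  obtain ⟨-, ⟨i, rfl⟩, rfl⟩ := hv
  obtain ⟨j, hj⟩ := exists_root_eq_neg P i
  exact ⟨_, ⟨j, rfl⟩, by rw [hj, map_neg]⟩

/-- `T` is the action on the realization of an element of the Weyl group. -/
def Acts (T : V → V) : Prop :=
  ∃ w ∈ reflectionGroup P (b.support : Set ι), ∀ x, r.f (w x) = T (r.f x)

variable {r}

theorem Acts.comp {T T' : V → V} (h : r.Acts T) (h' : r.Acts T') : r.Acts (T ∘ T') := by
  obtain ⟨w, hw, h⟩ := h
  obtain ⟨w', hw', h'⟩ := h'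
  exact ⟨w * w', mul_mem hw hw', fun x => by
    rw [LinearEquiv.mul_apply, h, h', Function.comp_apply]⟩

theorem Acts.mem_roots {T : V → V} (h : r.Acts T) {v : V} (hv : v ∈ r.roots) : T v ∈ r.roots := by
  obtain ⟨w, hw, h⟩ := h
  obtain ⟨-, ⟨i, rfl⟩, rfl⟩ := hv
  obtain ⟨j, hj⟩ := exists_root_eq_of_mem_reflectionGroup hw i
  exact ⟨_, ⟨j, rfl⟩, by rw [hj, h]⟩

theorem acts_id : r.Acts id := ⟨1, one_mem _, fun _ => rfl⟩

variable (r)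

section RootSystem

variable [P.IsRootSystem]

theorem linearMap_ext {W : Type*} [AddCommGroup W] [Module ℝ W] {g g' : M →ₗ[ℝ] W}
    (h : ∀ i ∈ Icc 1 ℓ, g (P.root (α i)) = g' (P.root (α i))) : g = g' := by
  refine b.toWeightBasis.ext fun s => ?_
  obtain ⟨i, hi, his⟩ := r.exists_eq s.2
  rw [b.toWeightBasis_apply, ← his]
  exact h i hi

theorem coord_apply {j : ℕ} (hj : j ∈ Icc 1 ℓ) (x : M) :
    b.toWeightBasis.coord ⟨α j, r.mem_support hj⟩ x = r.k j (r.f x) := by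
  classical
  suffices b.toWeightBasis.coord ⟨α j, r.mem_support hj⟩ = r.k j ∘ₗ r.f by rw [this]; rfl
  refine r.linearMap_ext fun i hi => ?_
  rw [LinearMap.comp_apply, r.map_root i hi, r.k_apply j hj i hi, Module.Basis.coord_apply,
    b.toWeightBasis_repr_root ⟨α i, r.mem_support hi⟩, Finsupp.single_apply]
  simp only [Subtype.mk.injEq]
  congr 1
  exact propext ⟨fun h => (r.bijOn.injOn hi hj h).symm, fun h => by rw [h]⟩

theorem f_injective : Function.Injective r.f := by
  intro x y h
  refine b.toWeightBasis.ext_elem fun s => ?_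
  obtain ⟨i, hi, his⟩ := r.exists_eq s.2
  have := r.coord_apply hi x
  rw [h, ← r.coord_apply hi y] at this
  simpa [his] using this

theorem toLinearMap_coroot {i : ℕ} (hi : i ∈ Icc 1 ℓ) (x : M) :
    P.toLinearMap x (P.coroot (α i)) = r.c i (r.f x) := by
  suffices P.toLinearMap.flip (P.coroot (α i)) = r.c i ∘ₗ r.f from LinearMap.congr_fun this x
  refine r.linearMap_ext fun j hj => ?_
  rw [LinearMap.comp_apply, r.map_root j hj, r.c_apply j hj i hi]
  rfl

theorem f_reflection {i : ℕ} (hi : i ∈ Icc 1 ℓ) (x : M) :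
    r.f (P.reflection (α i) x) = r.f x - r.c i (r.f x) • r.a i := by
  rw [P.reflection_apply, map_sub, map_smul, r.map_root i hi, ← r.toLinearMap_coroot hi]
  rfl

theorem acts_reflection {i : ℕ} (hi : i ∈ Icc 1 ℓ) : r.Acts fun v => v - r.c i v • r.a i :=
  ⟨P.reflection (α i), reflection_mem_reflectionGroup (r.mem_support hi), r.f_reflection hi⟩

end RootSystem

section Finite

variable [P.IsRootSystem] [Finite ι] [P.IsCrystallographic] [P.IsReduced]

/-- Simple reflections and negation reach every root from the simple ones, so an upper bound for the
set of roots is a closure check. The opposite inclusion is obtained in each type by moving known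
roots with `Acts.mem_roots`. -/
theorem roots_subset {R : Set V} (h1 : ∀ i ∈ Icc 1 ℓ, r.a i ∈ R) (h2 : ∀ v ∈ R, -v ∈ R)
    (h3 : ∀ i ∈ Icc 1 ℓ, ∀ v ∈ R, v - r.c i v • r.a i ∈ R) : r.roots ⊆ R := by
  rintro - ⟨-, ⟨i, rfl⟩, rfl⟩
  refine b.induction_reflect i (p := fun i => r.f (P.root i) ∈ R) ?_ ?_ ?_
  · intro i hi
    simpa using h2 _ hi
  · intro s hs
    obtain ⟨j, hj, rfl⟩ := r.exists_eq hs
    rw [r.map_root j hj]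
    exact h1 j hj
  · intro i s hi hs
    obtain ⟨j, hj, rfl⟩ := r.exists_eq hs
    rw [P.root_reflectionPerm, r.f_reflection hj]
    exact h3 j hj _ hi

/-- This is `omega_eq_of_forall` in coordinates: it suffices to produce a map induced by the Weyl
group and to inspect the images of the simple roots. -/
theorem f_omega {T : V → V} (hT : r.Acts T) {j : ℕ} (hj : j ∈ Icc 1 ℓ)
    (h : ∀ i ∈ Icc 1 ℓ, (∃ k ∈ Icc 1 ℓ, k ≠ j ∧ T (r.a i) = r.a k) ∨ r.k j (T (r.a i)) < 0)
    (x : M) : r.f (omega b (α j) x) = T (r.f x) := by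
  obtain ⟨w, hw, hT⟩ := hT
  rw [omega_eq_of_forall ⟨α j, r.mem_support hj⟩ hw, hT]
  intro s hs
  obtain ⟨i, hi, rfl⟩ := r.exists_eq hs
  refine (h i hi).imp ?_ fun h => ?_
  · rintro ⟨k, hk, hkj, hTk⟩
    refine ⟨α k, r.mem_support hk, fun h => hkj (r.bijOn.injOn hk hj h), r.f_injective ?_⟩
    rw [hT, r.map_root i hi, r.map_root k hk, hTk]
  · rwa [r.coord_apply hj, hT, r.map_root i hi]

variable [Nonempty ι]

-- `highestRoot` is a chosen root of maximal height; strict maximality of `v₀` leaves only one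
-- choice.
omit [P.IsRootSystem] [P.IsCrystallographic] [P.IsReduced] in
theorem f_highestRoot {v₀ : V} (h0 : v₀ ∈ r.roots) (h : ∀ v ∈ r.roots, v = v₀ ∨ r.ht v < r.ht v₀) :
    r.f (P.root (highestRoot b)) = v₀ := by
  obtain ⟨-, ⟨i, rfl⟩, rfl⟩ := h0
  refine (h _ (r.f_root_mem _)).resolve_right ?_
  have : b.height i ≤ b.height (highestRoot b) := (Finite.exists_max b.height).choose_spec i
  rw [r.ht_f_root, r.ht_f_root, Int.cast_lt]
  omega

omit [P.IsCrystallographic] [P.IsReduced] in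
theorem minuscule_eq {v₀ : V} (h : r.f (P.root (highestRoot b)) = v₀) :
    minuscule b = α '' {j ∈ Icc 1 ℓ | r.k j v₀ = 1} := by
  ext s
  constructor
  · rintro ⟨hs, h1⟩
    obtain ⟨j, hj, rfl⟩ := r.exists_eq hs
    rw [r.coord_apply hj, h] at h1
    exact ⟨j, ⟨hj, h1⟩, rfl⟩
  · rintro ⟨j, ⟨hj, h1⟩, rfl⟩
    exact ⟨r.mem_support hj, by rw [r.coord_apply hj, h, h1]⟩

end Finite

-- Needed because `fold` averages over the exact order of `ω`, while in coordinates only some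
-- exponent `m` with `T^m = 1` is at hand.
omit r in
theorem sum_range_mul_of_periodic {A : Type*} [AddCommMonoid A] (g : ℕ → A) {o : ℕ}
    (h : ∀ t, g (t + o) = g t) (q : ℕ) :
    ∑ t ∈ Finset.range (o * q), g t = q • ∑ t ∈ Finset.range o, g t := by
  have h' : ∀ q t, g (o * q + t) = g t := by
    intro q
    induction q with
    | zero => simp
    | succ q ih =>
      intro t
      rw [← ih t, ← h (o * q + t)]
      congr 1
      ring
  induction q with
  | zero => simp
  | succ q ih =>
    rw [mul_add, mul_one, Finset.sum_range_add, ih, succ_nsmul]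
    simp [h']

variable [P.IsRootSystem] {ω : M ≃ₗ[ℝ] M} {T : V → V} {m : ℕ}

omit [P.IsRootSystem] in
theorem f_pow (hω : ∀ x, r.f (ω x) = T (r.f x)) (t : ℕ) (x : M) :
    r.f ((ω ^ t) x) = T^[t] (r.f x) := by
  induction t generalizing x with
  | zero => rfl
  | succ t ih => rw [pow_succ, LinearEquiv.mul_apply, ih, hω, Function.iterate_succ_apply]

theorem pow_eq_one (hω : ∀ x, r.f (ω x) = T (r.f x)) (hm : ∀ x, T^[m] (r.f x) = r.f x) :
    ω ^ m = 1 := by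
  ext x
  apply r.f_injective
  rw [r.f_pow hω, hm]
  rfl

/-- The sum over `m` steps is a positive multiple of the sum over one period, so the two vanish
together; the exact order of `ω` need not be known. -/
theorem fold_eq_zero_iff (hω : ∀ x, r.f (ω x) = T (r.f x)) (hm0 : 0 < m)
    (hm : ∀ x, T^[m] (r.f x) = r.f x) (x : M) :
    fold ω x = 0 ↔ ∑ t ∈ Finset.range m, T^[t] (r.f x) = 0 := by
  have h1 := r.pow_eq_one hω hm
  have ho : 0 < orderOf ω := (isOfFinOrder_iff_pow_eq_one.mpr ⟨m, hm0, h1⟩).orderOf_pos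
  -- The terms for `t = 0` and for `t` equal to the order coincide, so the range of summation may be
  -- shifted by one.
  have h2 : ∑ t ∈ Finset.Icc 1 (orderOf ω), (ω ^ t) x
      = ∑ t ∈ Finset.range (orderOf ω), (ω ^ t) x := by
    have e1 := Finset.sum_range_succ (fun t => (ω ^ t) x) (orderOf ω)
    have e2 := Finset.sum_range_succ' (fun t => (ω ^ t) x) (orderOf ω)
    rw [e1, pow_orderOf_eq_one, pow_zero] at e2
    rw [add_right_cancel e2, Finset.range_eq_Ico, Finset.sum_Ico_add'
      (fun t => (ω ^ t) x) 0 (orderOf ω) 1]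
    rfl
  obtain ⟨q, hq⟩ := orderOf_dvd_of_pow_eq_one h1
  have hq0 : q ≠ 0 := by
    rintro rfl
    omega
  have h3 := sum_range_mul_of_periodic (fun t => (ω ^ t) x) (o := orderOf ω)
    (fun t => by rw [pow_add, pow_orderOf_eq_one, mul_one]) q
  rw [← hq] at h3
  have h4 : r.f (∑ t ∈ Finset.range m, (ω ^ t) x) = ∑ t ∈ Finset.range m, T^[t] (r.f x) := by
    rw [map_sum]
    exact Finset.sum_congr rfl fun t _ => r.f_pow hω t x
  rw [← h4, map_eq_zero_iff _ r.f_injective, h3, fold, h2, smul_eq_zero_iff_right (by positivity),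
    ← Nat.cast_smul_eq_nsmul ℝ, smul_eq_zero_iff_right (by positivity)]

theorem mem_disappearing_iff (hω : ∀ x, r.f (ω x) = T (r.f x)) (hm0 : 0 < m)
    (hm : ∀ x, T^[m] (r.f x) = r.f x) {x : M} :
    x ∈ disappearing b ω ↔
      r.f x ∈ r.roots ∧ 0 < r.ht (r.f x) ∧ ∑ t ∈ Finset.range m, T^[t] (r.f x) = 0 := by
  constructor
  · rintro ⟨i, hi, rfl, h⟩
    exact ⟨r.f_root_mem i, r.isPos_iff.mp hi, (r.fold_eq_zero_iff hω hm0 hm _).mp h⟩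
  · rintro ⟨⟨-, ⟨i, rfl⟩, hi⟩, h1, h2⟩
    have := r.f_injective hi
    subst this
    exact ⟨i, r.isPos_iff.mpr h1, rfl, (r.fold_eq_zero_iff hω hm0 hm _).mpr h2⟩

/-- The definition runs over integral powers of `ω`; as `ω ^ m = 1`, the exponents below `m` already
give the whole orbit of `α_0`, which makes the index set `S` computable. -/
theorem pairingPiZero_apply [Finite ι] [Nonempty ι] (hω : ∀ x, r.f (ω x) = T (r.f x)) (hm0 : 0 < m)
    (hm : ∀ x, T^[m] (r.f x) = r.f x) {v₀ : V} (h0 : r.f (P.root (highestRoot b)) = v₀)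
    {S : Finset ℕ} (hS : ∀ s, s ∈ S ↔ s ∈ Icc 1 ℓ ∧ ∃ t < m, T^[t] (-v₀) = r.a s) (x : M) :
    pairingPiZero b ω x = ∑ s ∈ S, r.k s (r.f x) := by
  classical
  have h1 := r.pow_eq_one hω hm
  have key : ∀ s ∈ Icc 1 ℓ, (∃ t : ℤ, (ω ^ t) (-P.root (highestRoot b)) = P.root (α s)) ↔
      ∃ t < m, T^[t] (-v₀) = r.a s := by
    intro s hs
    have e : ∀ t : ℕ, (ω ^ t) (-P.root (highestRoot b)) = P.root (α s) ↔ T^[t] (-v₀) = r.a s := by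
      intro t
      rw [← r.f_injective.eq_iff, r.f_pow hω, r.map_root s hs, map_neg, h0]
    constructor
    · rintro ⟨t, ht⟩
      have hpos : (0 : ℤ) < m := by exact_mod_cast hm0
      have hn := Int.emod_nonneg t hpos.ne'
      have hl := Int.emod_lt_of_pos t hpos
      refine ⟨(t % m).toNat, by omega, (e _).mp ?_⟩
      rw [← zpow_natCast, Int.toNat_of_nonneg hn, ← ht]
      congr 1
      rw [Int.emod_def, zpow_sub, zpow_mul, zpow_natCast, h1, one_zpow, inv_one, mul_one]
    · rintro ⟨t, -, ht⟩
      exact ⟨t, by rw [zpow_natCast]; exact (e t).mpr ht⟩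
  unfold pairingPiZero
  rw [LinearMap.sum_apply]
  symm
  refine Finset.sum_bij
    (fun s hs => ⟨⟨α s, r.mem_support ((hS s).mp hs).1⟩,
      (key s ((hS s).mp hs).1).mpr ((hS s).mp hs).2⟩) (fun _ _ => Finset.mem_univ _) ?_ ?_ ?_
  · intro s hs t ht h
    simp only [Subtype.mk.injEq] at h
    exact r.bijOn.injOn ((hS s).mp hs).1 ((hS t).mp ht).1 h
  · rintro ⟨⟨s, hs⟩, h⟩ -
    obtain ⟨i, hi, rfl⟩ := r.exists_eq hs
    exact ⟨i, (hS i).mpr ⟨hi, (key i hi).mp h⟩, rfl⟩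
  · intro s hs
    exact (r.coord_apply ((hS s).mp hs).1 x).symm

/-- The orbit of `α_0` has only the members `α_0` and `T(α_0) = α_j`, and the first is not simple.
So `π_0` is the single coweight `ϖ_j^∨`. -/
theorem pairingPiZero_of_involutive [Finite ι] [Nonempty ι] (hω : ∀ x, r.f (ω x) = T (r.f x))
    (hT : Function.Involutive T) {v₀ : V} (h0 : r.f (P.root (highestRoot b)) = v₀) {j : ℕ}
    (hj : j ∈ Icc 1 ℓ) (hTj : T (-v₀) = r.a j) (x : M) :
    pairingPiZero b ω x = r.k j (r.f x) := by
  rw [r.pairingPiZero_apply (m := 2) hω two_pos (fun x => hT _) h0 (S := {j}),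
    Finset.sum_singleton]
  intro s
  rw [Finset.mem_singleton]
  constructor
  · rintro rfl
    exact ⟨hj, 1, one_lt_two, hTj⟩
  · rintro ⟨hs, t, ht, hts⟩
    interval_cases t
    -- `α_0` has negative height, whereas simple roots have height 1.
    · exfalso
      have h1 := r.ht_a hs
      have h2 : b.height (α s) ≤ b.height (highestRoot b) :=
        (Finite.exists_max b.height).choose_spec (α s)
      rw [RootPairing.Base.height_one_of_mem_support (r.mem_support hs)] at h2
      rw [← hts, Function.iterate_zero, id, map_neg, ← h0, r.ht_f_root] at h1
      have h3 : (1 : ℝ) ≤ b.height (highestRoot b) := by exact_mod_cast h2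
      linarith
    · rw [Function.iterate_one, hTj] at hts
      exact (r.a_injOn hj hs hts).symm

end Realization

/-- The roots with zero average are closed under negation, so `P(0)` is determined by the positive
ones up to sign. -/
theorem mem_extraSet_zero_iff [Finite ι] [Nonempty ι] [P.IsRootSystem] {ω : M ≃ₗ[ℝ] M} {p : ℤ} :
    p ∈ extraSet b ω 0 ↔
      ∃ x ∈ disappearing b ω, pairingPiZero b ω x = p ∨ pairingPiZero b ω x = -p := by
  have hf : ∀ x, fold ω (-x) = -fold ω x := by
    intro x
    simp [fold]
  constructor
  · rintro ⟨i, h1, h2⟩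
    by_cases hi : b.IsPos i
    · exact ⟨_, ⟨i, hi, rfl, h1⟩, .inl h2⟩
    · obtain ⟨j, hj, hji⟩ := exists_isPos_root_eq_neg hi
      exact ⟨_, ⟨j, hj, rfl, by rw [hji, hf, h1, neg_zero]⟩, .inr (by rw [hji, map_neg, h2])⟩
  · rintro ⟨-, ⟨i, hi, rfl, h1⟩, h2 | h2⟩
    · exact ⟨i, h1, h2⟩
    · obtain ⟨j, hj⟩ := exists_root_eq_neg P i
      exact ⟨j, by rw [hj, hf, h1, neg_zero], by rw [hj, map_neg, h2, neg_neg]⟩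

theorem extraSet_zero_eq_of_forall [Finite ι] [Nonempty ι] [P.IsRootSystem] {ω : M ≃ₗ[ℝ] M}
    (hne : (disappearing b ω).Nonempty) (h : ∀ x ∈ disappearing b ω, pairingPiZero b ω x = 1) :
    extraSet b ω 0 = {1, -1} := by
  ext p
  rw [mem_extraSet_zero_iff, mem_insert_iff, mem_singleton_iff]
  constructor
  · rintro ⟨x, hx, hp⟩
    rw [h x hx] at hp
    exact hp.imp (fun hp => by exact_mod_cast hp.symm)
      fun hp => by rw [← neg_eq_iff_eq_neg]; exact_mod_cast hp.symm
  · obtain ⟨x, hx⟩ := hne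
    rintro (rfl | rfl)
    · exact ⟨x, hx, .inl (by rw [h x hx]; simp)⟩
    · exact ⟨x, hx, .inr (by rw [h x hx]; simp)⟩

/-- A string of consecutive simple roots telescopes. The bound `p ≤ q + 1` admits the empty string,
with value `0`. The map `g` is arbitrary because the formula serves both the internal realization
and the given maps to `ℝⁿ`. -/
theorem map_str {W : Type*} [AddCommGroup W] [Module ℝ W] (g : M →ₗ[ℝ] W) (u : ℕ → W) {p q : ℕ}
    (hpq : p ≤ q + 1) (h : ∀ i, p ≤ i → i ≤ q → g (P.root (α i)) = u i - u (i + 1)) :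
    g (str P α p q) = u p - u (q + 1) := by
  have := Finset.sum_Ico_sub u hpq
  rw [Finset.Ico_add_one_right_eq_Icc] at this
  rw [str, map_sum, Finset.sum_congr rfl fun i hi =>
    h i (Finset.mem_Icc.mp hi).1 (Finset.mem_Icc.mp hi).2, ← neg_sub (u (q + 1)), ← this,
    ← Finset.sum_neg_distrib]
  simp

section Swap

variable {X : Type*} [DecidableEq X] (r : Realization b ℓ α (X → ℝ))

/-- Transpositions of neighbours are simple reflections, and conjugating by neighbours gives the
rest. The bound `n ≤ ℓ + 1` covers type A, where there is one more coordinate than simple roots. -/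
theorem Realization.acts_swap [P.IsRootSystem] {n : ℕ} {u : ℕ → X} (hu : InjOn u (Icc 1 n))
    (hn : n ≤ ℓ + 1)
    (ha : ∀ i, 1 ≤ i → i < n → r.a i = Pi.single (u i) 1 - Pi.single (u (i + 1)) 1)
    (hc : ∀ i, 1 ≤ i → i < n → ∀ v, r.c i v = v (u i) - v (u (i + 1)))
    {p q : ℕ} (hp : p ∈ Icc 1 n) (hq : q ∈ Icc 1 n) :
    r.Acts fun v => v ∘ Equiv.swap (u p) (u q) := by
  have h1 : ∀ i, 1 ≤ i → i < n → r.Acts fun v => v ∘ Equiv.swap (u i) (u (i + 1)) := by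
    intro i hi hin
    have hne : u i ≠ u (i + 1) := fun h => by
      have := hu ⟨hi, hin.le⟩ ⟨by omega, hin⟩ h
      omega
    convert r.acts_reflection (i := i) ⟨hi, by omega⟩ using 1
    funext v x
    rw [ha i hi hin, hc i hi hin]
    simp only [Function.comp_apply, Equiv.swap_apply_def, Pi.sub_apply, Pi.smul_apply,
      Pi.single_apply, smul_eq_mul]
    split_ifs with h h' <;> simp_all
  have h2 : ∀ p q, 1 ≤ p → p < q → q ≤ n → r.Acts fun v => v ∘ Equiv.swap (u p) (u q) := by
    intro p q hp hpq
    induction q, hpq using Nat.le_induction with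
    | base => exact fun h => h1 p hp h
    | succ q hpq ih =>
      intro hqn
      have s1 := h1 q (by omega) hqn
      have := Realization.Acts.comp (Realization.Acts.comp s1 (ih (by omega))) s1
      convert this using 1
      funext v
      have hne1 : u p ≠ u q := fun h => by
        have := hu ⟨hp, by omega⟩ ⟨by omega, by omega⟩ h
        omega
      have hne2 : u p ≠ u (q + 1) := fun h => by
        have := hu ⟨hp, by omega⟩ ⟨by omega, by omega⟩ h
        omega
      rw [Equiv.swap_comm (u p) (u (q + 1)), ← Equiv.swap_mul_swap_mul_swap hne1 hne2]
      rfl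
  rcases lt_trichotomy p q with h | rfl | h
  · exact h2 p q hp.1 h hq.2
  · convert Realization.acts_id (r := r) using 1
    funext v
    simp
  · rw [Equiv.swap_comm]
    exact h2 q p hq.1 h hp.2

end Swap

end Realization

end Folding

namespace Folding

open Set Matrix

/-! ### Simply laced systems by integral coefficient vectors -/

section SimplyLaced

/-- The simple reflection `s_l` on integral coefficient vectors. -/
def simpleReflect {ℓ : ℕ} (C : Matrix (Fin ℓ) (Fin ℓ) ℤ) (l : Fin ℓ) (z : Fin ℓ → ℤ) : Fin ℓ → ℤ :=
  fun i => z i - (if i = l then (C *ᵥ z) l else 0)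

/-- The matrix of the reflection in the root with coefficient vector `β`. -/
def rootReflection {ℓ : ℕ} (C : Matrix (Fin ℓ) (Fin ℓ) ℤ) (β : Fin ℓ → ℤ) :
    Matrix (Fin ℓ) (Fin ℓ) ℤ :=
  1 - vecMulVec β (C *ᵥ β)

/-- `L` consists of the coefficient vectors of the positive roots. -/
structure IsPosRootList {ℓ : ℕ} (C : Matrix (Fin ℓ) (Fin ℓ) ℤ) (L : List (Fin ℓ → ℤ)) : Prop where
  single_mem : ∀ l, Pi.single l 1 ∈ L
  reflect_mem : ∀ z ∈ L, ∀ l, simpleReflect C l z ∈ L ∨ -simpleReflect C l z ∈ L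
  descend : ∀ z ∈ L, ∃ l, z = Pi.single l 1 ∨ simpleReflect C l z ∈ L ∧
    ∑ i, simpleReflect C l z i < ∑ i, z i
  sum_pos : ∀ z ∈ L, 0 < ∑ i, z i

variable {ι M N : Type*} [AddCommGroup M] [Module ℝ M] [AddCommGroup N] [Module ℝ N]
variable {P : RootPairing ι ℝ M N} [P.IsCrystallographic] [P.IsRootSystem]
variable {b : P.Base} {ℓ : ℕ} {α : ℕ → ι} {C : Matrix (Fin ℓ) (Fin ℓ) ℤ}

/-- The real vector with the given integral coordinates. -/
def toReal (z : Fin ℓ → ℤ) : Fin ℓ → ℝ := fun i => z i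

theorem toReal_injective : Function.Injective (toReal (ℓ := ℓ)) := fun z z' h => by
  funext i
  exact Int.cast_injective (congrFun h i)

theorem toReal_neg (z : Fin ℓ → ℤ) : toReal (-z) = -toReal z := by
  funext i
  simp [toReal]

theorem toReal_mulVec (A : Matrix (Fin ℓ) (Fin ℓ) ℤ) (z : Fin ℓ → ℤ) :
    toReal (A *ᵥ z) = A.map (Int.cast : ℤ → ℝ) *ᵥ toReal z := by
  funext i
  simp [toReal, mulVec, dotProduct]

theorem toReal_single (l : Fin ℓ) : toReal (Pi.single l 1) = Pi.single l 1 := by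
  funext i
  simp only [toReal, Pi.single_apply]
  split_ifs <;> simp

/-- The realization by coefficient vectors. -/
noncomputable def IsLabelling.coefRealization (h : IsLabelling b C α) :
    Realization b ℓ α (Fin ℓ → ℝ) :=
  h.realization (fun i j => if (j : ℕ) + 1 = i then 1 else 0)
    (fun i => ∑ j : Fin ℓ, if (j : ℕ) + 1 = i then LinearMap.proj j else 0)
    (fun i => ∑ j : Fin ℓ, ∑ l : Fin ℓ, if (l : ℕ) + 1 = i then (C j l : ℝ) • LinearMap.proj j else 0)
    (by
      intro i hi j hj
      simp only [LinearMap.sum_apply]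
      rw [Finset.sum_eq_single ⟨i - 1, by have := hi.1; have := hi.2; omega⟩]
      · simp only [Nat.sub_add_cancel hi.1, if_true, LinearMap.proj_apply]
      · intro l _ hl
        have : (l : ℕ) + 1 ≠ i := fun h => hl (Fin.ext (by simp only; omega))
        simp [this]
      · simp)
    (by
      intro i j
      simp only [LinearMap.sum_apply]
      rw [Finset.sum_eq_single i, Finset.sum_eq_single j]
      · simp
      · intro l _ hl
        have : (l : ℕ) + 1 ≠ j + 1 := fun h => hl (Fin.ext (by omega))
        rw [if_neg this, LinearMap.zero_apply]
      · simp
      · intro l _ hl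
        have : (l : ℕ) ≠ i := fun h => hl (Fin.ext h)
        refine Finset.sum_eq_zero fun l' _ => ?_
        split_ifs <;> simp [this]
      · simp)

variable (h : IsLabelling b C α)

theorem coefRealization_a (l : Fin ℓ) : h.coefRealization.a (l + 1) = toReal (Pi.single l 1) := by
  funext j
  rw [toReal_single]
  simp [IsLabelling.coefRealization, IsLabelling.realization, Pi.single_apply, Fin.ext_iff]

theorem coefRealization_k (l : Fin ℓ) (v : Fin ℓ → ℝ) : h.coefRealization.k (l + 1) v = v l := by
  simp only [IsLabelling.coefRealization, IsLabelling.realization, LinearMap.sum_apply]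
  rw [Finset.sum_eq_single l]
  · simp
  · intro i _ hi
    have : (i : ℕ) + 1 ≠ l + 1 := fun h => hi (Fin.ext (by omega))
    rw [if_neg this, LinearMap.zero_apply]
  · simp

theorem coefRealization_c (hC : C.IsSymm) (l : Fin ℓ) (v : Fin ℓ → ℝ) :
    h.coefRealization.c (l + 1) v = (C.map (Int.cast : ℤ → ℝ) *ᵥ v) l := by
  simp only [IsLabelling.coefRealization, IsLabelling.realization, LinearMap.sum_apply]
  refine Finset.sum_congr rfl fun i _ => ?_
  rw [Finset.sum_eq_single l]
  · simp [hC.apply i l]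
  · intro i _ hi
    have : (i : ℕ) + 1 ≠ l + 1 := fun h => hi (Fin.ext (by omega))
    rw [if_neg this, LinearMap.zero_apply]
  · simp

theorem exists_fin_succ_eq {i : ℕ} (hi : i ∈ Icc 1 ℓ) : ∃ l : Fin ℓ, (l : ℕ) + 1 = i :=
  ⟨⟨i - 1, by have := hi.1; have := hi.2; omega⟩, Nat.sub_add_cancel hi.1⟩

theorem fin_succ_mem (l : Fin ℓ) : (l : ℕ) + 1 ∈ Icc 1 ℓ := ⟨by omega, by omega⟩

theorem coefRealization_ht (z : Fin ℓ → ℤ) :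
    h.coefRealization.ht (toReal z) = ((∑ i, z i : ℤ) : ℝ) := by
  simp only [Realization.ht, LinearMap.sum_apply]
  rw [Int.cast_sum, ← Finset.Ico_add_one_right_eq_Icc, Finset.sum_Ico_eq_sum_range,
    Finset.sum_range]
  refine Finset.sum_congr rfl fun i _ => ?_
  rw [add_comm, coefRealization_k]
  rfl

theorem toReal_simpleReflect (hC : C.IsSymm) (l : Fin ℓ) (z : Fin ℓ → ℤ) :
    toReal (simpleReflect C l z) = toReal z -
      h.coefRealization.c (l + 1) (toReal z) • h.coefRealization.a (l + 1) := by
  funext i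
  rw [coefRealization_c h hC, coefRealization_a, ← toReal_mulVec]
  simp only [toReal, simpleReflect, Pi.sub_apply, Pi.smul_apply, Pi.single_apply, smul_eq_mul]
  split_ifs <;> simp

variable [Finite ι] [P.IsReduced]

/-- Closure of `±L` under simple reflections bounds the roots from above. Conversely `descend`
lowers each non-simple vector of `L` by a simple reflection to another one with smaller coefficient
sum, so induction on that sum shows that it is a root. -/
theorem coefRealization_roots (hC : C.IsSymm) {L : List (Fin ℓ → ℤ)} (hL : IsPosRootList C L) :
    h.coefRealization.roots = {v | ∃ z, (z ∈ L ∨ -z ∈ L) ∧ v = toReal z} := by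
  apply subset_antisymm
  · refine h.coefRealization.roots_subset ?_ ?_ ?_
    · intro i hi
      obtain ⟨l, rfl⟩ := exists_fin_succ_eq hi
      exact ⟨_, .inl (hL.single_mem l), coefRealization_a h l⟩
    · rintro - ⟨z, hz, rfl⟩
      exact ⟨-z, by rwa [neg_neg, or_comm], (toReal_neg z).symm⟩
    · rintro i hi - ⟨z, hz, rfl⟩
      obtain ⟨l, rfl⟩ := exists_fin_succ_eq hi
      refine ⟨simpleReflect C l z, ?_, (toReal_simpleReflect h hC l z).symm⟩
      have hneg : ∀ z, simpleReflect C l (-z) = -simpleReflect C l z := by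
        intro z
        funext i
        simp only [simpleReflect, mulVec_neg, Pi.neg_apply]
        split_ifs <;> ring
      rcases hz with hz | hz
      · exact hL.reflect_mem z hz l
      · have := hL.reflect_mem _ hz l
        rwa [hneg, neg_neg, or_comm] at this
  · have key : ∀ n : ℕ, ∀ z ∈ L, ∑ i, z i ≤ n → toReal z ∈ h.coefRealization.roots := by
      intro n
      induction n with
      | zero =>
        intro z hz hn
        have := hL.sum_pos z hz
        simp at hn
        omega
      | succ n ih =>
        intro z hz hn
        obtain ⟨l, rfl | ⟨h1, h2⟩⟩ := hL.descend z hz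
        · rw [← coefRealization_a h l]
          exact h.coefRealization.a_mem_roots (fin_succ_mem l)
        · have h3 := ih _ h1 (by push_cast at hn; omega)
          have h4 := (h.coefRealization.acts_reflection (fin_succ_mem l)).mem_roots h3
          rw [← toReal_simpleReflect h hC] at h4
          -- A reflection reverses the pairing with its own coroot, so reflecting `s_l z` once more
          -- gives back `z`.
          have h5 : (C *ᵥ simpleReflect C l z) l = -(C *ᵥ z) l := by
            have e : simpleReflect C l z = z - (C *ᵥ z) l • Pi.single l 1 := by
              funext i
              simp only [simpleReflect, Pi.sub_apply, Pi.smul_apply, Pi.single_apply, smul_eq_mul]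
              split_ifs <;> simp
            have e2 : C l l = 2 := by rw [← h.pairing l l]; simp
            rw [e, mulVec_sub, mulVec_smul, mulVec_single_one]
            simp [e2]
            ring
          convert h4 using 2
          funext i
          rw [simpleReflect, h5, simpleReflect]
          split_ifs <;> ring
    rintro - ⟨z, hz | hz, rfl⟩
    · exact key (∑ i, z i).toNat z hz (Int.self_le_toNat _)
    · have := h.coefRealization.neg_mem_roots (key (∑ i, (-z) i).toNat _ hz (Int.self_le_toNat _))
      rwa [toReal_neg, neg_neg] at this

/-- A symmetric Cartan matrix is itself the Gram matrix of an invariant form in which all roots have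
square 2. Hence pairing with the coroot of any root, not just a simple one, is the inner product
with that root; the formula spreads from simple roots by simple reflections. -/
theorem toLinearMap_coroot_eq (hC : C.IsSymm) (m : ι) (x : M) :
    P.toLinearMap x (P.coroot m) = h.coefRealization.f x ⬝ᵥ
      (C.map (Int.cast : ℤ → ℝ) *ᵥ h.coefRealization.f (P.root m)) := by
  set r := h.coefRealization
  set D := C.map (Int.cast : ℤ → ℝ)
  have hD : Dᵀ = D := by
    ext i j
    simp [D, hC.apply i j]
  have hsymm : ∀ v w : Fin ℓ → ℝ, v ⬝ᵥ D *ᵥ w = w ⬝ᵥ D *ᵥ v := by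
    intro v w
    rw [dotProduct_mulVec, ← mulVec_transpose, hD, dotProduct_comm]
  have hs : ∀ s ∈ b.support, ∀ x, P.toLinearMap x (P.coroot s) = r.f x ⬝ᵥ (D *ᵥ r.f (P.root s)) := by
    intro s hs x
    obtain ⟨j, hj, rfl⟩ := r.exists_eq hs
    obtain ⟨l, rfl⟩ := exists_fin_succ_eq hj
    rw [r.toLinearMap_coroot hj, r.map_root _ hj, coefRealization_c h hC, coefRealization_a h,
      toReal_single, hsymm, single_one_dotProduct]
  refine b.induction_reflect m (p := fun m => ∀ x, P.toLinearMap x (P.coroot m) =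
    r.f x ⬝ᵥ (D *ᵥ r.f (P.root m))) ?_ hs ?_ x
  · intro i hi x
    simp [hi, mulVec_neg]
  · intro i s hi hs' x
    have h1 := P.coroot'_reflection (i := s) (j := i) x
    change P.toLinearMap _ _ = P.toLinearMap _ _ at h1
    have h2 : r.f (P.root s) ⬝ᵥ D *ᵥ r.f (P.root s) = 2 := by
      rw [← hs s hs']
      simp
    rw [← h1, hi, P.root_reflectionPerm, P.reflection_apply, P.reflection_apply]
    have h3 := hs s hs' x
    have h4 := hs s hs' (P.root i)
    change P.toLinearMap x (P.coroot s) = _ at h3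
    change P.toLinearMap (P.root i) (P.coroot s) = _ at h4
    simp only [map_sub, map_smul, sub_dotProduct, smul_dotProduct, dotProduct_sub, mulVec_sub,
      mulVec_smul, dotProduct_smul, smul_eq_mul, LinearMap.flip_apply, h3, h4,
      hsymm (r.f (P.root s)) (r.f (P.root i))]
    ring

/-- Reflecting a root by `s_j` conjugates its reflection by `s_j`. -/
theorem reflection_mem_reflectionGroup_support (m : ι) :
    P.reflection m ∈ reflectionGroup P (b.support : Set ι) := by
  refine b.induction_reflect m (p := fun m => P.reflection m ∈ reflectionGroup P b.support) ?_ ?_ ?_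
  · intro i hi
    rw [P.reflection_reflectionPerm]
    exact mul_mem (mul_mem hi hi) hi
  · exact fun i hi => reflection_mem_reflectionGroup hi
  · intro i j hi hj
    rw [P.reflection_reflectionPerm]
    have := reflection_mem_reflectionGroup (P := P) (K := (b.support : Set ι)) hj
    exact mul_mem (mul_mem this hi) this

/-- This allows `ω_j` to be certified as a short product of reflections in arbitrary roots instead
of a long word in simple reflections. -/
theorem acts_rootReflection (hC : C.IsSymm) {z : Fin ℓ → ℤ}
    (hz : toReal z ∈ h.coefRealization.roots) :
    h.coefRealization.Acts fun v => (rootReflection C z).map (Int.cast : ℤ → ℝ) *ᵥ v := by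
  obtain ⟨-, ⟨i, rfl⟩, hi⟩ := hz
  refine ⟨P.reflection i, reflection_mem_reflectionGroup_support i, fun x => ?_⟩
  rw [P.reflection_apply, map_sub, map_smul]
  change _ - P.toLinearMap x (P.coroot i) • _ = _
  rw [toLinearMap_coroot_eq h hC, hi, ← toReal_mulVec]
  have e : (rootReflection C z).map (Int.cast : ℤ → ℝ)
      = 1 - vecMulVec (toReal z) (toReal (C *ᵥ z)) := by
    ext i j
    simp [rootReflection, vecMulVec_apply, toReal, Matrix.one_apply]
  simp only [e, sub_mulVec, one_mulVec, vecMulVec_mulVec]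
  rw [dotProduct_comm]
  simp

end SimplyLaced

end Folding

namespace Folding

open Set Matrix

/-! ### Consequences of a finite certificate for `ω_j` -/

section FoldingData

/-- The highest root `z₀` in a list of positive roots. -/
structure IsHighest {ℓ : ℕ} (L : List (Fin ℓ → ℤ)) (z₀ : Fin ℓ → ℤ) : Prop where
  mem : z₀ ∈ L
  lt : ∀ z ∈ L, z = z₀ ∨ ∑ i, z i < ∑ i, z₀ i

/-- The matrix `A` of `ω_j`, of order dividing `m`, together with the list `D` of the coefficient
vectors of the positive roots that disappear and the set `S` of the simple roots in the orbit of
`α_0`. -/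
structure FoldingData {ℓ : ℕ} (C : Matrix (Fin ℓ) (Fin ℓ) ℤ) (L : List (Fin ℓ → ℤ))
    (z₀ : Fin ℓ → ℤ) (j : Fin ℓ) (A : Matrix (Fin ℓ) (Fin ℓ) ℤ) (m : ℕ) (D : List (Fin ℓ → ℤ))
    (S : Finset (Fin ℓ)) : Prop where
  pos : 0 < m
  pow_eq_one : ∀ i, (A *ᵥ ·)^[m] (Pi.single i 1) = Pi.single i 1
  exists_list : ∃ l : List (Fin ℓ → ℤ), (∀ β ∈ l, β ∈ L) ∧ (l.map (rootReflection C)).prod = A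
  simple : ∀ i, (∃ k, k ≠ j ∧ A *ᵥ Pi.single i 1 = Pi.single k 1) ∨ (A *ᵥ Pi.single i 1) j < 0
  mem_iff : ∀ z ∈ L, ∑ t ∈ Finset.range m, (A *ᵥ ·)^[t] z = 0 ↔ z ∈ D
  subset : ∀ z ∈ D, z ∈ L
  orbit : ∀ s, s ∈ S ↔ ∃ t ∈ Finset.range m, (A *ᵥ ·)^[t] (-z₀) = Pi.single s 1

variable {ι M N : Type*} [AddCommGroup M] [Module ℝ M] [AddCommGroup N] [Module ℝ N]
variable {P : RootPairing ι ℝ M N} [P.IsCrystallographic] [P.IsRootSystem] [Finite ι] [P.IsReduced]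
variable {b : P.Base} {ℓ : ℕ} {α : ℕ → ι} {C : Matrix (Fin ℓ) (Fin ℓ) ℤ} {L : List (Fin ℓ → ℤ)}

theorem coefRealization_highestRoot [Nonempty ι] (h : IsLabelling b C α) (hC : C.IsSymm)
    (hL : IsPosRootList C L) {z₀ : Fin ℓ → ℤ} (h0 : IsHighest L z₀) :
    h.coefRealization.f (P.root (highestRoot b)) = toReal z₀ := by
  have hroots := coefRealization_roots h hC hL
  refine h.coefRealization.f_highestRoot (hroots ▸ ⟨z₀, .inl h0.mem, rfl⟩) fun v hv => ?_
  rw [hroots] at hv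
  obtain ⟨z, hz | hz, rfl⟩ := hv
  · rw [coefRealization_ht, coefRealization_ht, Int.cast_lt]
    exact (h0.lt z hz).imp (congrArg toReal) id
  · right
    rw [coefRealization_ht, coefRealization_ht, Int.cast_lt]
    have h1 := hL.sum_pos _ hz
    have h2 := hL.sum_pos _ h0.mem
    simp only [Pi.neg_apply, Finset.sum_neg_distrib] at h1
    omega

theorem IsHighest.minuscule_eq [Nonempty ι] (h : IsLabelling b C α) (hC : C.IsSymm)
    (hL : IsPosRootList C L) {z₀ : Fin ℓ → ℤ} (h0 : IsHighest L z₀) :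
    minuscule b = (fun l : Fin ℓ => α (l + 1)) '' {l | z₀ l = 1} := by
  rw [h.coefRealization.minuscule_eq (coefRealization_highestRoot h hC hL h0)]
  ext s
  constructor
  · rintro ⟨j, ⟨hj, h1⟩, rfl⟩
    obtain ⟨l, rfl⟩ := exists_fin_succ_eq hj
    rw [coefRealization_k] at h1
    exact ⟨l, Int.cast_injective (α := ℝ) (by simpa [toReal] using h1), rfl⟩
  · rintro ⟨l, h1, rfl⟩
    refine ⟨_, ⟨fin_succ_mem l, ?_⟩, rfl⟩
    rw [coefRealization_k]
    simpa [toReal] using h1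

theorem f_sum_smul_root (h : IsLabelling b C α) (z : Fin ℓ → ℤ) :
    h.coefRealization.f (∑ l, (z l : ℝ) • P.root (α (l + 1))) = toReal z := by
  rw [map_sum]
  funext i
  rw [Finset.sum_apply, Finset.sum_eq_single i]
  · rw [map_smul, h.coefRealization.map_root _ (fin_succ_mem i), coefRealization_a, toReal_single]
    simp [toReal]
  · intro l _ hl
    rw [map_smul, h.coefRealization.map_root _ (fin_succ_mem l), coefRealization_a, toReal_single]
    simp [hl.symm]
  · simp

theorem acts_list (h : IsLabelling b C α) (hC : C.IsSymm) (hL : IsPosRootList C L)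
    {l : List (Fin ℓ → ℤ)} (hl : ∀ β ∈ l, β ∈ L) :
    h.coefRealization.Acts fun v => (l.map (rootReflection C)).prod.map (Int.cast : ℤ → ℝ) *ᵥ v := by
  induction l with
  | nil =>
    convert Realization.acts_id (r := h.coefRealization) using 1
    funext v
    simp
  | cons β l ih =>
    have h1 := acts_rootReflection h hC (z := β)
      (by rw [coefRealization_roots h hC hL]; exact ⟨β, .inl (hl β (by simp)), rfl⟩)
    convert h1.comp (ih fun β hβ => hl β (by simp [hβ])) using 1
    funext v
    have e : ∀ X Y : Matrix (Fin ℓ) (Fin ℓ) ℤ, (X * Y).map (Int.cast : ℤ → ℝ)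
        = X.map (Int.cast : ℤ → ℝ) * Y.map (Int.cast : ℤ → ℝ) := by
      intro X Y
      ext i j
      simp [Matrix.mul_apply]
    simp only [List.map_cons, List.prod_cons, Function.comp_apply, mulVec_mulVec, e]

namespace FoldingData

variable {z₀ : Fin ℓ → ℤ} {j : Fin ℓ} {A : Matrix (Fin ℓ) (Fin ℓ) ℤ} {m : ℕ}
  {D : List (Fin ℓ → ℤ)} {S : Finset (Fin ℓ)}

theorem f_omega (hF : FoldingData C L z₀ j A m D S) (h : IsLabelling b C α) (hC : C.IsSymm)
    (hL : IsPosRootList C L) (x : M) : h.coefRealization.f (omega b (α (j + 1)) x)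
      = A.map (Int.cast : ℤ → ℝ) *ᵥ h.coefRealization.f x := by
  obtain ⟨l, hl, hA⟩ := hF.exists_list
  have hact := acts_list h hC hL hl
  rw [hA] at hact
  refine h.coefRealization.f_omega hact (fin_succ_mem j) (fun i hi => ?_) x
  obtain ⟨i, rfl⟩ := exists_fin_succ_eq hi
  rw [coefRealization_a, ← toReal_mulVec]
  refine (hF.simple i).imp ?_ fun hlt => ?_
  · rintro ⟨k, hk, hik⟩
    exact ⟨k + 1, fin_succ_mem k, fun h => hk (Fin.ext (by omega)),
      by rw [hik, coefRealization_a]⟩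
  · rw [coefRealization_k]
    exact Int.cast_lt_zero.mpr hlt

omit [Finite ι] [P.IsReduced] in
theorem iterate_toReal (A : Matrix (Fin ℓ) (Fin ℓ) ℤ) (t : ℕ) (z : Fin ℓ → ℤ) :
    (fun v => A.map (Int.cast : ℤ → ℝ) *ᵥ v)^[t] (toReal z) = toReal ((A *ᵥ ·)^[t] z) := by
  induction t generalizing z with
  | zero => rfl
  | succ t ih => rw [Function.iterate_succ_apply, ← toReal_mulVec, ih, Function.iterate_succ_apply]

/-- By linearity it is enough that the power of the matrix fixes the basis vectors. -/
theorem iterate_f (hF : FoldingData C L z₀ j A m D S) (h : IsLabelling b C α) (x : M) :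
    (fun v => A.map (Int.cast : ℤ → ℝ) *ᵥ v)^[m] (h.coefRealization.f x)
      = h.coefRealization.f x := by
  have e : ∀ t, ∀ v, (fun v => A.map (Int.cast : ℤ → ℝ) *ᵥ v)^[t] v
      = (((A.map (Int.cast : ℤ → ℝ)).mulVecLin ^ t : Module.End ℝ (Fin ℓ → ℝ))) v := by
    intro t v
    rw [Module.End.pow_apply]
    rfl
  rw [e]
  have : ((A.map (Int.cast : ℤ → ℝ)).mulVecLin ^ m : Module.End ℝ (Fin ℓ → ℝ)) ∘ₗ
      h.coefRealization.f = h.coefRealization.f := by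
    refine h.coefRealization.linearMap_ext fun i hi => ?_
    obtain ⟨i, rfl⟩ := exists_fin_succ_eq hi
    rw [LinearMap.comp_apply, h.coefRealization.map_root _ hi, coefRealization_a, ← e,
      iterate_toReal, hF.pow_eq_one]
  exact LinearMap.congr_fun this x

theorem disappearing_eq (hF : FoldingData C L z₀ j A m D S) (h : IsLabelling b C α)
    (hC : C.IsSymm) (hL : IsPosRootList C L) : disappearing b (omega b (α (j + 1)))
      = {x | ∃ z ∈ D, x = ∑ l, (z l : ℝ) • P.root (α (l + 1))} := by
  have hsum : ∀ z : Fin ℓ → ℤ, ∑ t ∈ Finset.range m,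
      (fun v => A.map (Int.cast : ℤ → ℝ) *ᵥ v)^[t] (toReal z) = 0 ↔
      ∑ t ∈ Finset.range m, (A *ᵥ ·)^[t] z = 0 := by
    intro z
    rw [← toReal_injective.eq_iff]
    have e1 : toReal (0 : Fin ℓ → ℤ) = 0 := by
      funext i
      simp [toReal]
    have e2 : toReal (∑ t ∈ Finset.range m, (A *ᵥ ·)^[t] z)
        = ∑ t ∈ Finset.range m, toReal ((A *ᵥ ·)^[t] z) := by
      funext i
      simp [toReal]
    rw [e1, e2]
    simp only [iterate_toReal]
  ext x
  rw [h.coefRealization.mem_disappearing_iff (hF.f_omega h hC hL) hF.pos (hF.iterate_f h),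
    coefRealization_roots h hC hL]
  constructor
  · rintro ⟨⟨z, hz, hxz⟩, h1, h2⟩
    rw [hxz, hsum] at h2
    rw [hxz, coefRealization_ht, Int.cast_pos] at h1
    -- A positive coefficient sum excludes the negatives of the members of `L`.
    have hzL : z ∈ L := hz.resolve_right fun hz => by
      have := hL.sum_pos _ hz
      simp only [Pi.neg_apply, Finset.sum_neg_distrib] at this
      omega
    refine ⟨z, (hF.mem_iff z hzL).mp h2, h.coefRealization.f_injective ?_⟩
    rw [hxz, f_sum_smul_root]
  · rintro ⟨z, hz, rfl⟩
    have hzL := hF.subset z hz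
    rw [f_sum_smul_root, coefRealization_ht, Int.cast_pos, hsum]
    exact ⟨⟨z, .inl hzL, rfl⟩, hL.sum_pos z hzL, (hF.mem_iff z hzL).mpr hz⟩

theorem extraSet_eq [Nonempty ι] (hF : FoldingData C L z₀ j A m D S) (h : IsLabelling b C α)
    (hC : C.IsSymm) (hL : IsPosRootList C L) (h0 : IsHighest L z₀) :
    extraSet b (omega b (α (j + 1))) 0
      = {p | ∃ z ∈ D, ∑ s ∈ S, z s = p ∨ ∑ s ∈ S, z s = -p} := by
  have hpair : ∀ z : Fin ℓ → ℤ, pairingPiZero b (omega b (α (j + 1)))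
      (∑ l, (z l : ℝ) • P.root (α (l + 1))) = ((∑ s ∈ S, z s : ℤ) : ℝ) := by
    intro z
    -- `S` consists of indices in `Fin ℓ`, which start at 0, and the labels of simple roots start at
    -- 1; hence the shifted image.
    rw [h.coefRealization.pairingPiZero_apply (hF.f_omega h hC hL) hF.pos (hF.iterate_f h)
      (coefRealization_highestRoot h hC hL h0) (S := S.image fun s : Fin ℓ => (s : ℕ) + 1),
      f_sum_smul_root, Finset.sum_image fun s _ t _ h => Fin.ext (by omega), Int.cast_sum]
    · exact Finset.sum_congr rfl fun s _ => coefRealization_k h s _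
    · intro s
      rw [← toReal_neg]
      simp only [iterate_toReal, Finset.mem_image]
      constructor
      · rintro ⟨s, hs, rfl⟩
        obtain ⟨t, ht, hts⟩ := (hF.orbit s).mp hs
        exact ⟨fin_succ_mem s, t, Finset.mem_range.mp ht, by rw [hts, coefRealization_a]⟩
      · rintro ⟨hs, t, ht, hts⟩
        obtain ⟨s, rfl⟩ := exists_fin_succ_eq hs
        rw [coefRealization_a] at hts
        exact ⟨s, (hF.orbit s).mpr ⟨t, Finset.mem_range.mpr ht, toReal_injective hts⟩, rfl⟩
  ext p
  rw [mem_extraSet_zero_iff, hF.disappearing_eq h hC hL]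
  constructor
  · rintro ⟨-, ⟨z, hz, rfl⟩, hp⟩
    rw [hpair] at hp
    exact ⟨z, hz, by exact_mod_cast hp⟩
  · rintro ⟨z, hz, hp⟩
    refine ⟨_, ⟨z, hz, rfl⟩, ?_⟩
    rw [hpair]
    exact_mod_cast hp

end FoldingData

end FoldingData

end Folding

namespace Folding

open Set Matrix

/-! ### Explicit data for `E₆` and `E₇`, checked by evaluation -/

section Exceptional

/-- The coefficient vectors of the positive roots of type `E₆`. -/
def posRootsE₆ : List (Fin 6 → ℤ) :=
  [![0, 0, 0, 0, 0, 1], ![0, 0, 0, 0, 1, 0], ![0, 0, 0, 1, 0, 0], ![0, 0, 1, 0, 0, 0],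
    ![0, 1, 0, 0, 0, 0], ![1, 0, 0, 0, 0, 0], ![0, 0, 0, 0, 1, 1], ![0, 0, 0, 1, 1, 0],
    ![0, 0, 1, 1, 0, 0], ![0, 1, 0, 1, 0, 0], ![1, 0, 1, 0, 0, 0], ![0, 0, 0, 1, 1, 1],
    ![0, 0, 1, 1, 1, 0], ![0, 1, 0, 1, 1, 0], ![0, 1, 1, 1, 0, 0], ![1, 0, 1, 1, 0, 0],
    ![0, 0, 1, 1, 1, 1], ![0, 1, 0, 1, 1, 1], ![0, 1, 1, 1, 1, 0], ![1, 0, 1, 1, 1, 0],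
    ![1, 1, 1, 1, 0, 0], ![0, 1, 1, 1, 1, 1], ![0, 1, 1, 2, 1, 0], ![1, 0, 1, 1, 1, 1],
    ![1, 1, 1, 1, 1, 0], ![0, 1, 1, 2, 1, 1], ![1, 1, 1, 1, 1, 1], ![1, 1, 1, 2, 1, 0],
    ![0, 1, 1, 2, 2, 1], ![1, 1, 1, 2, 1, 1], ![1, 1, 2, 2, 1, 0], ![1, 1, 1, 2, 2, 1],
    ![1, 1, 2, 2, 1, 1], ![1, 1, 2, 2, 2, 1], ![1, 1, 2, 3, 2, 1], ![1, 2, 2, 3, 2, 1]]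

/-- The coefficient vectors of the positive roots of type `E₇`. -/
def posRootsE₇ : List (Fin 7 → ℤ) :=
  [![0, 0, 0, 0, 0, 0, 1], ![0, 0, 0, 0, 0, 1, 0], ![0, 0, 0, 0, 1, 0, 0], ![0, 0, 0, 1, 0, 0, 0],
    ![0, 0, 1, 0, 0, 0, 0], ![0, 1, 0, 0, 0, 0, 0], ![1, 0, 0, 0, 0, 0, 0], ![0, 0, 0, 0, 0, 1, 1],
    ![0, 0, 0, 0, 1, 1, 0], ![0, 0, 0, 1, 1, 0, 0], ![0, 0, 1, 1, 0, 0, 0], ![0, 1, 0, 1, 0, 0, 0],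
    ![1, 0, 1, 0, 0, 0, 0], ![0, 0, 0, 0, 1, 1, 1], ![0, 0, 0, 1, 1, 1, 0], ![0, 0, 1, 1, 1, 0, 0],
    ![0, 1, 0, 1, 1, 0, 0], ![0, 1, 1, 1, 0, 0, 0], ![1, 0, 1, 1, 0, 0, 0], ![0, 0, 0, 1, 1, 1, 1],
    ![0, 0, 1, 1, 1, 1, 0], ![0, 1, 0, 1, 1, 1, 0], ![0, 1, 1, 1, 1, 0, 0], ![1, 0, 1, 1, 1, 0, 0],
    ![1, 1, 1, 1, 0, 0, 0], ![0, 0, 1, 1, 1, 1, 1], ![0, 1, 0, 1, 1, 1, 1], ![0, 1, 1, 1, 1, 1, 0],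
    ![0, 1, 1, 2, 1, 0, 0], ![1, 0, 1, 1, 1, 1, 0], ![1, 1, 1, 1, 1, 0, 0], ![0, 1, 1, 1, 1, 1, 1],
    ![0, 1, 1, 2, 1, 1, 0], ![1, 0, 1, 1, 1, 1, 1], ![1, 1, 1, 1, 1, 1, 0], ![1, 1, 1, 2, 1, 0, 0],
    ![0, 1, 1, 2, 1, 1, 1], ![0, 1, 1, 2, 2, 1, 0], ![1, 1, 1, 1, 1, 1, 1], ![1, 1, 1, 2, 1, 1, 0],
    ![1, 1, 2, 2, 1, 0, 0], ![0, 1, 1, 2, 2, 1, 1], ![1, 1, 1, 2, 1, 1, 1], ![1, 1, 1, 2, 2, 1, 0],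
    ![1, 1, 2, 2, 1, 1, 0], ![0, 1, 1, 2, 2, 2, 1], ![1, 1, 1, 2, 2, 1, 1], ![1, 1, 2, 2, 1, 1, 1],
    ![1, 1, 2, 2, 2, 1, 0], ![1, 1, 1, 2, 2, 2, 1], ![1, 1, 2, 2, 2, 1, 1], ![1, 1, 2, 3, 2, 1, 0],
    ![1, 1, 2, 2, 2, 2, 1], ![1, 1, 2, 3, 2, 1, 1], ![1, 2, 2, 3, 2, 1, 0], ![1, 1, 2, 3, 2, 2, 1],
    ![1, 2, 2, 3, 2, 1, 1], ![1, 1, 2, 3, 3, 2, 1], ![1, 2, 2, 3, 2, 2, 1], ![1, 2, 2, 3, 3, 2, 1],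
    ![1, 2, 2, 4, 3, 2, 1], ![1, 2, 3, 4, 3, 2, 1], ![2, 2, 3, 4, 3, 2, 1]]

/-- The matrix of `ω_1` in type `E₆`. -/
def omegaMatrixE₆₁ : Matrix (Fin 6) (Fin 6) ℤ :=
  !![0, 0, 0, 0, 0, -1;
     0, 0, 0, 0, 1, -2;
     0, 1, 0, 0, 0, -2;
     0, 0, 0, 1, 0, -3;
     0, 0, 1, 0, 0, -2;
     1, 0, 0, 0, 0, -1]

/-- The matrix of `ω_6` in type `E₆`. -/
def omegaMatrixE₆₆ : Matrix (Fin 6) (Fin 6) ℤ :=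
  !![-1, 0, 0, 0, 0, 1;
     -2, 0, 1, 0, 0, 0;
     -2, 0, 0, 0, 1, 0;
     -3, 0, 0, 1, 0, 0;
     -2, 1, 0, 0, 0, 0;
     -1, 0, 0, 0, 0, 0]

/-- The matrix of `ω_7` in type `E₇`. -/
def omegaMatrixE₇ : Matrix (Fin 7) (Fin 7) ℤ :=
  !![0, 0, 0, 0, 0, 1, -2;
     0, 1, 0, 0, 0, 0, -2;
     0, 0, 0, 0, 1, 0, -3;
     0, 0, 0, 1, 0, 0, -4;
     0, 0, 1, 0, 0, 0, -3;
     1, 0, 0, 0, 0, 0, -2;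
     0, 0, 0, 0, 0, 0, -1]

/-- The coefficient vectors of the disappearing roots in type `E₆`. -/
def disappearingE₆ : List (Fin 6 → ℤ) :=
  [![1, 1, 1, 1, 0, 0], ![1, 0, 1, 1, 1, 0], ![0, 1, 0, 1, 1, 1], ![0, 0, 1, 1, 1, 1],
    ![1, 1, 2, 2, 1, 1], ![1, 1, 1, 2, 2, 1]]

/-- The coefficient vectors of the disappearing roots in type `E₇`. -/
def disappearingE₇ : List (Fin 7 → ℤ) :=
  [![0, 1, 1, 2, 2, 2, 1], ![1, 1, 2, 2, 1, 1, 1], ![1, 1, 1, 2, 2, 1, 1]]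

theorem isPosRootList_E₆ : IsPosRootList CartanMatrix.E₆ posRootsE₆ where
  single_mem := by decide +kernel
  reflect_mem := by decide +kernel
  descend := by decide +kernel
  sum_pos := by decide +kernel

theorem isPosRootList_E₇ : IsPosRootList CartanMatrix.E₇ posRootsE₇ where
  single_mem := by decide +kernel
  reflect_mem := by decide +kernel
  descend := by decide +kernel
  sum_pos := by decide +kernel

theorem isHighest_E₆ : IsHighest posRootsE₆ ![1, 2, 2, 3, 2, 1] where
  mem := by decide +kernel
  lt := by decide +kernel

theorem isHighest_E₇ : IsHighest posRootsE₇ ![2, 2, 3, 4, 3, 2, 1] where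
  mem := by decide +kernel
  lt := by decide +kernel

/-- Here `ω_1` has order 3 and runs through `α_0 ↦ α_1 ↦ α_6 ↦ α_0`, so the indices 0 and 5 give the
nonzero labels 1 and 6 of `S_0`. -/
theorem foldingData_E₆₁ : FoldingData CartanMatrix.E₆ posRootsE₆ ![1, 2, 2, 3, 2, 1] 0 omegaMatrixE₆₁ 3
    disappearingE₆ {0, 5} where
  pos := by decide
  pow_eq_one := by decide +kernel
  -- An element of a finite reflection group is a product of reflections in roots orthogonal to its
  -- fixed space, and those are the roots of zero average. The fixed space has codimension 4, which
  -- accounts for the four reflections.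
  exists_list := ⟨disappearingE₆.take 4, by decide +kernel, by decide +kernel⟩
  simple := by decide +kernel
  mem_iff := by decide +kernel
  subset := by decide +kernel
  orbit := by decide +kernel

theorem foldingData_E₆₆ : FoldingData CartanMatrix.E₆ posRootsE₆ ![1, 2, 2, 3, 2, 1] 5 omegaMatrixE₆₆ 3
    disappearingE₆ {0, 5} where
  pos := by decide
  pow_eq_one := by decide +kernel
  -- A different selection of four disappearing roots gives the inverse of `ω_1`.
  exists_list := ⟨disappearingE₆.take 2 ++ disappearingE₆.drop 4, by decide +kernel, by decide +kernel⟩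
  simple := by decide +kernel
  mem_iff := by decide +kernel
  subset := by decide +kernel
  orbit := by decide +kernel

theorem foldingData_E₇ : FoldingData CartanMatrix.E₇ posRootsE₇ ![2, 2, 3, 4, 3, 2, 1] 6 omegaMatrixE₇ 2
    disappearingE₇ {6} where
  pos := by decide
  pow_eq_one := by decide +kernel
  -- The three disappearing roots are mutually orthogonal, and the involution `ω_7` is the product
  -- of their commuting reflections.
  exists_list := ⟨disappearingE₇, by decide +kernel, by decide +kernel⟩
  simple := by decide +kernel
  mem_iff := by decide +kernel
  subset := by decide +kernel
  orbit := by decide +kernel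

end Exceptional

end Folding

namespace Folding

open Set Matrix

/-! ### The statements for `E₆` and `E₇` -/

section ExceptionalTypes

variable {ι M N : Type*} [AddCommGroup M] [Module ℝ M] [AddCommGroup N] [Module ℝ N]
variable {P : RootPairing ι ℝ M N} [P.IsCrystallographic] [P.IsRootSystem] [Finite ι] [P.IsReduced]
variable [Nonempty ι] {b : P.Base} {α : ℕ → ι}

theorem minuscule_E₆ (h : IsLabelling b CartanMatrix.E₆ α) : minuscule b = {α 1, α 6} := by
  rw [isHighest_E₆.minuscule_eq h CartanMatrix.E₆_isSymm isPosRootList_E₆]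
  have : {l : Fin 6 | (![1, 2, 2, 3, 2, 1] : Fin 6 → ℤ) l = 1} = {0, 5} := by
    ext l
    fin_cases l <;> simp
  rw [this, image_pair]
  rfl

theorem minuscule_E₇ (h : IsLabelling b CartanMatrix.E₇ α) : minuscule b = {α 7} := by
  rw [isHighest_E₇.minuscule_eq h CartanMatrix.E₇_isSymm isPosRootList_E₇]
  have : {l : Fin 7 | (![2, 2, 3, 4, 3, 2, 1] : Fin 7 → ℤ) l = 1} = {6} := by
    ext l
    fin_cases l <;> simp
  rw [this, image_singleton]
  rfl

/-- One list serves both values of `j`: `ω_6` is the inverse of `ω_1`, so both generate the same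
cyclic group and give the same averages. -/
theorem exists_foldingData_E₆ {j : ℕ} (hj : j = 1 ∨ j = 6) :
    ∃ (l : Fin 6) (A : Matrix (Fin 6) (Fin 6) ℤ), (l : ℕ) + 1 = j ∧
      FoldingData CartanMatrix.E₆ posRootsE₆ ![1, 2, 2, 3, 2, 1] l A 3 disappearingE₆ {0, 5} := by
  rcases hj with rfl | rfl
  · exact ⟨0, _, rfl, foldingData_E₆₁⟩
  · exact ⟨5, _, rfl, foldingData_E₆₆⟩

theorem disappearing_E₆ (h : IsLabelling b CartanMatrix.E₆ α) {j : ℕ} (hj : j = 1 ∨ j = 6) :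
    disappearing b (omega b (α j)) =
      {P.root (α 1) + P.root (α 2) + P.root (α 3) + P.root (α 4),
        P.root (α 1) + P.root (α 3) + P.root (α 4) + P.root (α 5),
        P.root (α 2) + P.root (α 4) + P.root (α 5) + P.root (α 6),
        P.root (α 3) + P.root (α 4) + P.root (α 5) + P.root (α 6),
        P.root (α 1) + P.root (α 2) + (2 : ℝ) • P.root (α 3) + (2 : ℝ) • P.root (α 4)
          + P.root (α 5) + P.root (α 6),
        P.root (α 1) + P.root (α 2) + P.root (α 3) + (2 : ℝ) • P.root (α 4)
          + (2 : ℝ) • P.root (α 5) + P.root (α 6)} := by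
  obtain ⟨l, A, rfl, hF⟩ := exists_foldingData_E₆ hj
  rw [hF.disappearing_eq h CartanMatrix.E₆_isSymm isPosRootList_E₆]
  ext x
  simp only [disappearingE₆, List.mem_cons, List.not_mem_nil, or_false, exists_eq_or_imp,
    exists_eq_left, mem_ofPred_eq, mem_insert_iff, mem_singleton_iff]
  simp [Fin.sum_univ_succ, add_assoc]

theorem disappearing_E₇ (h : IsLabelling b CartanMatrix.E₇ α) :
    disappearing b (omega b (α 7)) =
      {P.root (α 2) + P.root (α 3) + (2 : ℝ) • P.root (α 4) + (2 : ℝ) • P.root (α 5)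
          + (2 : ℝ) • P.root (α 6) + P.root (α 7),
        P.root (α 1) + P.root (α 2) + (2 : ℝ) • P.root (α 3) + (2 : ℝ) • P.root (α 4)
          + P.root (α 5) + P.root (α 6) + P.root (α 7),
        P.root (α 1) + P.root (α 2) + P.root (α 3) + (2 : ℝ) • P.root (α 4)
          + (2 : ℝ) • P.root (α 5) + P.root (α 6) + P.root (α 7)} := by
  have := foldingData_E₇.disappearing_eq h CartanMatrix.E₇_isSymm isPosRootList_E₇
  change disappearing b (omega b (α 7)) = _ at this
  rw [this]
  ext x
  simp only [disappearingE₇, List.mem_cons, List.not_mem_nil, or_false, exists_eq_or_imp,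
    exists_eq_left, mem_ofPred_eq, mem_insert_iff, mem_singleton_iff]
  simp [Fin.sum_univ_succ, add_assoc]

theorem extraSet_E₆ (h : IsLabelling b CartanMatrix.E₆ α) {j : ℕ} (hj : j = 1 ∨ j = 6) :
    extraSet b (omega b (α j)) 0 = {1, -1, 2, -2} := by
  obtain ⟨l, A, rfl, hF⟩ := exists_foldingData_E₆ hj
  rw [hF.extraSet_eq h CartanMatrix.E₆_isSymm isPosRootList_E₆ isHighest_E₆]
  ext p
  simp only [disappearingE₆, List.mem_cons, List.not_mem_nil, or_false, exists_eq_or_imp,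
    exists_eq_left, mem_ofPred_eq, mem_insert_iff, mem_singleton_iff]
  simp
  omega

theorem extraSet_E₇ (h : IsLabelling b CartanMatrix.E₇ α) :
    extraSet b (omega b (α 7)) 0 = {1, -1} := by
  have := foldingData_E₇.extraSet_eq h CartanMatrix.E₇_isSymm isPosRootList_E₇ isHighest_E₇
  change extraSet b (omega b (α 7)) 0 = _ at this
  rw [this]
  ext p
  simp only [disappearingE₇, List.mem_cons, List.not_mem_nil, or_false, exists_eq_or_imp,
    exists_eq_left, mem_ofPred_eq, mem_insert_iff, mem_singleton_iff]
  simp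
  omega

theorem image_disappearing_E₆ (h : IsLabelling b CartanMatrix.E₆ α) {j : ℕ} (hj : j = 1 ∨ j = 6)
    {f : M →ₗ[ℝ] EuclideanSpace ℝ (Fin 8)}
    (h1 : f (P.root (α 1)) =
      (1 / 2 : ℝ) • (e 8 1 - e 8 2 - e 8 3 - e 8 4 - e 8 5 - e 8 6 - e 8 7 + e 8 8))
    (h2 : f (P.root (α 2)) = e 8 1 + e 8 2) (h3 : f (P.root (α 3)) = e 8 2 - e 8 1)
    (h4 : f (P.root (α 4)) = e 8 3 - e 8 2) (h5 : f (P.root (α 5)) = e 8 4 - e 8 3)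
    (h6 : f (P.root (α 6)) = e 8 5 - e 8 4) :
    f '' disappearing b (omega b (α j)) =
      {(1 / 2 : ℝ) • (e 8 1 + e 8 2 + e 8 3 - e 8 4 - e 8 5 - e 8 6 - e 8 7 + e 8 8),
        (1 / 2 : ℝ) • (-e 8 1 - e 8 2 - e 8 3 + e 8 4 - e 8 5 - e 8 6 - e 8 7 + e 8 8),
        e 8 5 + e 8 1,
        e 8 5 - e 8 1,
        (1 / 2 : ℝ) • (-e 8 1 + e 8 2 + e 8 3 - e 8 4 + e 8 5 - e 8 6 - e 8 7 + e 8 8),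
        (1 / 2 : ℝ) • (e 8 1 - e 8 2 - e 8 3 + e 8 4 + e 8 5 - e 8 6 - e 8 7 + e 8 8)} := by
  rw [disappearing_E₆ h hj]
  simp only [image_insert_eq, image_singleton, map_add, map_smul, h1, h2, h3, h4, h5, h6]
  congr 1
  · module
  congr 1
  · module
  congr 1
  · module
  congr 1
  · module
  congr 1
  · module
  · congr 1
    module

theorem image_disappearing_E₇ (h : IsLabelling b CartanMatrix.E₇ α)
    {f : M →ₗ[ℝ] EuclideanSpace ℝ (Fin 8)}
    (h1 : f (P.root (α 1)) =
      (1 / 2 : ℝ) • (e 8 1 - e 8 2 - e 8 3 - e 8 4 - e 8 5 - e 8 6 - e 8 7 + e 8 8))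
    (h2 : f (P.root (α 2)) = e 8 2 + e 8 1) (h3 : f (P.root (α 3)) = e 8 2 - e 8 1)
    (h4 : f (P.root (α 4)) = e 8 3 - e 8 2) (h5 : f (P.root (α 5)) = e 8 4 - e 8 3)
    (h6 : f (P.root (α 6)) = e 8 5 - e 8 4) (h7 : f (P.root (α 7)) = e 8 6 - e 8 5) :
    f '' disappearing b (omega b (α 7)) =
      {e 8 6 + e 8 5,
        (1 / 2 : ℝ) • (-e 8 1 + e 8 2 + e 8 3 - e 8 4 - e 8 5 + e 8 6 - e 8 7 + e 8 8),
        (1 / 2 : ℝ) • (e 8 1 - e 8 2 - e 8 3 + e 8 4 - e 8 5 + e 8 6 - e 8 7 + e 8 8)} := by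
  rw [disappearing_E₇ h]
  simp only [image_insert_eq, image_singleton, map_add, map_smul, h1, h2, h3, h4, h5, h6, h7]
  congr 1
  · module
  congr 1
  · module
  · congr 1
    module

end ExceptionalTypes

end Folding

namespace Folding

open Set

/-! ### Signed permutations and the roots of types B, C, D -/

section Signed

/-- The standard basis vectors of `ℕ → ℝ`. -/
noncomputable def ε (p : ℕ) : ℕ → ℝ := Pi.single p 1

theorem ε_apply (p r : ℕ) : ε p r = if r = p then 1 else 0 := Pi.single_apply p 1 r

/-- The coordinate at `p`. -/
def coordAt (p : ℕ) : (ℕ → ℝ) →ₗ[ℝ] ℝ := LinearMap.proj p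

theorem coordAt_apply (p : ℕ) (v : ℕ → ℝ) : coordAt p v = v p := rfl

/-- The sum of the coordinates from `1` to `i`. -/
noncomputable def coordSum (i : ℕ) : (ℕ → ℝ) →ₗ[ℝ] ℝ := ∑ p ∈ Finset.Icc 1 i, coordAt p

theorem coordSum_ε (i p : ℕ) : coordSum i (ε p) = if 1 ≤ p ∧ p ≤ i then 1 else 0 := by
  simp [coordSum, coordAt_apply, ε_apply, LinearMap.sum_apply]

/-- The vectors `± e_p ± e_q` with `p ≠ q`. -/
def pairRoots (ℓ : ℕ) : Set (ℕ → ℝ) :=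
  {v | ∃ p ∈ Icc 1 ℓ, ∃ q ∈ Icc 1 ℓ, p < q ∧ ∃ s t : ℝ, (s = 1 ∨ s = -1) ∧ (t = 1 ∨ t = -1) ∧
    v = s • ε p + t • ε q}

/-- The vectors `± c e_p`. -/
def axisRoots (ℓ : ℕ) (c : ℝ) : Set (ℕ → ℝ) :=
  {v | ∃ p ∈ Icc 1 ℓ, ∃ s : ℝ, (s = 1 ∨ s = -1) ∧ v = (s * c) • ε p}

theorem sign_mul {s t : ℝ} (hs : s = 1 ∨ s = -1) (ht : t = 1 ∨ t = -1) :
    s * t = 1 ∨ s * t = -1 := by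
  rcases hs with rfl | rfl <;> rcases ht with rfl | rfl <;> simp

variable {ℓ : ℕ}

theorem mem_pairRoots_of_ne {p q : ℕ} (hp : p ∈ Icc 1 ℓ) (hq : q ∈ Icc 1 ℓ) (hpq : p ≠ q) {s t : ℝ}
    (hs : s = 1 ∨ s = -1) (ht : t = 1 ∨ t = -1) : s • ε p + t • ε q ∈ pairRoots ℓ := by
  rcases hpq.lt_or_gt with h | h
  · exact ⟨p, hp, q, hq, h, s, t, hs, ht, rfl⟩
  · exact ⟨q, hq, p, hp, h, t, s, ht, hs, add_comm _ _⟩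

theorem neg_mem_pairRoots {v : ℕ → ℝ} (hv : v ∈ pairRoots ℓ) : -v ∈ pairRoots ℓ := by
  obtain ⟨p, hp, q, hq, hpq, s, t, hs, ht, rfl⟩ := hv
  refine ⟨p, hp, q, hq, hpq, -s, -t, ?_, ?_, by module⟩
  · rcases hs with rfl | rfl <;> simp
  · rcases ht with rfl | rfl <;> simp

theorem neg_mem_axisRoots {c : ℝ} {v : ℕ → ℝ} (hv : v ∈ axisRoots ℓ c) : -v ∈ axisRoots ℓ c := by
  obtain ⟨p, hp, s, hs, rfl⟩ := hv
  refine ⟨p, hp, -s, ?_, by module⟩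
  rcases hs with rfl | rfl <;> simp

/-- The coordinate at `q` is nonzero, so the mirrored index `n - q` must also lie in the support
`{p, q}`. With `n = ℓ + 1` this analyses roots that are symmetric under `r ↦ ℓ + 1 - r`; `q ≤ n`
keeps the subtraction honest. -/
theorem eq_of_pair_apply_eq {p q n : ℕ} {s t : ℝ} (hpq : p ≠ q)
    (ht : t = 1 ∨ t = -1) (hq : q ≤ n)
    (h : (s • ε p + t • ε q) q = (s • ε p + t • ε q) (n - q)) :
    (p + q = n ∧ s = t) ∨ 2 * q = n := by
  by_contra! hcon
  have hn : n - q ≠ q := by omega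
  simp only [Pi.add_apply, Pi.smul_apply, ε_apply, smul_eq_mul, hpq.symm, if_true, if_false,
    hn] at h
  by_cases h1 : n - q = p
  · have := hcon.1 (by omega)
    simp only [h1, if_true, mul_one, mul_zero, zero_add, add_zero] at h
    exact this h.symm
  · simp only [h1, if_false, mul_one, mul_zero, zero_add, add_zero] at h
    rcases ht with rfl | rfl <;> norm_num at h

theorem eq_of_axis_apply_eq {p n : ℕ} {c : ℝ} (hc : c ≠ 0) (hp : p ≤ n)
    (h : (c • ε p) p = (c • ε p) (n - p)) : 2 * p = n := by
  by_contra hcon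
  have hn : n - p ≠ p := by omega
  simp [ε_apply, hn, hc] at h

/-- `T` permutes the vectors `± e_p`. -/
structure IsSignedPerm (ℓ : ℕ) (T : (ℕ → ℝ) → ℕ → ℝ) (g : ℕ → ℕ) : Prop where
  map_add : ∀ v w, T (v + w) = T v + T w
  map_smul : ∀ (s : ℝ) v, T (s • v) = s • T v
  mapsTo : MapsTo g (Icc 1 ℓ) (Icc 1 ℓ)
  injOn : InjOn g (Icc 1 ℓ)
  map_ε : ∀ p ∈ Icc 1 ℓ, ∃ s : ℝ, (s = 1 ∨ s = -1) ∧ T (ε p) = s • ε (g p)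

theorem IsSignedPerm.mem_pairRoots {T : (ℕ → ℝ) → ℕ → ℝ} {g : ℕ → ℕ} (h : IsSignedPerm ℓ T g)
    {v : ℕ → ℝ} (hv : v ∈ pairRoots ℓ) : T v ∈ pairRoots ℓ := by
  obtain ⟨p, hp, q, hq, hpq, s, t, hs, ht, rfl⟩ := hv
  obtain ⟨s', hs', h1⟩ := h.map_ε p hp
  obtain ⟨t', ht', h2⟩ := h.map_ε q hq
  rw [h.map_add, h.map_smul, h.map_smul, h1, h2, smul_smul, smul_smul]
  exact mem_pairRoots_of_ne (h.mapsTo hp) (h.mapsTo hq) (fun e => hpq.ne (h.injOn hp hq e))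
    (sign_mul hs hs') (sign_mul ht ht')

theorem IsSignedPerm.mem_axisRoots {T : (ℕ → ℝ) → ℕ → ℝ} {g : ℕ → ℕ} (h : IsSignedPerm ℓ T g)
    {c : ℝ} {v : ℕ → ℝ} (hv : v ∈ axisRoots ℓ c) : T v ∈ axisRoots ℓ c := by
  obtain ⟨p, hp, s, hs, rfl⟩ := hv
  obtain ⟨s', hs', h1⟩ := h.map_ε p hp
  rw [h.map_smul, h1, smul_smul]
  exact ⟨g p, h.mapsTo hp, s * s', sign_mul hs hs', by ring_nf⟩

theorem reflection_ε {i p : ℕ} :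
    ε p - (ε p i - ε p (i + 1)) • (ε i - ε (i + 1)) = ε (Equiv.swap i (i + 1) p) := by
  funext r
  simp only [Pi.sub_apply, Pi.smul_apply, ε_apply, smul_eq_mul, Equiv.swap_apply_def]
  split_ifs <;> first | omega | norm_num

theorem swap_mem_Icc {i j p : ℕ} (hi : i ∈ Icc 1 ℓ) (hj : j ∈ Icc 1 ℓ) (hp : p ∈ Icc 1 ℓ) :
    Equiv.swap i j p ∈ Icc 1 ℓ := by
  rw [Equiv.swap_apply_def]
  split_ifs <;> assumption

variable {ι M N : Type*} [AddCommGroup M] [Module ℝ M] [AddCommGroup N] [Module ℝ N]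
variable {P : RootPairing ι ℝ M N} {b : P.Base} {α : ℕ → ι}

/-- The pairwise exchange of the coordinates `p` and `ℓ + 1 - p` with a change of signs. -/
theorem Realization.acts_reverse {r : Realization b ℓ α (ℕ → ℝ)} {lo hi : ℕ} (hlo : 1 ≤ lo) (hhi : 2 * hi ≤ ℓ + 1)
    (h : ∀ p, lo ≤ p → p ≤ hi → r.Acts fun v s =>
      if s = p then -v (ℓ + 1 - p) else if s = ℓ + 1 - p then -v p else v s) :
    r.Acts fun v s => if (lo ≤ s ∧ s ≤ hi) ∨ (lo ≤ ℓ + 1 - s ∧ ℓ + 1 - s ≤ hi)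
      then -v (ℓ + 1 - s) else v s := by
  induction hi with
  | zero =>
    convert Realization.acts_id (r := r) using 1
    funext v s
    rw [if_neg (by omega)]
    rfl
  | succ hi ih =>
    have h1 := ih (by omega) fun p h1 h2 => h p h1 (by omega)
    by_cases hlh : lo ≤ hi + 1
    -- The new exchange concerns the coordinates `hi + 1` and `ℓ - hi`, which the earlier ones leave
    -- alone. The two may coincide, and then a single sign changes.
    · convert (h (hi + 1) hlh le_rfl).comp h1 using 1
      funext v s
      simp only [Function.comp_apply]
      split_ifs <;> first | omega | (congr 2; omega) | rfl
    · convert h1 using 1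
      funext v s
      congr 1
      exact propext ⟨fun _ => by omega, fun _ => by omega⟩

/-- A realization with `α i = e_i - e_{i+1}` for `i < ℓ`. -/
structure Realization.IsClassical (r : Realization b ℓ α (ℕ → ℝ)) : Prop where
  a_eq : ∀ i, 1 ≤ i → i < ℓ → r.a i = ε i - ε (i + 1)
  c_eq : ∀ i, 1 ≤ i → i < ℓ → ∀ v, r.c i v = v i - v (i + 1)

namespace Realization.IsClassical

variable {r : Realization b ℓ α (ℕ → ℝ)} (hr : r.IsClassical)
include hr

theorem isSignedPerm {i : ℕ} (hi : 1 ≤ i) (hiℓ : i < ℓ) :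
    IsSignedPerm ℓ (fun v => v - r.c i v • r.a i) (Equiv.swap i (i + 1)) where
  map_add v w := by simp only [map_add]; module
  map_smul s v := by simp only [map_smul, smul_eq_mul]; module
  mapsTo p hp := swap_mem_Icc ⟨hi, hiℓ.le⟩ ⟨by omega, hiℓ⟩ hp
  injOn := (Equiv.injective _).injOn
  map_ε p hp := ⟨1, .inl rfl, by rw [hr.a_eq i hi hiℓ, hr.c_eq i hi hiℓ, reflection_ε, one_smul]⟩

/-- Each `e_p - e_{p+1}` has height 1, so heights telescope down from `e_ℓ`. The value at `e_ℓ`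
depends on the last simple root: 1 in type B, 1/2 in type C, 0 in type D. -/
theorem ht_ε {p : ℕ} (hp : p ∈ Icc 1 ℓ) : r.ht (ε p) = (ℓ : ℝ) - p + r.ht (ε ℓ) := by
  obtain ⟨h1, h2⟩ := hp
  induction h2 using Nat.decreasingInduction with
  | self => ring
  | of_succ p hpℓ ih =>
    have h3 := r.ht_a (i := p) ⟨h1, hpℓ.le⟩
    rw [hr.a_eq p h1 hpℓ, map_sub, ih (by omega)] at h3
    push_cast at h3
    linarith

variable [P.IsRootSystem]

theorem acts_swap {p q : ℕ} (hp : p ∈ Icc 1 ℓ) (hq : q ∈ Icc 1 ℓ) :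
    r.Acts fun v => v ∘ Equiv.swap p q :=
  r.acts_swap (u := id) (n := ℓ) (injOn_id _) (by omega) hr.a_eq hr.c_eq hp hq

/-- Exchanging the coordinates `p + 1` and `q` turns `α_p` into this vector. -/
theorem sub_mem_roots {p q : ℕ} (hp : p ∈ Icc 1 ℓ) (hq : q ∈ Icc 1 ℓ) (hpq : p < q) :
    ε p - ε q ∈ r.roots := by
  have hp1 := hp.1
  have hp2 := hp.2
  have hq2 := hq.2
  have h1 := r.a_mem_roots (i := p) hp
  rw [hr.a_eq p hp1 (by omega)] at h1
  convert (hr.acts_swap (p := p + 1) (q := q) ⟨by omega, by omega⟩ hq).mem_roots h1 using 1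
  funext r
  simp only [Pi.sub_apply, ε_apply, Function.comp_apply, Equiv.swap_apply_def]
  split_ifs <;> first | omega | norm_num

variable {x : ℝ}

/-- The reflection in `x e_ℓ` is the sign change of the last coordinate whatever `x ≠ 0` is, and
conjugation by a transposition moves it to `p`. The parameter is `x = 1` in type B and `x = 2` in
type C. -/
theorem acts_neg (hx : x ≠ 0) (ha : r.a ℓ = x • ε ℓ) (hc : ∀ v, r.c ℓ v = 2 / x * v ℓ)
    {p : ℕ} (hp : p ∈ Icc 1 ℓ) :
    r.Acts fun v s => if s = p then -v s else v s := by
  have hℓ : ℓ ∈ Icc 1 ℓ := ⟨hp.1.trans hp.2, le_rfl⟩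
  have h1 : r.Acts fun v s => if s = ℓ then -v s else v s := by
    convert r.acts_reflection hℓ using 1
    funext v s
    rw [ha, hc]
    simp only [Pi.sub_apply, Pi.smul_apply, ε_apply, smul_eq_mul]
    split_ifs with hs
    · rw [hs]
      field_simp
      ring
    · ring
  have h2 := hr.acts_swap hp hℓ
  convert (h2.comp h1).comp h2 using 1
  funext v s
  simp only [Function.comp_apply, Equiv.swap_apply_def]
  split_ifs <;> first | omega | simp_all

variable [Finite ι] [P.IsReduced] [P.IsCrystallographic]

/-- Simple reflections are signed permutations of the `e_p`, and these preserve both families.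
Conversely transpositions and single sign changes produce both families from the differences `e_p -
e_q` and from the last simple root. -/
theorem roots_eq (hℓ : 1 ≤ ℓ) (hx : x ≠ 0) (ha : r.a ℓ = x • ε ℓ)
    (hc : ∀ v, r.c ℓ v = 2 / x * v ℓ) :
    r.roots = pairRoots ℓ ∪ axisRoots ℓ x := by
  apply subset_antisymm
  · have hT : ∀ i ∈ Icc 1 ℓ, ∃ g, IsSignedPerm ℓ
        (fun v => v - r.c i v • r.a i) g := by
      rintro i ⟨hi, hi'⟩
      rcases hi'.lt_or_eq with hlt | rfl
      · exact ⟨_, hr.isSignedPerm hi hlt⟩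
      · refine ⟨id, fun v w => by simp only [map_add]; module,
          fun s v => by simp only [map_smul, smul_eq_mul]; module, mapsTo_id _, injOn_id _, ?_⟩
        intro p _
        rw [ha, hc]
        by_cases hp : p = i
        · refine ⟨-1, .inr rfl, ?_⟩
          subst hp
          rw [ε_apply, if_pos rfl, smul_smul, mul_one, div_mul_cancel₀ _ hx]
          simp only [id]
          module
        · refine ⟨1, .inl rfl, ?_⟩
          rw [ε_apply, if_neg (Ne.symm hp)]
          simp
    refine r.roots_subset ?_ ?_ ?_
    · rintro i ⟨hi, hi'⟩
      rcases hi'.lt_or_eq with hlt | rfl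
      · left
        rw [hr.a_eq i hi hlt]
        convert mem_pairRoots_of_ne (p := i) (q := i + 1) ⟨hi, hi'⟩ ⟨by omega, hlt⟩ (by omega)
          (.inl rfl) (.inr rfl) using 1
        module
      · exact .inr ⟨i, ⟨hi, le_rfl⟩, 1, .inl rfl, by rw [ha, one_mul]⟩
    · rintro v (hv | hv)
      exacts [.inl (neg_mem_pairRoots hv), .inr (neg_mem_axisRoots hv)]
    · intro i hi v hv
      obtain ⟨g, hg⟩ := hT i hi
      exact hv.imp hg.mem_pairRoots hg.mem_axisRoots
  · have h1 : ∀ p ∈ Icc 1 ℓ, ∀ q ∈ Icc 1 ℓ, p < q → ∀ t : ℝ, (t = 1 ∨ t = -1) →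
        ε p + t • ε q ∈ r.roots := by
      intro p hp q hq hpq t ht
      have h2 := hr.sub_mem_roots hp hq hpq
      rcases ht with rfl | rfl
      · convert (hr.acts_neg hx ha hc hq).mem_roots h2 using 1
        funext s
        simp only [Pi.add_apply, Pi.sub_apply, Pi.smul_apply, ε_apply, smul_eq_mul]
        split_ifs <;> first | omega | norm_num
      · convert h2 using 1
        module
    rintro v (⟨p, hp, q, hq, hpq, s, t, hs, ht, rfl⟩ | ⟨p, hp, s, hs, rfl⟩)
    · rcases hs with rfl | rfl
      · rw [one_smul]
        exact h1 p hp q hq hpq t ht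
      · convert r.neg_mem_roots (h1 p hp q hq hpq (-t) ?_) using 1
        · module
        · rcases ht with rfl | rfl <;> simp
    · have hℓ : ℓ ∈ Icc 1 ℓ := ⟨hp.1.trans hp.2, le_rfl⟩
      have h2 : x • ε p ∈ r.roots := by
        have h3 := r.a_mem_roots hℓ
        rw [ha] at h3
        convert (hr.acts_swap hp hℓ).mem_roots h3 using 1
        funext s
        simp only [Pi.smul_apply, ε_apply, smul_eq_mul, Function.comp_apply, Equiv.swap_apply_def]
        split_ifs <;> first | omega | norm_num
      rcases hs with rfl | rfl
      · rwa [one_mul]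
      · convert r.neg_mem_roots h2 using 1
        module

end Realization.IsClassical

end Signed

end Folding

namespace Folding

open Set

/-! ### Type C: realization, highest root and `ω_ℓ` -/

section TypeC

variable {ι M N : Type*} [AddCommGroup M] [Module ℝ M] [AddCommGroup N] [Module ℝ N]
variable {P : RootPairing ι ℝ M N} {b : P.Base} {α : ℕ → ι} {ℓ : ℕ}
variable [P.IsRootSystem] [P.IsCrystallographic]

/-- The realization of type `C`. -/
noncomputable def IsLabelling.realizationC (h : IsLabelling b (CartanMatrix.C ℓ) α) :
    Realization b ℓ α (ℕ → ℝ) :=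
  h.realization (fun i => if i < ℓ then ε i - ε (i + 1) else (2 : ℝ) • ε ℓ)
    -- Only `α_ℓ = 2e_ℓ` has nonzero coordinate sum, and that sum is 2; hence the factor 1/2.
    (fun i => if i < ℓ then coordSum i else (1 / 2 : ℝ) • coordSum ℓ)
    -- The coroot of `2e_ℓ` is `e_ℓ`.
    (fun i => if i < ℓ then coordAt i - coordAt (i + 1) else coordAt ℓ)
    (by
      rintro i ⟨hi, hi'⟩ j ⟨hj, hj'⟩
      by_cases h1 : i < ℓ <;> by_cases h2 : j < ℓ <;>
        simp only [h1, h2, if_true, if_false, map_sub, map_smul, coordSum_ε,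
          LinearMap.smul_apply, smul_eq_mul] <;>
        split_ifs <;> first | omega | norm_num)
    (by
      rintro ⟨i, hi⟩ ⟨j, hj⟩
      simp only [CartanMatrix.C, Matrix.of_apply, Fin.mk.injEq]
      by_cases h1 : i + 1 < ℓ <;> by_cases h2 : j + 1 < ℓ <;>
        simp only [h1, h2, if_true, if_false, LinearMap.sub_apply, coordAt_apply,
          Pi.sub_apply, Pi.smul_apply, ε_apply, smul_eq_mul] <;>
        split_ifs <;> first | omega | norm_num)

variable (h : IsLabelling b (CartanMatrix.C ℓ) α)

theorem realizationC_a_last : h.realizationC.a ℓ = (2 : ℝ) • ε ℓ := if_neg (lt_irrefl ℓ)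

theorem realizationC_c_last (v : ℕ → ℝ) : h.realizationC.c ℓ v = v ℓ := by
  change (if ℓ < ℓ then _ else _ : (ℕ → ℝ) →ₗ[ℝ] ℝ) v = _
  rw [if_neg (lt_irrefl ℓ)]
  rfl

theorem realizationC_k_last (v : ℕ → ℝ) : h.realizationC.k ℓ v = (1 / 2 : ℝ) * coordSum ℓ v := by
  change (if ℓ < ℓ then _ else _ : (ℕ → ℝ) →ₗ[ℝ] ℝ) v = _
  rw [if_neg (lt_irrefl ℓ)]
  rfl

theorem realizationC_k {i : ℕ} (hi : i < ℓ) : h.realizationC.k i = coordSum i := if_pos hi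

theorem realizationC_isClassical : h.realizationC.IsClassical where
  a_eq i _ hi := if_pos hi
  c_eq i _ hi v := by
    change (if i < ℓ then _ else _ : (ℕ → ℝ) →ₗ[ℝ] ℝ) v = _
    rw [if_pos hi]
    rfl

theorem realizationC_ht_ε {p : ℕ} (hp : p ∈ Icc 1 ℓ) :
    h.realizationC.ht (ε p) = (ℓ : ℝ) - p + 1 / 2 := by
  have h1 := h.realizationC.ht_a (i := ℓ) ⟨hp.1.trans hp.2, le_rfl⟩
  rw [realizationC_a_last, map_smul, smul_eq_mul] at h1
  rw [(realizationC_isClassical h).ht_ε hp]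
  linarith

theorem actsC_neg {p : ℕ} (hp : p ∈ Icc 1 ℓ) :
    h.realizationC.Acts fun v s => if s = p then -v s else v s :=
  (realizationC_isClassical h).acts_neg two_ne_zero (realizationC_a_last h)
    (fun v => by rw [realizationC_c_last]; ring) hp

theorem actsC_neg_swap {p q : ℕ} (hp : p ∈ Icc 1 ℓ) (hq : q ∈ Icc 1 ℓ) :
    h.realizationC.Acts fun v s => if s = p then -v q else if s = q then -v p else v s := by
  by_cases hpq : p = q
  · subst hpq
    convert actsC_neg h hp using 1
    funext v s
    split_ifs <;> simp_all
  · convert ((actsC_neg h hp).comp (actsC_neg h hq)).comp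
      ((realizationC_isClassical h).acts_swap hp hq) using 1
    funext v s
    simp only [Function.comp_apply, Equiv.swap_apply_def]
    split_ifs <;> simp_all

/-- The action of `ω_ℓ` in type `C`. -/
def reverseC (ℓ : ℕ) (v : ℕ → ℝ) (s : ℕ) : ℝ := if 1 ≤ s ∧ s ≤ ℓ then -v (ℓ + 1 - s) else v s

/-- The pairs `{p, ℓ + 1 - p}` are treated one by one. For odd `ℓ` the bound `(ℓ + 1) / 2` includes
the middle coordinate, whose exchange with itself is a sign change. -/
theorem actsC_reverse : h.realizationC.Acts (reverseC ℓ) := by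
  convert Realization.acts_reverse (r := h.realizationC) (lo := 1) (hi := (ℓ + 1) / 2) le_rfl
    (by omega) fun p h1 h2 => actsC_neg_swap h ⟨h1, by omega⟩ ⟨by omega, by omega⟩ using 1
  funext v s
  unfold reverseC
  congr 1
  exact propext ⟨fun _ => by omega, fun _ => by omega⟩

theorem reverseC_involutive : Function.Involutive (reverseC ℓ) := by
  intro v
  funext s
  unfold reverseC
  split_ifs
  · rw [neg_neg]
    congr 1
    omega
  · omega
  · rfl

variable [Finite ι] [P.IsReduced]

theorem realizationC_roots (h : IsLabelling b (CartanMatrix.C ℓ) α) (hℓ : 1 ≤ ℓ) :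
    h.realizationC.roots = pairRoots ℓ ∪ axisRoots ℓ 2 :=
  (realizationC_isClassical h).roots_eq hℓ two_ne_zero (realizationC_a_last h)
    fun v => by rw [realizationC_c_last]; ring

variable [Nonempty ι]

theorem f_highestRootC (hℓ : 3 ≤ ℓ) :
    h.realizationC.f (P.root (highestRoot b)) = (2 : ℝ) • ε 1 := by
  have h1ℓ : 1 ∈ Icc 1 ℓ := ⟨le_rfl, by omega⟩
  have hl : (3 : ℝ) ≤ ℓ := by exact_mod_cast hℓ
  refine h.realizationC.f_highestRoot ?_ ?_
  · rw [realizationC_roots h (by omega)]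
    exact .inr ⟨1, h1ℓ, 1, .inl rfl, by rw [one_mul]⟩
  · intro v hv
    rw [realizationC_roots h (by omega)] at hv
    rw [map_smul, realizationC_ht_ε h h1ℓ, smul_eq_mul]
    rcases hv with ⟨p, hp, q, hq, hpq, s, t, hs, ht, rfl⟩ | ⟨p, hp, s, hs, rfl⟩
    · right
      rw [map_add, map_smul, map_smul, realizationC_ht_ε h hp, realizationC_ht_ε h hq]
      have e1 : (1 : ℝ) ≤ p := by exact_mod_cast hp.1
      have e2 : (p : ℝ) + 1 ≤ q := by exact_mod_cast hpq
      have e3 : (q : ℝ) ≤ ℓ := by exact_mod_cast hq.2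
      rcases hs with rfl | rfl <;> rcases ht with rfl | rfl <;>
        simp only [smul_eq_mul, Nat.cast_one] <;> linarith
    · rw [map_smul, realizationC_ht_ε h hp]
      have e1 : (1 : ℝ) ≤ p := by exact_mod_cast hp.1
      have e3 : (p : ℝ) ≤ ℓ := by exact_mod_cast hp.2
      rcases hs with rfl | rfl
      · rcases hp.1.eq_or_lt with rfl | hlt
        · left
          rw [one_mul]
        · right
          have e4 : (1 : ℝ) + 1 ≤ p := by exact_mod_cast hlt
          simp only [smul_eq_mul, Nat.cast_one]
          linarith
      · right
        simp only [smul_eq_mul, Nat.cast_one]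
        linarith

theorem minuscule_C (h : IsLabelling b (CartanMatrix.C ℓ) α) (hℓ : 3 ≤ ℓ) : minuscule b = {α ℓ} := by
  rw [h.realizationC.minuscule_eq (f_highestRootC h hℓ)]
  have : {j ∈ Icc 1 ℓ | h.realizationC.k j ((2 : ℝ) • ε 1) = 1} = {ℓ} := by
    ext j
    constructor
    · rintro ⟨⟨hj, hj'⟩, h1⟩
      rcases hj'.lt_or_eq with hlt | rfl
      · rw [realizationC_k h hlt, map_smul, coordSum_ε, if_pos ⟨le_rfl, hj⟩] at h1
        norm_num at h1
      · rfl
    · rintro rfl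
      refine ⟨⟨by omega, le_rfl⟩, ?_⟩
      rw [realizationC_k_last, map_smul, coordSum_ε, if_pos ⟨le_rfl, by omega⟩]
      norm_num
  rw [this, image_singleton]

-- The reversal sends `α_i` to `α_{ℓ-i}` for `i < ℓ`, which is never `α_ℓ`, and `α_ℓ = 2e_ℓ` to the
-- lowest root `-2e_1`.
omit [Nonempty ι] in
theorem f_omegaC (hℓ : 1 ≤ ℓ) (x : M) :
    h.realizationC.f (omega b (α ℓ) x) = reverseC ℓ (h.realizationC.f x) := by
  have hr := realizationC_isClassical h
  refine h.realizationC.f_omega (actsC_reverse h) ⟨hℓ, le_rfl⟩ ?_ x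
  rintro i ⟨hi, hi'⟩
  rcases hi'.lt_or_eq with hlt | rfl
  · left
    refine ⟨ℓ - i, ⟨by omega, by omega⟩, by omega, ?_⟩
    rw [hr.a_eq i hi hlt, hr.a_eq (ℓ - i) (by omega) (by omega)]
    funext s
    simp only [reverseC, Pi.sub_apply, ε_apply]
    split_ifs <;> first | omega | norm_num
  · right
    have : reverseC i ((2 : ℝ) • ε i) = (-2 : ℝ) • ε 1 := by
      funext s
      simp only [reverseC, Pi.smul_apply, ε_apply, smul_eq_mul]
      split_ifs <;> first | omega | norm_num
    rw [realizationC_a_last, this, realizationC_k_last, map_smul, coordSum_ε, if_pos ⟨le_rfl, hi⟩]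
    norm_num

/-- The value is `(u_i - u_{ℓ-i+1}) + 2(u_{ℓ-i+1} - u_ℓ) + 2u_ℓ`. -/
theorem map_strC {W : Type*} [AddCommGroup W] [Module ℝ W] {g : M →ₗ[ℝ] W} {u : ℕ → W}
    (h1 : ∀ i ∈ Icc 1 (ℓ - 1), g (P.root (α i)) = u i - u (i + 1))
    (h2 : g (P.root (α ℓ)) = (2 : ℝ) • u ℓ) {i : ℕ} (hi : i ∈ Icc 1 ((ℓ + 1) / 2)) :
    g (str P α i (ℓ - i) + (2 : ℝ) • str P α (ℓ - i + 1) (ℓ - 1) + P.root (α ℓ))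
      = u i + u (ℓ - i + 1) := by
  obtain ⟨hi, hi'⟩ := hi
  rw [map_add, map_add, map_smul, h2,
    map_str g u (by omega) fun j hj hj' => h1 j ⟨by omega, by omega⟩,
    map_str g u (by omega) fun j hj hj' => h1 j ⟨by omega, by omega⟩,
    Nat.sub_add_cancel (by omega : 1 ≤ ℓ)]
  module

end TypeC

end Folding

namespace Folding

open Set

/-! ### Type C: disappearing roots and `P(0)` -/

section TypeC

variable {ι M N : Type*} [AddCommGroup M] [Module ℝ M] [AddCommGroup N] [Module ℝ N]
variable {P : RootPairing ι ℝ M N} {b : P.Base} {α : ℕ → ι} {ℓ : ℕ}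
variable [P.IsRootSystem] [P.IsCrystallographic] [Finite ι] [P.IsReduced] [Nonempty ι]

theorem f_strC (h : IsLabelling b (CartanMatrix.C ℓ) α) {i : ℕ} (hi : i ∈ Icc 1 ((ℓ + 1) / 2)) :
    h.realizationC.f (str P α i (ℓ - i) + (2 : ℝ) • str P α (ℓ - i + 1) (ℓ - 1) + P.root (α ℓ))
      = ε i + ε (ℓ - i + 1) := by
  have hi1 := hi.1
  have hi2 := hi.2
  refine map_strC (u := ε) (fun j hj => ?_) ?_ hi
  · have := hj.1
    have := hj.2
    rw [h.realizationC.map_root j ⟨by omega, by omega⟩,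
      (realizationC_isClassical h).a_eq j (by omega) (by omega)]
  · rw [h.realizationC.map_root ℓ ⟨by omega, le_rfl⟩, realizationC_a_last]

/-- Zero average means that the coordinates are symmetric under `r ↦ ℓ + 1 - r`. This leaves `±(e_p
+ e_{ℓ+1-p})` and, for odd `ℓ`, twice the middle vector up to sign, which is the case `p = ℓ + 1 -
p` of the same formula. Positivity selects the sign. -/
theorem disappearing_C (h : IsLabelling b (CartanMatrix.C ℓ) α) (hℓ : 3 ≤ ℓ) :
    disappearing b (omega b (α ℓ)) =
      {x | ∃ i ∈ Icc 1 ((ℓ + 1) / 2),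
        x = str P α i (ℓ - i) + (2 : ℝ) • str P α (ℓ - i + 1) (ℓ - 1) + P.root (α ℓ)} := by
  ext x
  rw [h.realizationC.mem_disappearing_iff (m := 2) (f_omegaC h (by omega)) two_pos
    (fun x => reverseC_involutive _), realizationC_roots h (by omega)]
  simp only [Finset.sum_range_succ, Finset.sum_range_zero, zero_add, Function.iterate_zero, id,
    Function.iterate_one]
  constructor
  · rintro ⟨hv, hpos, hz⟩
    have hz' : ∀ r, 1 ≤ r → r ≤ ℓ →
        h.realizationC.f x r = h.realizationC.f x (ℓ + 1 - r) := by
      intro r h1 h2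
      have := congrFun hz r
      rw [Pi.add_apply, reverseC, if_pos ⟨h1, h2⟩, Pi.zero_apply] at this
      linarith
    suffices ∃ i ∈ Icc 1 ((ℓ + 1) / 2), h.realizationC.f x = ε i + ε (ℓ - i + 1) by
      obtain ⟨i, hi, hx⟩ := this
      exact ⟨i, hi, h.realizationC.f_injective (by rw [hx, f_strC h hi])⟩
    rcases hv with ⟨p, hp, q, hq, hpq, s, t, hs, ht, hx⟩ | ⟨p, hp, s, hs, hx⟩
    · have hp1 := hp.1
      have hq2 := hq.2
      rw [hx] at hz' hpos
      have e1 := eq_of_pair_apply_eq hpq.ne ht (by omega) (hz' q (by omega) hq2)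
      rw [add_comm] at hz'
      have e2 := eq_of_pair_apply_eq hpq.ne' hs (by omega) (hz' p hp1 (by omega))
      -- The indices `p < q` cannot both be the midpoint, so at least one of the two comparisons
      -- yields a mirrored pair with equal signs.
      obtain ⟨hpq', rfl⟩ : p + q = ℓ + 1 ∧ s = t := by
        rcases e1 with e1 | e1
        · exact e1
        · exact ⟨by omega, (e2.resolve_right (by omega)).2.symm⟩
      rw [map_add, map_smul, map_smul, realizationC_ht_ε h hp, realizationC_ht_ε h hq] at hpos
      have e3 : (q : ℝ) ≤ ℓ := by exact_mod_cast hq2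
      have e4 : (p : ℝ) ≤ ℓ := by exact_mod_cast hp.2
      refine ⟨p, ⟨hp1, by omega⟩, ?_⟩
      rcases hs with rfl | rfl
      · rw [hx, one_smul, one_smul, (by omega : ℓ - p + 1 = q)]
      · simp only [smul_eq_mul] at hpos
        linarith
    · have hp1 := hp.1
      have hp2 := hp.2
      rw [hx] at hz' hpos
      have e1 := eq_of_axis_apply_eq (by rcases hs with rfl | rfl <;> norm_num) (by omega)
        (hz' p hp1 hp2)
      rw [map_smul, realizationC_ht_ε h hp] at hpos
      have e4 : (p : ℝ) ≤ ℓ := by exact_mod_cast hp.2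
      refine ⟨p, ⟨hp1, by omega⟩, ?_⟩
      rcases hs with rfl | rfl
      · rw [hx, one_mul, (by omega : ℓ - p + 1 = p), two_smul]
      · simp only [smul_eq_mul] at hpos
        linarith
  · rintro ⟨i, hi, rfl⟩
    rw [f_strC h hi]
    obtain ⟨hi1, hi2⟩ := hi
    refine ⟨?_, ?_, ?_⟩
    · by_cases hii : ℓ - i + 1 = i
      · right
        exact ⟨i, ⟨hi1, by omega⟩, 1, .inl rfl, by rw [hii, one_mul, two_smul]⟩
      · left
        convert mem_pairRoots_of_ne (ℓ := ℓ) (p := i) (q := ℓ - i + 1) ⟨hi1, by omega⟩ ⟨by omega, by omega⟩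
          (Ne.symm hii) (.inl rfl) (.inl rfl) using 1
        module
    · rw [map_add, realizationC_ht_ε h ⟨hi1, by omega⟩,
        realizationC_ht_ε h ⟨by omega, by omega⟩]
      have e1 : (i : ℝ) ≤ ℓ := by exact_mod_cast (by omega : i ≤ ℓ)
      have e2 : ((ℓ - i + 1 : ℕ) : ℝ) ≤ ℓ := by exact_mod_cast (by omega : ℓ - i + 1 ≤ ℓ)
      linarith
    · funext s
      simp only [Pi.add_apply, reverseC, ε_apply, Pi.zero_apply]
      split_ifs <;> first | omega | norm_num

theorem image_disappearing_C (h : IsLabelling b (CartanMatrix.C ℓ) α) (hℓ : 3 ≤ ℓ)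
    {W : Type*} [AddCommGroup W] [Module ℝ W] {g : M →ₗ[ℝ] W} {u : ℕ → W}
    (h1 : ∀ i ∈ Icc 1 (ℓ - 1), g (P.root (α i)) = u i - u (i + 1))
    (h2 : g (P.root (α ℓ)) = (2 : ℝ) • u ℓ) :
    g '' disappearing b (omega b (α ℓ)) =
      {x | ∃ p ∈ Icc 1 ((ℓ + 1) / 2), x = u p + u (ℓ - p + 1)} := by
  rw [disappearing_C h hℓ]
  ext y
  constructor
  · rintro ⟨-, ⟨i, hi, rfl⟩, rfl⟩
    exact ⟨i, hi, map_strC h1 h2 hi⟩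
  · rintro ⟨i, hi, rfl⟩
    exact ⟨_, ⟨i, hi, rfl⟩, map_strC h1 h2 hi⟩

theorem pairingPiZero_C (h : IsLabelling b (CartanMatrix.C ℓ) α) (hℓ : 3 ≤ ℓ) (x : M) :
    pairingPiZero b (omega b (α ℓ)) x = (1 / 2 : ℝ) * coordSum ℓ (h.realizationC.f x) := by
  have hT : reverseC ℓ (-(2 : ℝ) • ε 1) = h.realizationC.a ℓ := by
    rw [realizationC_a_last]
    funext s
    simp only [reverseC, Pi.smul_apply, ε_apply, smul_eq_mul]
    split_ifs <;> first | omega | norm_num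
  rw [h.realizationC.pairingPiZero_of_involutive (f_omegaC h (by omega)) reverseC_involutive
    (f_highestRootC h hℓ) ⟨by omega, le_rfl⟩ (by rw [← neg_smul]; exact hT), realizationC_k_last]

theorem extraSet_C (h : IsLabelling b (CartanMatrix.C ℓ) α) (hℓ : 3 ≤ ℓ) :
    extraSet b (omega b (α ℓ)) 0 = {1, -1} := by
  apply extraSet_zero_eq_of_forall <;> rw [disappearing_C h hℓ]
  · exact ⟨_, 1, ⟨le_rfl, by omega⟩, rfl⟩
  · rintro - ⟨i, ⟨hi1, hi2⟩, rfl⟩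
    rw [pairingPiZero_C h hℓ, f_strC h ⟨hi1, hi2⟩, map_add, coordSum_ε, coordSum_ε,
      if_pos ⟨hi1, by omega⟩, if_pos ⟨by omega, by omega⟩]
    norm_num

end TypeC

end Folding

namespace Folding

open Set

/-! ### Type B -/

section TypeB

variable {ι M N : Type*} [AddCommGroup M] [Module ℝ M] [AddCommGroup N] [Module ℝ N]
variable {P : RootPairing ι ℝ M N} {b : P.Base} {α : ℕ → ι} {ℓ : ℕ}

/-- Extending `u` by zero beyond `ℓ` makes `α_ℓ ↦ u_ℓ - u_{ℓ+1}` fit the telescoping pattern. -/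
theorem map_strB {W : Type*} [AddCommGroup W] [Module ℝ W] {g : M →ₗ[ℝ] W} {u : ℕ → W}
    (hℓ : 1 ≤ ℓ) (h1 : ∀ i ∈ Icc 1 (ℓ - 1), g (P.root (α i)) = u i - u (i + 1))
    (h2 : g (P.root (α ℓ)) = u ℓ) : g (str P α 1 ℓ) = u 1 := by
  rw [map_str g (fun i => if i ≤ ℓ then u i else 0) (by omega), if_pos hℓ, if_neg (by omega),
    sub_zero]
  intro i hi hiℓ
  rcases hiℓ.lt_or_eq with hlt | rfl
  · rw [h1 i ⟨hi, by omega⟩, if_pos hiℓ, if_pos (show i + 1 ≤ ℓ from hlt)]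
  · rw [h2, if_pos le_rfl, if_neg (by omega), sub_zero]

variable [P.IsRootSystem] [P.IsCrystallographic]

/-- The realization of type `B`. -/
noncomputable def IsLabelling.realizationB (h : IsLabelling b (CartanMatrix.B ℓ) α) :
    Realization b ℓ α (ℕ → ℝ) :=
  h.realization (fun i => if i < ℓ then ε i - ε (i + 1) else ε ℓ) coordSum
    -- The coroot of `e_ℓ` is `2e_ℓ`.
    (fun i => if i < ℓ then coordAt i - coordAt (i + 1) else (2 : ℝ) • coordAt ℓ)
    (by
      rintro i ⟨hi, hi'⟩ j ⟨hj, hj'⟩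
      by_cases h2 : j < ℓ <;>
        simp only [h2, if_true, if_false, map_sub, coordSum_ε] <;>
        split_ifs <;> first | omega | norm_num)
    (by
      rintro ⟨i, hi⟩ ⟨j, hj⟩
      simp only [CartanMatrix.B, Matrix.of_apply, Fin.mk.injEq]
      by_cases h1 : i + 1 < ℓ <;> by_cases h2 : j + 1 < ℓ <;>
        simp only [h1, h2, if_true, if_false, LinearMap.sub_apply, coordAt_apply,
          Pi.sub_apply, LinearMap.smul_apply, ε_apply, smul_eq_mul] <;>
        split_ifs <;> first | omega | norm_num)

variable (h : IsLabelling b (CartanMatrix.B ℓ) α)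

theorem realizationB_a_last : h.realizationB.a ℓ = ε ℓ := if_neg (lt_irrefl ℓ)

theorem realizationB_k (i : ℕ) : h.realizationB.k i = coordSum i := rfl

theorem realizationB_isClassical : h.realizationB.IsClassical where
  a_eq i _ hi := if_pos hi
  c_eq i _ hi v := by
    change (if i < ℓ then _ else _ : (ℕ → ℝ) →ₗ[ℝ] ℝ) v = _
    rw [if_pos hi]
    rfl

theorem realizationB_ht_ε {p : ℕ} (hp : p ∈ Icc 1 ℓ) :
    h.realizationB.ht (ε p) = (ℓ : ℝ) - p + 1 := by
  have h1 := h.realizationB.ht_a (i := ℓ) ⟨hp.1.trans hp.2, le_rfl⟩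
  rw [realizationB_a_last] at h1
  rw [(realizationB_isClassical h).ht_ε hp, h1]

theorem realizationB_aux :
    h.realizationB.a ℓ = (1 : ℝ) • ε ℓ ∧ ∀ v, h.realizationB.c ℓ v = 2 / 1 * v ℓ := by
  refine ⟨by rw [realizationB_a_last, one_smul], fun v => ?_⟩
  change (if ℓ < ℓ then _ else _ : (ℕ → ℝ) →ₗ[ℝ] ℝ) v = _
  rw [if_neg (lt_irrefl ℓ), div_one]
  rfl

/-- The change of sign of the first coordinate. -/
def negFirst (v : ℕ → ℝ) (s : ℕ) : ℝ := if s = 1 then -v s else v s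

theorem negFirst_involutive : Function.Involutive negFirst := by
  intro v
  funext s
  unfold negFirst
  split_ifs <;> simp

variable [Finite ι] [P.IsReduced]

theorem realizationB_roots (hℓ : 1 ≤ ℓ) :
    h.realizationB.roots = pairRoots ℓ ∪ axisRoots ℓ 1 :=
  (realizationB_isClassical h).roots_eq hℓ one_ne_zero (realizationB_aux h).1 (realizationB_aux h).2

/-- The sign change at 1 fixes `α_2, …, α_ℓ` and sends `α_1` to the lowest root `-e_1 - e_2`. -/
theorem f_omegaB (hℓ : 2 ≤ ℓ) (x : M) :
    h.realizationB.f (omega b (α 1) x) = negFirst (h.realizationB.f x) := by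
  have hr := realizationB_isClassical h
  refine h.realizationB.f_omega (hr.acts_neg one_ne_zero (realizationB_aux h).1
    (realizationB_aux h).2 ⟨le_rfl, by omega⟩) ⟨le_rfl, by omega⟩ ?_ x
  rintro i ⟨hi, hi'⟩
  rcases hi.eq_or_lt with rfl | hlt
  · right
    have : (fun s => if s = 1 then -(ε 1 - ε (1 + 1)) s else (ε 1 - ε (1 + 1)) s)
        = -ε 1 - ε 2 := by
      funext s
      simp only [Pi.sub_apply, Pi.neg_apply, ε_apply]
      split_ifs <;> first | omega | norm_num
    rw [hr.a_eq 1 hi (by omega), this, realizationB_k, map_sub, map_neg, coordSum_ε, coordSum_ε]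
    norm_num
  · left
    refine ⟨i, ⟨hi, hi'⟩, hlt.ne', ?_⟩
    rcases hi'.lt_or_eq with hlt' | rfl
    · rw [hr.a_eq i hi hlt']
      funext s
      simp only [Pi.sub_apply, ε_apply]
      split_ifs <;> first | omega | norm_num
    · rw [realizationB_a_last]
      funext s
      simp only [ε_apply]
      split_ifs <;> first | omega | norm_num

variable [Nonempty ι]

theorem f_highestRootB (hℓ : 2 ≤ ℓ) :
    h.realizationB.f (P.root (highestRoot b)) = ε 1 + ε 2 := by
  have h1ℓ : 1 ∈ Icc 1 ℓ := ⟨le_rfl, by omega⟩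
  have h2ℓ : 2 ∈ Icc 1 ℓ := ⟨by omega, hℓ⟩
  have hl : (2 : ℝ) ≤ ℓ := by exact_mod_cast hℓ
  refine h.realizationB.f_highestRoot ?_ ?_
  · rw [realizationB_roots h (by omega)]
    exact .inl ⟨1, h1ℓ, 2, h2ℓ, one_lt_two, 1, 1, .inl rfl, .inl rfl, by module⟩
  · intro v hv
    rw [realizationB_roots h (by omega)] at hv
    rw [map_add, realizationB_ht_ε h h1ℓ, realizationB_ht_ε h h2ℓ]
    rcases hv with ⟨p, hp, q, hq, hpq, s, t, hs, ht, rfl⟩ | ⟨p, hp, s, hs, rfl⟩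
    · rw [map_add, map_smul, map_smul, realizationB_ht_ε h hp, realizationB_ht_ε h hq]
      by_cases heq : p = 1 ∧ q = 2
      · obtain ⟨rfl, rfl⟩ := heq
        rcases hs with rfl | rfl <;> rcases ht with rfl | rfl
        · left
          module
        all_goals
          right
          simp only [smul_eq_mul, Nat.cast_one, Nat.cast_ofNat]
          linarith
      · right
        have e1 : (1 : ℝ) ≤ p := by exact_mod_cast hp.1
        have e2 : (p : ℝ) + 1 ≤ q := by exact_mod_cast hpq
        have e3 : (q : ℝ) ≤ ℓ := by exact_mod_cast hq.2
        have e4 : (1 : ℝ) + 2 + 1 ≤ p + q := by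
          have := hp.1
          exact_mod_cast (by omega : 1 + 2 + 1 ≤ p + q)
        rcases hs with rfl | rfl <;> rcases ht with rfl | rfl <;>
          simp only [smul_eq_mul, Nat.cast_one, Nat.cast_ofNat] <;> linarith
    · right
      rw [map_smul, realizationB_ht_ε h hp]
      have e1 : (1 : ℝ) ≤ p := by exact_mod_cast hp.1
      have e3 : (p : ℝ) ≤ ℓ := by exact_mod_cast hp.2
      rcases hs with rfl | rfl <;> simp only [smul_eq_mul, Nat.cast_one, Nat.cast_ofNat] <;>
        linarith

theorem minuscule_B (h : IsLabelling b (CartanMatrix.B ℓ) α) (hℓ : 2 ≤ ℓ) :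
    minuscule b = {α 1} := by
  rw [h.realizationB.minuscule_eq (f_highestRootB h hℓ)]
  have : {j ∈ Icc 1 ℓ | h.realizationB.k j (ε 1 + ε 2) = 1} = {1} := by
    ext j
    rw [mem_ofPred_eq, mem_singleton_iff, realizationB_k, map_add, coordSum_ε, coordSum_ε]
    constructor
    · rintro ⟨⟨hj, hj'⟩, h1⟩
      by_contra hne
      rw [if_pos ⟨le_rfl, hj⟩, if_pos ⟨one_le_two, by omega⟩] at h1
      norm_num at h1
    · rintro rfl
      exact ⟨⟨le_rfl, by omega⟩, by norm_num⟩
  rw [this, image_singleton]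

omit [Nonempty ι] [P.IsReduced] [Finite ι] in
theorem f_strB (hℓ : 2 ≤ ℓ) : h.realizationB.f (str P α 1 ℓ) = ε 1 := by
  refine map_strB (u := ε) (by omega) (fun j hj => ?_) ?_
  · have := hj.1
    have := hj.2
    rw [h.realizationB.map_root j ⟨by omega, by omega⟩,
      (realizationB_isClassical h).a_eq j (by omega) (by omega)]
  · rw [h.realizationB.map_root ℓ ⟨by omega, le_rfl⟩, realizationB_a_last]

-- A vector and its image under the sign change cancel exactly when all coordinates but the first
-- vanish, so only `±e_1` remain.
omit [Nonempty ι] in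
theorem disappearing_B (h : IsLabelling b (CartanMatrix.B ℓ) α) (hℓ : 2 ≤ ℓ) :
    disappearing b (omega b (α 1)) = {str P α 1 ℓ} := by
  have h1ℓ : 1 ∈ Icc 1 ℓ := ⟨le_rfl, by omega⟩
  ext x
  rw [h.realizationB.mem_disappearing_iff (m := 2) (f_omegaB h hℓ) two_pos
    (fun x => negFirst_involutive _), realizationB_roots h (by omega), mem_singleton_iff,
    ← h.realizationB.f_injective.eq_iff, f_strB h hℓ]
  simp only [Finset.sum_range_succ, Finset.sum_range_zero, zero_add, Function.iterate_zero, id,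
    Function.iterate_one]
  constructor
  · rintro ⟨hv, hpos, hz⟩
    have hz' : ∀ r, r ≠ 1 → h.realizationB.f x r = 0 := by
      intro r hr
      have := congrFun hz r
      rw [Pi.add_apply, negFirst, if_neg hr, Pi.zero_apply] at this
      linarith
    rcases hv with ⟨p, hp, q, hq, hpq, s, t, hs, ht, hx⟩ | ⟨p, hp, s, hs, hx⟩
    · exfalso
      have e := hz' q (by have := hp.1; omega)
      rw [hx] at e
      simp only [Pi.add_apply, Pi.smul_apply, ε_apply, smul_eq_mul, hpq.ne', if_true, if_false] at e
      rcases ht with rfl | rfl <;> norm_num at e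
    · have hp1 : p = 1 := by
        by_contra hne
        have e := hz' p hne
        rw [hx] at e
        rcases hs with rfl | rfl <;> norm_num [ε_apply] at e
      subst hp1
      rcases hs with rfl | rfl
      · rw [hx, one_mul, one_smul]
      · rw [hx, map_smul, realizationB_ht_ε h hp] at hpos
        have e3 : ((1 : ℕ) : ℝ) ≤ ℓ := by exact_mod_cast hp.2
        simp only [smul_eq_mul] at hpos
        linarith
  · intro hx
    rw [hx]
    refine ⟨.inr ⟨1, h1ℓ, 1, .inl rfl, by rw [one_mul, one_smul]⟩, ?_, ?_⟩
    · rw [realizationB_ht_ε h h1ℓ]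
      have e3 : ((1 : ℕ) : ℝ) ≤ ℓ := by exact_mod_cast h1ℓ.2
      linarith
    · funext s
      simp only [Pi.add_apply, negFirst, ε_apply, Pi.zero_apply]
      split_ifs <;> norm_num

theorem extraSet_B (h : IsLabelling b (CartanMatrix.B ℓ) α) (hℓ : 2 ≤ ℓ) :
    extraSet b (omega b (α 1)) 0 = {1, -1} := by
  have hr := realizationB_isClassical h
  have hT : negFirst (-(ε 1 + ε 2)) = h.realizationB.a 1 := by
    rw [hr.a_eq 1 le_rfl (by omega)]
    funext s
    simp only [negFirst, Pi.add_apply, Pi.neg_apply, Pi.sub_apply, ε_apply]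
    split_ifs <;> first | omega | norm_num
  apply extraSet_zero_eq_of_forall <;> rw [disappearing_B h hℓ]
  · exact singleton_nonempty _
  · rintro - rfl
    rw [h.realizationB.pairingPiZero_of_involutive (f_omegaB h hℓ) negFirst_involutive
      (f_highestRootB h hℓ) ⟨le_rfl, by omega⟩ hT, f_strB h hℓ, realizationB_k, coordSum_ε]
    norm_num

end TypeB

end Folding

namespace Folding

open Set

/-! ### Type D: realization, roots and candidates for `ω_j` -/

section TypeD

variable {ι M N : Type*} [AddCommGroup M] [Module ℝ M] [AddCommGroup N] [Module ℝ N]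
variable {P : RootPairing ι ℝ M N} {b : P.Base} {α : ℕ → ι} {ℓ : ℕ}
variable [P.IsRootSystem] [P.IsCrystallographic]

/-- The last row and column are separated from the chain `α_1, …, α_{ℓ-1}`, in accordance with the
case distinction in the realization. -/
theorem cartanMatrixD_apply (hℓ : 4 ≤ ℓ) (i j : Fin ℓ) :
    CartanMatrix.D ℓ i j =
      if (i : ℕ) + 1 < ℓ then
        if (j : ℕ) + 1 < ℓ then
          if (i : ℕ) = j then 2 else if (i : ℕ) + 1 = j ∨ (j : ℕ) + 1 = i then -1 else 0
        else if (i : ℕ) + 3 = ℓ then -1 else 0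
      else if (j : ℕ) + 1 < ℓ then if (j : ℕ) + 3 = ℓ then -1 else 0 else 2 := by
  obtain ⟨i, hi⟩ := i
  obtain ⟨j, hj⟩ := j
  simp only [CartanMatrix.D, Matrix.of_apply, Fin.mk.injEq]
  by_cases h1 : i + 1 < ℓ <;> by_cases h2 : j + 1 < ℓ <;> simp only [h1, h2, if_true, if_false] <;>
    split_ifs <;> first | rfl | omega

/-- The realization of type `D`. -/
noncomputable def IsLabelling.realizationD (h : IsLabelling b (CartanMatrix.D ℓ) α) (hℓ : 4 ≤ ℓ) :
    Realization b ℓ α (ℕ → ℝ) :=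
  h.realization (fun i => if i < ℓ then ε i - ε (i + 1) else ε (ℓ - 1) + ε ℓ)
    -- The last two simple roots are `e_{ℓ-1} ∓ e_ℓ`, so their coefficients are half of `x_1 + ⋯ +
    -- x_{ℓ-1} ∓ x_ℓ`.
    (fun i => if i < ℓ - 1 then coordSum i
      else if i < ℓ then (1 / 2 : ℝ) • (coordSum (ℓ - 1) - coordAt ℓ) else (1 / 2 : ℝ) • coordSum ℓ)
    (fun i => if i < ℓ then coordAt i - coordAt (i + 1) else coordAt (ℓ - 1) + coordAt ℓ)
    (by
      rintro i ⟨hi, hi'⟩ j ⟨hj, hj'⟩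
      by_cases h0 : i < ℓ - 1 <;> by_cases h1 : i < ℓ <;> by_cases h2 : j < ℓ <;>
        simp only [h0, h1, h2, if_true, if_false, map_sub, map_add, coordSum_ε, coordAt_apply,
          LinearMap.smul_apply, LinearMap.sub_apply, ε_apply, smul_eq_mul] <;>
        split_ifs <;> first | omega | norm_num)
    (by
      rintro ⟨i, hi⟩ ⟨j, hj⟩
      rw [cartanMatrixD_apply hℓ]
      by_cases h1 : i + 1 < ℓ <;> by_cases h2 : j + 1 < ℓ <;>
        simp only [h1, h2, if_true, if_false, LinearMap.sub_apply, LinearMap.add_apply,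
          coordAt_apply, Pi.sub_apply, Pi.add_apply, ε_apply] <;>
        split_ifs <;> first | omega | norm_num)

variable (h : IsLabelling b (CartanMatrix.D ℓ) α) (hℓ : 4 ≤ ℓ)

theorem realizationD_a_last : (h.realizationD hℓ).a ℓ = ε (ℓ - 1) + ε ℓ := if_neg (lt_irrefl ℓ)

theorem realizationD_c_last (v : ℕ → ℝ) : (h.realizationD hℓ).c ℓ v = v (ℓ - 1) + v ℓ := by
  change (if ℓ < ℓ then _ else _ : (ℕ → ℝ) →ₗ[ℝ] ℝ) v = _
  rw [if_neg (lt_irrefl ℓ)]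
  rfl

theorem realizationD_k {i : ℕ} (hi : i < ℓ - 1) : (h.realizationD hℓ).k i = coordSum i := if_pos hi

theorem realizationD_k_pred (v : ℕ → ℝ) :
    (h.realizationD hℓ).k (ℓ - 1) v = (1 / 2 : ℝ) * (coordSum (ℓ - 1) v - v ℓ) := by
  change (if ℓ - 1 < ℓ - 1 then _ else if ℓ - 1 < ℓ then _ else _ : (ℕ → ℝ) →ₗ[ℝ] ℝ) v = _
  rw [if_neg (lt_irrefl _), if_pos (by omega)]
  rfl

theorem realizationD_k_last (v : ℕ → ℝ) :
    (h.realizationD hℓ).k ℓ v = (1 / 2 : ℝ) * coordSum ℓ v := by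
  change (if ℓ < ℓ - 1 then _ else if ℓ < ℓ then _ else _ : (ℕ → ℝ) →ₗ[ℝ] ℝ) v = _
  rw [if_neg (by omega), if_neg (lt_irrefl _)]
  rfl

theorem realizationD_isClassical : (h.realizationD hℓ).IsClassical where
  a_eq i _ hi := if_pos hi
  c_eq i _ hi v := by
    change (if i < ℓ then _ else _ : (ℕ → ℝ) →ₗ[ℝ] ℝ) v = _
    rw [if_pos hi]
    rfl

theorem realizationD_ht_ε {p : ℕ} (hp : p ∈ Icc 1 ℓ) :
    (h.realizationD hℓ).ht (ε p) = (ℓ : ℝ) - p := by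
  have hr := realizationD_isClassical h hℓ
  have h1 := (h.realizationD hℓ).ht_a (i := ℓ) ⟨hp.1.trans hp.2, le_rfl⟩
  rw [realizationD_a_last, map_add, hr.ht_ε (p := ℓ - 1) ⟨by omega, by omega⟩,
    Nat.cast_sub (by omega)] at h1
  rw [hr.ht_ε hp]
  push_cast at h1
  linarith

/-- The last simple reflection exchanges the last two coordinates with sign changes, and
transpositions carry it to any pair. The case `p = q` is excluded: the Weyl group of type D contains
no single sign change. -/
theorem actsD_neg_swap {p q : ℕ} (hp : p ∈ Icc 1 ℓ) (hq : q ∈ Icc 1 ℓ) (hpq : p ≠ q) :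
    (h.realizationD hℓ).Acts fun v s => if s = p then -v q else if s = q then -v p else v s := by
  have hr := realizationD_isClassical h hℓ
  have hℓ' : ℓ ∈ Icc 1 ℓ := ⟨by omega, le_rfl⟩
  have h1 : (h.realizationD hℓ).Acts fun v s =>
      if s = ℓ - 1 then -v ℓ else if s = ℓ then -v (ℓ - 1) else v s := by
    convert (h.realizationD hℓ).acts_reflection hℓ' using 1
    funext v s
    rw [realizationD_a_last, realizationD_c_last]
    simp only [Pi.sub_apply, Pi.smul_apply, Pi.add_apply, ε_apply, smul_eq_mul]
    split_ifs with h1 h2 h3 <;> first | omega | (subst h1; ring) | (subst h3; ring) | ring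
  have h2 : ∀ p ∈ Icc 1 ℓ, p ≠ ℓ → (h.realizationD hℓ).Acts fun v s =>
      if s = p then -v ℓ else if s = ℓ then -v p else v s := by
    intro p hp hpℓ
    have h3 := hr.acts_swap (p := ℓ - 1) ⟨by omega, by omega⟩ hp
    convert (h3.comp h1).comp h3 using 1
    funext v s
    simp only [Function.comp_apply, Equiv.swap_apply_def]
    split_ifs <;> first | omega | simp_all
  by_cases hpℓ : p = ℓ
  · subst hpℓ
    convert h2 q hq hpq.symm using 1
    funext v s
    split_ifs <;> first | omega | rfl
  · have h3 := hr.acts_swap hℓ' hq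
    convert (h3.comp (h2 p hp hpℓ)).comp h3 using 1
    funext v s
    simp only [Function.comp_apply, Equiv.swap_apply_def]
    split_ifs <;> first | omega | simp_all

/-- The change of sign of the coordinates `p` and `q`. -/
def negPair (p q : ℕ) (v : ℕ → ℝ) (s : ℕ) : ℝ := if s = p ∨ s = q then -v s else v s

theorem negPair_involutive (p q : ℕ) : Function.Involutive (negPair p q) := by
  intro v
  funext s
  unfold negPair
  split_ifs <;> simp

theorem actsD_negPair {p q : ℕ} (hp : p ∈ Icc 1 ℓ) (hq : q ∈ Icc 1 ℓ) (hpq : p ≠ q) :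
    (h.realizationD hℓ).Acts (negPair p q) := by
  convert (actsD_neg_swap h hℓ hp hq hpq).comp
    ((realizationD_isClassical h hℓ).acts_swap hp hq) using 1
  funext v s
  simp only [negPair, Function.comp_apply, Equiv.swap_apply_def]
  split_ifs <;> simp_all

/-- The action of `ω_{ℓ-1}` and `ω_ℓ` in type `D`, for suitable signs `s` and `t`. -/
def turn (ℓ : ℕ) (s t : ℝ) (v : ℕ → ℝ) (r : ℕ) : ℝ :=
  if r = 1 then s * v ℓ else if r = ℓ then t * v 1
  else if 1 < r ∧ r < ℓ then -v (ℓ + 1 - r) else v r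

/-- Without a middle coordinate the inner pairs contribute an even number of signs, so the ends must
be exchanged with no sign or with two. -/
theorem actsD_turn_of_even (hev : Even ℓ) {t : ℝ} (ht : t = 1 ∨ t = -1) :
    (h.realizationD hℓ).Acts (turn ℓ t t) := by
  obtain ⟨n, rfl⟩ := hev
  have h1 : (1 : ℕ) ∈ Icc 1 (n + n) := ⟨le_rfl, by omega⟩
  have hn : n + n ∈ Icc 1 (n + n) := ⟨by omega, le_rfl⟩
  rcases ht with rfl | rfl
  · convert (Realization.acts_reverse (r := h.realizationD hℓ) (lo := 2) (hi := n) (by omega)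
      (by omega) fun p h1 h2 => actsD_neg_swap h hℓ ⟨by omega, by omega⟩ ⟨by omega, by omega⟩
        (by omega)).comp ((realizationD_isClassical h hℓ).acts_swap h1 hn) using 1
    funext v r
    simp only [turn, Function.comp_apply, Equiv.swap_apply_def, one_mul]
    split_ifs <;> first | omega | rfl
  · convert Realization.acts_reverse (r := h.realizationD hℓ) (lo := 1) (hi := n) (by omega)
      (by omega) fun p h1 h2 => actsD_neg_swap h hℓ ⟨by omega, by omega⟩ ⟨by omega, by omega⟩
        (by omega) using 1
    funext v r
    simp only [turn, neg_mul, one_mul]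
    split_ifs <;> first | omega | rfl | (congr 2; omega)

/-- The middle coordinate changes sign alone, so exactly one of the ends must do so as well. This is
why the two end signs are opposite. -/
theorem actsD_turn_of_odd (hodd : Odd ℓ) {t : ℝ} (ht : t = 1 ∨ t = -1) :
    (h.realizationD hℓ).Acts (turn ℓ (-t) t) := by
  obtain ⟨n, rfl⟩ := hodd
  have h1 : (1 : ℕ) ∈ Icc 1 (2 * n + 1) := ⟨le_rfl, by omega⟩
  have hn : 2 * n + 1 ∈ Icc 1 (2 * n + 1) := ⟨by omega, le_rfl⟩
  have h2 := (Realization.acts_reverse (r := h.realizationD hℓ) (lo := 2) (hi := n) (by omega)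
      (by omega) fun p h1 h2 => actsD_neg_swap h hℓ ⟨by omega, by omega⟩ ⟨by omega, by omega⟩
        (by omega)).comp ((realizationD_isClassical h hℓ).acts_swap h1 hn)
  rcases ht with rfl | rfl
  · convert (actsD_negPair h hℓ (p := n + 1) (q := 1) ⟨by omega, by omega⟩ h1 (by omega)).comp h2
      using 1
    funext v r
    simp only [turn, negPair, Function.comp_apply, Equiv.swap_apply_def, one_mul, neg_mul]
    split_ifs <;> first | omega | rfl | (congr 2; omega)
  · convert (actsD_negPair h hℓ (p := n + 1) (q := 2 * n + 1) ⟨by omega, by omega⟩ hn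
      (by omega)).comp h2 using 1
    funext v r
    simp only [turn, negPair, Function.comp_apply, Equiv.swap_apply_def, one_mul, neg_mul, neg_neg]
    split_ifs <;> first | omega | rfl | (congr 2; omega)

/-- The square is the identity on the inner coordinates and `s * t` on the ends: `turn` is an
involution for equal signs and has order 4 for opposite signs. -/
theorem turn_turn {s t : ℝ} (hℓ : 2 ≤ ℓ) (v : ℕ → ℝ) (r : ℕ) :
    turn ℓ s t (turn ℓ s t v) r = if r = 1 ∨ r = ℓ then s * t * v r else v r := by
  by_cases h1 : r = 1
  · subst h1
    simp only [turn, true_or, if_true, if_neg (by omega : ¬ ℓ = 1)]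
    ring
  by_cases h2 : r = ℓ
  · subst h2
    simp only [turn, or_true, if_true, if_neg h1]
    ring
  simp only [turn]
  split_ifs <;> first | omega | rfl | (rw [neg_neg]; congr 1; omega)

variable [Finite ι] [P.IsReduced]

theorem realizationD_roots : (h.realizationD hℓ).roots = pairRoots ℓ := by
  have hr := realizationD_isClassical h hℓ
  have hℓ' : ℓ ∈ Icc 1 ℓ := ⟨by omega, le_rfl⟩
  have hℓ1 : ℓ - 1 ∈ Icc 1 ℓ := ⟨by omega, by omega⟩
  apply subset_antisymm
  · refine (h.realizationD hℓ).roots_subset ?_ (fun v hv => neg_mem_pairRoots hv) ?_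
    · rintro i ⟨hi, hi'⟩
      rcases hi'.lt_or_eq with hlt | rfl
      · rw [hr.a_eq i hi hlt]
        convert mem_pairRoots_of_ne (p := i) (q := i + 1) ⟨hi, hi'⟩ ⟨by omega, hlt⟩ (by omega)
          (.inl rfl) (.inr rfl) using 1
        module
      · rw [realizationD_a_last]
        exact ⟨i - 1, hℓ1, i, hℓ', by omega, 1, 1, .inl rfl, .inl rfl, by module⟩
    · rintro i ⟨hi, hi'⟩ v hv
      rcases hi'.lt_or_eq with hlt | rfl
      · exact (hr.isSignedPerm hi hlt).mem_pairRoots hv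
      · refine IsSignedPerm.mem_pairRoots (T := fun v => v - _ • _) (g := Equiv.swap (i - 1) i)
          ⟨fun v w => by simp only [map_add]; module,
          fun s v => by simp only [map_smul, smul_eq_mul]; module,
          fun p hp => swap_mem_Icc hℓ1 hℓ' hp, (Equiv.injective _).injOn, fun p _ => ?_⟩ hv
        rw [realizationD_a_last, realizationD_c_last]
        by_cases hp : p = i - 1 ∨ p = i
        · refine ⟨-1, .inr rfl, ?_⟩
          funext s
          simp only [Pi.sub_apply, Pi.smul_apply, Pi.add_apply, ε_apply, smul_eq_mul,
            Equiv.swap_apply_def]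
          split_ifs <;> first | omega | norm_num
        · refine ⟨1, .inl rfl, ?_⟩
          funext s
          simp only [Pi.sub_apply, Pi.smul_apply, Pi.add_apply, ε_apply, smul_eq_mul,
            Equiv.swap_apply_def]
          split_ifs <;> first | omega | norm_num
  · have h1 : ∀ p ∈ Icc 1 ℓ, ∀ q ∈ Icc 1 ℓ, p < q → ∀ t : ℝ, (t = 1 ∨ t = -1) →
        ε p + t • ε q ∈ (h.realizationD hℓ).roots := by
      intro p hp q hq hpq t ht
      rcases ht with rfl | rfl
      -- Signs change only in pairs, so the sign at `q` is changed together with that at an index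
      -- outside the support.
      · obtain ⟨o, ho, hop, hoq⟩ : ∃ o ∈ Icc 1 ℓ, o ≠ p ∧ o ≠ q := by
          by_cases e1 : p = 1
          · by_cases e2 : q = 2
            · exact ⟨3, ⟨by omega, by omega⟩, by omega, by omega⟩
            · exact ⟨2, ⟨by omega, by omega⟩, by omega, by omega⟩
          · exact ⟨1, ⟨by omega, by omega⟩, by omega, by have := hp.1; omega⟩
        convert (actsD_negPair h hℓ hq ho hoq.symm).mem_roots (hr.sub_mem_roots hp hq hpq) using 1
        funext s
        simp only [negPair, Pi.add_apply, Pi.sub_apply, Pi.smul_apply, ε_apply, smul_eq_mul]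
        split_ifs <;> first | omega | norm_num
      · convert hr.sub_mem_roots hp hq hpq using 1
        module
    rintro v ⟨p, hp, q, hq, hpq, s, t, hs, ht, rfl⟩
    rcases hs with rfl | rfl
    · rw [one_smul]
      exact h1 p hp q hq hpq t ht
    · convert (h.realizationD hℓ).neg_mem_roots (h1 p hp q hq hpq (-t) ?_) using 1
      · module
      · rcases ht with rfl | rfl <;> simp

/-- Since `e_p` has height `ℓ - p`, the coordinate with the smaller index decides the sign of the
height. -/
theorem realizationD_pos_iff (v : ℕ → ℝ) :
    v ∈ (h.realizationD hℓ).roots ∧ 0 < (h.realizationD hℓ).ht v ↔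
      ∃ p ∈ Icc 1 ℓ, ∃ q ∈ Icc 1 ℓ, p < q ∧ ∃ t : ℝ, (t = 1 ∨ t = -1) ∧ v = ε p + t • ε q := by
  rw [realizationD_roots]
  constructor
  · rintro ⟨⟨p, hp, q, hq, hpq, s, t, hs, ht, rfl⟩, hpos⟩
    refine ⟨p, hp, q, hq, hpq, t, ht, ?_⟩
    rcases hs with rfl | rfl
    · rw [one_smul]
    · exfalso
      rw [map_add, map_smul, map_smul, realizationD_ht_ε h hℓ hp, realizationD_ht_ε h hℓ hq] at hpos
      have e2 : (p : ℝ) + 1 ≤ q := by exact_mod_cast hpq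
      have e3 : (q : ℝ) ≤ ℓ := by exact_mod_cast hq.2
      rcases ht with rfl | rfl <;> simp only [smul_eq_mul] at hpos <;> linarith
  · rintro ⟨p, hp, q, hq, hpq, t, ht, rfl⟩
    refine ⟨⟨p, hp, q, hq, hpq, 1, t, .inl rfl, ht, by rw [one_smul]⟩, ?_⟩
    rw [map_add, map_smul, realizationD_ht_ε h hℓ hp, realizationD_ht_ε h hℓ hq]
    have e2 : (p : ℝ) + 1 ≤ q := by exact_mod_cast hpq
    have e3 : (q : ℝ) ≤ ℓ := by exact_mod_cast hq.2
    rcases ht with rfl | rfl <;> simp only [smul_eq_mul] <;> linarith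

theorem f_highestRootD [Nonempty ι] :
    (h.realizationD hℓ).f (P.root (highestRoot b)) = ε 1 + ε 2 := by
  have h1ℓ : 1 ∈ Icc 1 ℓ := ⟨le_rfl, by omega⟩
  have h2ℓ : 2 ∈ Icc 1 ℓ := ⟨by omega, by omega⟩
  have hl : (4 : ℝ) ≤ ℓ := by exact_mod_cast hℓ
  refine (h.realizationD hℓ).f_highestRoot ?_ ?_
  · rw [realizationD_roots]
    exact ⟨1, h1ℓ, 2, h2ℓ, one_lt_two, 1, 1, .inl rfl, .inl rfl, by module⟩
  · intro v hv
    rw [map_add, realizationD_ht_ε h hℓ h1ℓ, realizationD_ht_ε h hℓ h2ℓ]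
    by_cases hpos : 0 < (h.realizationD hℓ).ht v
    · obtain ⟨p, hp, q, hq, hpq, t, ht, rfl⟩ := (realizationD_pos_iff h hℓ v).mp ⟨hv, hpos⟩
      rw [map_add, map_smul, realizationD_ht_ε h hℓ hp, realizationD_ht_ε h hℓ hq]
      have e1 : (1 : ℝ) ≤ p := by exact_mod_cast hp.1
      have e2 : (p : ℝ) + 1 ≤ q := by exact_mod_cast hpq
      have e3 : (q : ℝ) ≤ ℓ := by exact_mod_cast hq.2
      rcases ht with rfl | rfl
      · by_cases heq : p = 1 ∧ q = 2
        · left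
          rw [heq.1, heq.2, one_smul]
        · right
          have e4 : (1 : ℝ) + 2 + 1 ≤ p + q := by
            have := hp.1
            exact_mod_cast (by omega : 1 + 2 + 1 ≤ p + q)
          simp only [smul_eq_mul, Nat.cast_one, Nat.cast_ofNat]
          linarith
      · right
        simp only [smul_eq_mul, Nat.cast_one, Nat.cast_ofNat]
        linarith
    · right
      push_cast
      linarith

theorem minuscule_D [Nonempty ι] (h : IsLabelling b (CartanMatrix.D ℓ) α) (hℓ : 4 ≤ ℓ) :
    minuscule b = {α 1, α (ℓ - 1), α ℓ} := by
  rw [(h.realizationD hℓ).minuscule_eq (f_highestRootD h hℓ)]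
  have : {j ∈ Icc 1 ℓ | (h.realizationD hℓ).k j (ε 1 + ε 2) = 1} = {1, ℓ - 1, ℓ} := by
    ext j
    rw [mem_ofPred_eq, mem_insert_iff, mem_insert_iff, mem_singleton_iff]
    by_cases h1 : j < ℓ - 1
    · rw [realizationD_k h hℓ h1, map_add, coordSum_ε, coordSum_ε, mem_Icc]
      split_ifs <;> constructor <;> intro _ <;>
        first | omega | (simp_all; done) | (simp_all; omega)
    by_cases h2 : j = ℓ - 1
    · subst h2
      rw [realizationD_k_pred, map_add, coordSum_ε, coordSum_ε, if_pos ⟨le_rfl, by omega⟩,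
        if_pos ⟨one_le_two, by omega⟩, Pi.add_apply, ε_apply, ε_apply, if_neg (by omega),
        if_neg (by omega)]
      exact ⟨fun _ => by tauto, fun _ => ⟨⟨by omega, by omega⟩, by norm_num⟩⟩
    by_cases h3 : j = ℓ
    · subst h3
      rw [realizationD_k_last, map_add, coordSum_ε, coordSum_ε, if_pos ⟨le_rfl, by omega⟩,
        if_pos ⟨one_le_two, by omega⟩]
      exact ⟨fun _ => by tauto, fun _ => ⟨⟨by omega, by omega⟩, by norm_num⟩⟩
    · rw [mem_Icc]
      constructor <;> intro _ <;> omega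
  rw [this, image_insert_eq, image_insert_eq, image_singleton]

end TypeD

end Folding

namespace Folding

open Set

/-! ### Type D: strings of simple roots, the case `j = 1`, images of simple roots -/

section TypeD

/-- Disjointness is detected by a function that is constant on each set with distinct values on
different sets. -/
theorem isDisjointUnion_of_forall {X : Type*} {S : Set X} {L : List (Set X)} {φ : X → ℝ}
    {c : List ℝ} (hc : c.Nodup) (h : List.Forall₂ (fun T a => ∀ x ∈ T, φ x = a) L c)
    (hS : S = {x | ∃ T ∈ L, x ∈ T}) : IsDisjointUnion S L := by
  refine ⟨?_, hS⟩
  clear hS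
  induction h with
  | nil => exact List.Pairwise.nil
  | @cons T a L c hT hL ih =>
    rw [List.nodup_cons] at hc
    refine List.pairwise_cons.mpr ⟨fun T' hT' => disjoint_left.mpr fun x hx hx' => hc.1 ?_, ih hc.2⟩
    obtain ⟨n, hn, rfl⟩ := List.getElem_of_mem hT'
    have hn' : n < c.length := by rwa [← hL.length_eq]
    have := (List.forall₂_iff_get.mp hL).2 n hn hn' x hx'
    rw [← hT x hx, this]
    exact List.get_mem _ _

variable {ι M N : Type*} [AddCommGroup M] [Module ℝ M] [AddCommGroup N] [Module ℝ N]
variable {P : RootPairing ι ℝ M N} {b : P.Base} {α : ℕ → ι} {ℓ : ℕ}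

section Strings

variable {W : Type*} [AddCommGroup W] [Module ℝ W] {g : M →ₗ[ℝ] W} {u : ℕ → W}

theorem map_strD_pred (hℓ : 4 ≤ ℓ) (h1 : ∀ i ∈ Icc 1 (ℓ - 1), g (P.root (α i)) = u i - u (i + 1))
    {i : ℕ} (hi : i ∈ Icc 1 (ℓ - 1)) :
    g (str P α i (ℓ - 2) + P.root (α (ℓ - 1))) = u i - u ℓ := by
  obtain ⟨hi, hi'⟩ := hi
  rw [map_add, map_str g u (by omega) fun j hj hj' => h1 j ⟨by omega, by omega⟩,
    h1 (ℓ - 1) ⟨by omega, le_rfl⟩, (by omega : ℓ - 2 + 1 = ℓ - 1), (by omega : ℓ - 1 + 1 = ℓ)]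
  abel

theorem map_strD_last (hℓ : 4 ≤ ℓ) (h1 : ∀ i ∈ Icc 1 (ℓ - 1), g (P.root (α i)) = u i - u (i + 1))
    (h2 : g (P.root (α ℓ)) = u (ℓ - 1) + u ℓ) {i : ℕ} (hi : i ∈ Icc 1 (ℓ - 1)) :
    g (str P α i (ℓ - 2) + P.root (α ℓ)) = u i + u ℓ := by
  obtain ⟨hi, hi'⟩ := hi
  rw [map_add, map_str g u (by omega) fun j hj hj' => h1 j ⟨by omega, by omega⟩, h2,
    (by omega : ℓ - 2 + 1 = ℓ - 1)]
  abel

/-- The two ends of the diagram add up to `2u_{ℓ-1}`, after which everything telescopes. Both `m = ℓ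
- i` and, for odd `ℓ`, `m = (ℓ - 1) / 2` are used. -/
theorem map_strD (hℓ : 4 ≤ ℓ) (h1 : ∀ i ∈ Icc 1 (ℓ - 1), g (P.root (α i)) = u i - u (i + 1))
    (h2 : g (P.root (α ℓ)) = u (ℓ - 1) + u ℓ) {i m : ℕ} (hi : 1 ≤ i) (him : i ≤ m + 1)
    (hm : m < ℓ - 1) :
    g (str P α i m + (2 : ℝ) • str P α (m + 1) (ℓ - 2) + P.root (α (ℓ - 1)) + P.root (α ℓ))
      = u i + u (m + 1) := by
  rw [map_add, map_add, map_add, map_smul,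
    map_str g u (by omega) fun j hj hj' => h1 j ⟨by omega, by omega⟩,
    map_str g u (by omega) fun j hj hj' => h1 j ⟨by omega, by omega⟩, h2,
    h1 (ℓ - 1) ⟨by omega, le_rfl⟩, (by omega : ℓ - 2 + 1 = ℓ - 1), (by omega : ℓ - 1 + 1 = ℓ)]
  module

end Strings

variable [P.IsRootSystem] [P.IsCrystallographic]
variable (h : IsLabelling b (CartanMatrix.D ℓ) α) (hℓ : 4 ≤ ℓ)

theorem realizationD_f_root {i : ℕ} (hi : i ∈ Icc 1 (ℓ - 1)) :
    (h.realizationD hℓ).f (P.root (α i)) = ε i - ε (i + 1) := by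
  have := hi.1
  have := hi.2
  rw [(h.realizationD hℓ).map_root i ⟨by omega, by omega⟩,
    (realizationD_isClassical h hℓ).a_eq i (by omega) (by omega)]

theorem realizationD_f_root_last :
    (h.realizationD hℓ).f (P.root (α ℓ)) = ε (ℓ - 1) + ε ℓ := by
  rw [(h.realizationD hℓ).map_root ℓ ⟨by omega, le_rfl⟩, realizationD_a_last]

variable [Finite ι] [P.IsReduced]

/-! ### The element `ω_1` -/

/-- Changing the signs of `x_1` and `x_ℓ` exchanges `α_{ℓ-1}` and `α_ℓ`, fixes `α_2, …, α_{ℓ-2}` and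
sends `α_1` to `α_0`. -/
theorem f_omegaD_first (x : M) :
    (h.realizationD hℓ).f (omega b (α 1) x) = negPair 1 ℓ ((h.realizationD hℓ).f x) := by
  have hr := realizationD_isClassical h hℓ
  refine (h.realizationD hℓ).f_omega (actsD_negPair h hℓ ⟨le_rfl, by omega⟩ ⟨by omega, le_rfl⟩
    (by omega)) ⟨le_rfl, by omega⟩ ?_ x
  rintro i ⟨hi, hi'⟩
  by_cases h1 : i = 1
  · right
    subst h1
    have : negPair 1 ℓ (ε 1 - ε (1 + 1)) = -ε 1 - ε 2 := by
      funext s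
      simp only [negPair, Pi.sub_apply, Pi.neg_apply, ε_apply]
      split_ifs <;> first | omega | norm_num
    rw [hr.a_eq 1 hi (by omega), this, realizationD_k h hℓ (by omega), map_sub, map_neg,
      coordSum_ε, coordSum_ε]
    norm_num
  left
  by_cases h2 : i = ℓ
  · subst h2
    refine ⟨i - 1, ⟨by omega, by omega⟩, by omega, ?_⟩
    rw [realizationD_a_last, hr.a_eq (i - 1) (by omega) (by omega)]
    funext s
    simp only [negPair, Pi.sub_apply, Pi.add_apply, ε_apply]
    split_ifs <;> first | omega | norm_num
  by_cases h3 : i = ℓ - 1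
  · subst h3
    refine ⟨ℓ, ⟨by omega, by omega⟩, by omega, ?_⟩
    rw [realizationD_a_last, hr.a_eq (ℓ - 1) (by omega) (by omega)]
    funext s
    simp only [negPair, Pi.sub_apply, Pi.add_apply, ε_apply]
    split_ifs <;> first | omega | norm_num
  · refine ⟨i, ⟨hi, hi'⟩, h1, ?_⟩
    rw [hr.a_eq i hi (by omega)]
    funext s
    simp only [negPair, Pi.sub_apply, ε_apply]
    split_ifs <;> first | omega | norm_num

/-- The average vanishes exactly when the inner coordinates do, so the support of the root is `{1,
ℓ}`. -/
theorem mem_disappearing_D_first {x : M} :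
    x ∈ disappearing b (omega b (α 1)) ↔ (h.realizationD hℓ).f x = ε 1 - ε ℓ ∨
      (h.realizationD hℓ).f x = ε 1 + ε ℓ := by
  rw [(h.realizationD hℓ).mem_disappearing_iff (m := 2) (f_omegaD_first h hℓ) two_pos
    (fun x => negPair_involutive _ _ _), ← and_assoc, realizationD_pos_iff]
  simp only [Finset.sum_range_succ, Finset.sum_range_zero, zero_add, Function.iterate_zero, id,
    Function.iterate_one]
  generalize (h.realizationD hℓ).f x = v
  constructor
  · rintro ⟨⟨p, ⟨hp, hp'⟩, q, ⟨hq, hq'⟩, hpq, t, ht, rfl⟩, hz⟩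
    have hz' : ∀ r, r ≠ 1 → r ≠ ℓ → (ε p + t • ε q) r = 0 := by
      intro r h1 h2
      have := congrFun hz r
      rw [Pi.add_apply, negPair, if_neg (by omega), Pi.zero_apply] at this
      linarith
    have hp1 : p = 1 := by
      by_contra hne
      have := hz' p hne (by omega)
      simp only [Pi.add_apply, Pi.smul_apply, ε_apply, if_true, if_neg hpq.ne, smul_eq_mul] at this
      norm_num at this
    have hqℓ : q = ℓ := by
      by_contra hne
      have := hz' q (by omega) hne
      simp only [Pi.add_apply, Pi.smul_apply, ε_apply, if_true, if_neg hpq.ne', smul_eq_mul] at this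
      rcases ht with rfl | rfl <;> norm_num at this
    subst hp1 hqℓ
    rcases ht with rfl | rfl
    · right
      rw [one_smul]
    · left
      module
  · have h1ℓ : 1 ∈ Icc 1 ℓ := ⟨le_rfl, by omega⟩
    have hℓ' : ℓ ∈ Icc 1 ℓ := ⟨by omega, le_rfl⟩
    rintro (rfl | rfl)
    · refine ⟨⟨1, h1ℓ, ℓ, hℓ', by omega, -1, .inr rfl, by module⟩, ?_⟩
      funext s
      simp only [negPair, Pi.sub_apply, Pi.add_apply, ε_apply, Pi.zero_apply]
      split_ifs <;> first | omega | norm_num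
    · refine ⟨⟨1, h1ℓ, ℓ, hℓ', by omega, 1, .inl rfl, by module⟩, ?_⟩
      funext s
      simp only [negPair, Pi.add_apply, ε_apply, Pi.zero_apply]
      split_ifs <;> first | omega | norm_num

theorem str_eq_add_root (hℓ : 4 ≤ ℓ) : str P α 1 (ℓ - 1) = str P α 1 (ℓ - 2) + P.root (α (ℓ - 1)) := by
  obtain ⟨n, rfl⟩ : ∃ n, ℓ = n + 2 := ⟨ℓ - 2, by omega⟩
  exact Finset.sum_Icc_succ_top (by omega) _

theorem disappearing_D_first (h : IsLabelling b (CartanMatrix.D ℓ) α) (hℓ : 4 ≤ ℓ) :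
    disappearing b (omega b (α 1)) = {str P α 1 (ℓ - 1), str P α 1 (ℓ - 2) + P.root (α ℓ)} := by
  ext x
  rw [mem_disappearing_D_first h hℓ, mem_insert_iff, mem_singleton_iff, str_eq_add_root hℓ,
    ← (h.realizationD hℓ).f_injective.eq_iff, ← (h.realizationD hℓ).f_injective.eq_iff (a := x),
    map_strD_pred (u := ε) hℓ (fun i => realizationD_f_root h hℓ) ⟨le_rfl, by omega⟩,
    map_strD_last (u := ε) hℓ (fun i => realizationD_f_root h hℓ) (realizationD_f_root_last h hℓ)
      ⟨le_rfl, by omega⟩]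

theorem image_disappearing_D_first (h : IsLabelling b (CartanMatrix.D ℓ) α) (hℓ : 4 ≤ ℓ)
    {W : Type*} [AddCommGroup W] [Module ℝ W] {g : M →ₗ[ℝ] W} {u : ℕ → W}
    (h1 : ∀ i ∈ Icc 1 (ℓ - 1), g (P.root (α i)) = u i - u (i + 1))
    (h2 : g (P.root (α ℓ)) = u (ℓ - 1) + u ℓ) :
    g '' disappearing b (omega b (α 1)) = {u 1 - u ℓ, u 1 + u ℓ} := by
  rw [disappearing_D_first h hℓ, image_insert_eq, image_singleton, str_eq_add_root hℓ,
    map_strD_pred hℓ h1 ⟨le_rfl, by omega⟩, map_strD_last hℓ h1 h2 ⟨le_rfl, by omega⟩]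

theorem extraSet_D_first [Nonempty ι] (h : IsLabelling b (CartanMatrix.D ℓ) α) (hℓ : 4 ≤ ℓ) :
    extraSet b (omega b (α 1)) 0 = {1, -1} := by
  have hr := realizationD_isClassical h hℓ
  have hT : negPair 1 ℓ (-(ε 1 + ε 2)) = (h.realizationD hℓ).a 1 := by
    rw [hr.a_eq 1 le_rfl (by omega)]
    funext s
    simp only [negPair, Pi.add_apply, Pi.neg_apply, Pi.sub_apply, ε_apply]
    split_ifs <;> first | omega | norm_num
  apply extraSet_zero_eq_of_forall
  · rw [disappearing_D_first h hℓ]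
    exact insert_nonempty _ _
  · intro x hx
    rw [(h.realizationD hℓ).pairingPiZero_of_involutive (f_omegaD_first h hℓ)
      (negPair_involutive 1 ℓ) (f_highestRootD h hℓ) ⟨le_rfl, by omega⟩ hT,
      realizationD_k h hℓ (by omega)]
    rcases (mem_disappearing_D_first h hℓ).mp hx with hx | hx <;>
      rw [hx] <;> simp only [map_sub, map_add, coordSum_ε] <;>
      rw [if_pos ⟨le_rfl, le_rfl⟩, if_neg (by omega)] <;> norm_num

/-! ### The elements `ω_{ℓ-1}` and `ω_ℓ` -/

/-- One has `α_1 ↦ e_{ℓ-1} + t e_ℓ`, which is the one of `α_{ℓ-1}, α_ℓ` that differs from `α_j`;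
this fixes the correspondence between `t` and `j`. The sign `s` decides which of the last two simple
roots goes to `α_0`, and the other goes to `α_1`. -/
theorem turn_a {s t : ℝ} (hs : s = 1 ∨ s = -1) (ht : t = 1 ∨ t = -1) {j : ℕ}
    (hj : j = ℓ - 1 ∧ t = 1 ∨ j = ℓ ∧ t = -1) {i : ℕ} (hi : i ∈ Icc 1 ℓ) :
    (∃ k ∈ Icc 1 ℓ, k ≠ j ∧ turn ℓ s t ((h.realizationD hℓ).a i) = (h.realizationD hℓ).a k) ∨
      (h.realizationD hℓ).k j (turn ℓ s t ((h.realizationD hℓ).a i)) < 0 := by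
  have hr := realizationD_isClassical h hℓ
  have hneg : (h.realizationD hℓ).k j (-ε 1 - ε 2) < 0 := by
    rcases hj with ⟨rfl, -⟩ | ⟨rfl, -⟩
    · rw [realizationD_k_pred, map_sub, map_neg, coordSum_ε, coordSum_ε, if_pos ⟨le_rfl, by omega⟩,
        if_pos ⟨one_le_two, by omega⟩, Pi.sub_apply, Pi.neg_apply, ε_apply, ε_apply,
        if_neg (by omega), if_neg (by omega)]
      norm_num
    · rw [realizationD_k_last, map_sub, map_neg, coordSum_ε, coordSum_ε, if_pos ⟨le_rfl, by omega⟩,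
        if_pos ⟨one_le_two, by omega⟩]
      norm_num
  obtain ⟨hi, hi'⟩ := hi
  by_cases h1 : i = 1
  · subst h1
    left
    rw [hr.a_eq 1 hi (by omega)]
    rcases hj with ⟨rfl, rfl⟩ | ⟨rfl, rfl⟩
    · refine ⟨ℓ, ⟨hi', le_rfl⟩, by omega, ?_⟩
      rw [realizationD_a_last]
      funext r
      simp only [turn, Pi.sub_apply, Pi.add_apply, ε_apply]
      split_ifs <;> first | omega | norm_num
    · refine ⟨j - 1, ⟨by omega, by omega⟩, by omega, ?_⟩
      rw [hr.a_eq (j - 1) (by omega) (by omega)]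
      funext r
      simp only [turn, Pi.sub_apply, ε_apply]
      split_ifs <;> first | omega | norm_num
  by_cases h2 : i = ℓ
  · subst h2
    rw [realizationD_a_last]
    rcases hs with rfl | rfl
    · left
      refine ⟨1, ⟨le_rfl, hi⟩, by omega, ?_⟩
      rw [hr.a_eq 1 le_rfl (by omega)]
      funext r
      simp only [turn, Pi.sub_apply, Pi.add_apply, ε_apply]
      split_ifs <;> first | omega | norm_num
    · right
      convert hneg using 2
      funext r
      simp only [turn, Pi.sub_apply, Pi.neg_apply, Pi.add_apply, ε_apply]
      split_ifs <;> first | omega | norm_num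
  by_cases h3 : i = ℓ - 1
  · subst h3
    rw [hr.a_eq (ℓ - 1) hi (by omega)]
    rcases hs with rfl | rfl
    · right
      convert hneg using 2
      funext r
      simp only [turn, Pi.sub_apply, Pi.neg_apply, ε_apply]
      split_ifs <;> first | omega | norm_num
    · left
      refine ⟨1, ⟨le_rfl, by omega⟩, by omega, ?_⟩
      rw [hr.a_eq 1 le_rfl (by omega)]
      funext r
      simp only [turn, Pi.sub_apply, ε_apply]
      split_ifs <;> first | omega | norm_num
  · left
    refine ⟨ℓ - i, ⟨by omega, by omega⟩, by omega, ?_⟩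
    rw [hr.a_eq i hi (by omega), hr.a_eq (ℓ - i) (by omega) (by omega)]
    funext r
    simp only [turn, Pi.sub_apply, ε_apply]
    split_ifs <;> first | omega | norm_num

theorem turn_neg_highest {s t : ℝ} {j : ℕ} (hj : j = ℓ - 1 ∧ t = 1 ∨ j = ℓ ∧ t = -1) :
    turn ℓ s t (-(ε 1 + ε 2)) = (h.realizationD hℓ).a j := by
  rcases hj with ⟨rfl, rfl⟩ | ⟨rfl, rfl⟩
  · rw [(realizationD_isClassical h hℓ).a_eq (ℓ - 1) (by omega) (by omega)]
    funext r
    simp only [turn, Pi.sub_apply, Pi.neg_apply, Pi.add_apply, ε_apply]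
    split_ifs <;> first | omega | norm_num
  · rw [realizationD_a_last]
    funext r
    simp only [turn, Pi.neg_apply, Pi.add_apply, ε_apply]
    split_ifs <;> first | omega | norm_num

end TypeD

end Folding

namespace Folding

open Set

/-! ### Type D: vectors of zero average for `j = ℓ - 1` and `j = ℓ` -/

section TypeD

variable {ι M N : Type*} [AddCommGroup M] [Module ℝ M] [AddCommGroup N] [Module ℝ N]
variable {P : RootPairing ι ℝ M N} {b : P.Base} {α : ℕ → ι} {ℓ : ℕ}

/-- An inner index of the support is either the midpoint or mirrored by the other index with the
same sign; the indices `1` and `ℓ` are not constrained. -/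
theorem eq_of_pair_symmetric {p q : ℕ} {t : ℝ} (hp : p ∈ Icc 1 ℓ) (hq : q ∈ Icc 1 ℓ) (hpq : p < q)
    (ht : t = 1 ∨ t = -1)
    (hz : ∀ r, 1 < r → r < ℓ → (ε p + t • ε q) r = (ε p + t • ε q) (ℓ + 1 - r)) :
    (2 ≤ p ∧ p + q = ℓ + 1 ∧ t = 1) ∨ ((p = 1 ∨ 2 * p = ℓ + 1) ∧ (q = ℓ ∨ 2 * q = ℓ + 1)) := by
  obtain ⟨hp, hp'⟩ := hp
  obtain ⟨hq, hq'⟩ := hq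
  have e1 : q < ℓ → (p + q = ℓ + 1 ∧ (1 : ℝ) = t) ∨ 2 * q = ℓ + 1 := fun h =>
    eq_of_pair_apply_eq hpq.ne ht (by omega) (by simpa only [one_smul] using hz q (by omega) h)
  have e2 : 1 < p → (q + p = ℓ + 1 ∧ t = 1) ∨ 2 * p = ℓ + 1 := fun h =>
    eq_of_pair_apply_eq hpq.ne' (.inl rfl) (by omega)
      (by simpa only [one_smul, add_comm] using hz p h (by omega))
  rcases hp.eq_or_lt with rfl | hlt
  · right
    refine ⟨.inl rfl, ?_⟩
    by_contra! hcon
    have := e1 (by omega)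
    omega
  · rcases e2 hlt with ⟨h1, h2⟩ | h1
    · exact .inl ⟨hlt, by omega, h2⟩
    · refine .inr ⟨.inr h1, ?_⟩
      by_contra! hcon
      have := e1 (by omega)
      omega

variable [P.IsRootSystem] [P.IsCrystallographic] [Finite ι] [P.IsReduced]
variable (h : IsLabelling b (CartanMatrix.D ℓ) α) (hℓ : 4 ≤ ℓ)

section Even

variable (hev : Even ℓ) {t : ℝ} {j : ℕ} (hj : j = ℓ - 1 ∧ t = 1 ∨ j = ℓ ∧ t = -1)
include hev hj

theorem f_omegaD_of_even (x : M) :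
    (h.realizationD hℓ).f (omega b (α j) x) = turn ℓ t t ((h.realizationD hℓ).f x) := by
  have ht : t = 1 ∨ t = -1 := hj.imp And.right And.right
  exact (h.realizationD hℓ).f_omega (actsD_turn_of_even h hℓ hev ht) ⟨by omega, by omega⟩
    (fun i hi => turn_a h hℓ ht ht hj hi) x

omit [P.IsRootSystem] [P.IsCrystallographic] [Finite ι] [P.IsReduced] hev in
theorem turn_involutive (hℓ : 4 ≤ ℓ) : Function.Involutive (turn ℓ t t) := by
  intro v
  funext r
  rw [turn_turn (by omega)]
  rcases hj with ⟨-, rfl⟩ | ⟨-, rfl⟩ <;> norm_num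

/-- Zero average means symmetric inner coordinates together with `x_1 + t x_ℓ = 0`. For even `ℓ`
there is no midpoint, so a root is either an inner mirrored pair or supported on the two ends. -/
theorem mem_disappearing_D_of_even {x : M} :
    x ∈ disappearing b (omega b (α j)) ↔ (h.realizationD hℓ).f x = ε 1 - t • ε ℓ ∨
      ∃ i ∈ Icc 2 (ℓ / 2), (h.realizationD hℓ).f x = ε i + ε (ℓ - i + 1) := by
  rw [(h.realizationD hℓ).mem_disappearing_iff (m := 2) (f_omegaD_of_even h hℓ hev hj) two_pos
    (fun x => turn_involutive hj hℓ _), ← and_assoc, realizationD_pos_iff]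
  have ht : t = 1 ∨ t = -1 := hj.imp And.right And.right
  obtain ⟨n, rfl⟩ := hev
  simp only [Finset.sum_range_succ, Finset.sum_range_zero, zero_add, Function.iterate_zero, id,
    Function.iterate_one]
  generalize (h.realizationD hℓ).f x = v
  constructor
  · rintro ⟨⟨p, hp, q, hq, hpq, s, hs, rfl⟩, hz⟩
    have hz' : ∀ r, 1 < r → r < n + n →
        (ε p + s • ε q) r = (ε p + s • ε q) (n + n + 1 - r) := by
      intro r h1 h2
      have := congrFun hz r
      rw [Pi.add_apply, turn, if_neg (by omega), if_neg (by omega), if_pos ⟨h1, h2⟩,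
        Pi.zero_apply] at this
      linarith
    rcases eq_of_pair_symmetric hp hq hpq hs hz' with ⟨h1, h2, rfl⟩ | ⟨h1, h2⟩
    · right
      exact ⟨p, ⟨h1, by omega⟩, by rw [one_smul, (by omega : n + n - p + 1 = q)]⟩
    · left
      obtain rfl : p = 1 := by omega
      obtain rfl : q = n + n := by omega
      have := congrFun hz 1
      simp only [turn, Pi.add_apply, Pi.smul_apply, ε_apply, if_true, smul_eq_mul, Pi.zero_apply,
        if_neg hpq.ne, if_neg hpq.ne'] at this
      -- The first coordinate of the sum is `1 + t * s`.
      have hst : s = -t := by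
        rcases hs with rfl | rfl <;> rcases ht with rfl | rfl <;> 
          first | (norm_num; done) | (norm_num at this; done)
      rw [hst]
      module
  · rintro (rfl | ⟨i, ⟨hi, hi'⟩, rfl⟩)
    · refine ⟨⟨1, ⟨le_rfl, by omega⟩, n + n, ⟨by omega, le_rfl⟩, by omega, -t, ?_, by module⟩, ?_⟩
      · rcases ht with rfl | rfl <;> simp
      funext r
      simp only [turn, Pi.sub_apply, Pi.smul_apply, Pi.add_apply, ε_apply, Pi.zero_apply,
        smul_eq_mul]
      rcases ht with rfl | rfl <;> split_ifs <;> first | omega | norm_num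
    · refine ⟨⟨i, ⟨by omega, by omega⟩, n + n - i + 1, ⟨by omega, by omega⟩, by omega, 1,
        .inl rfl, by module⟩, ?_⟩
      funext r
      simp only [turn, Pi.add_apply, ε_apply, Pi.zero_apply]
      split_ifs <;> first | omega | norm_num

end Even

section Odd

variable (hodd : Odd ℓ) {t : ℝ} {j : ℕ} (hj : j = ℓ - 1 ∧ t = 1 ∨ j = ℓ ∧ t = -1)
include hodd hj

theorem f_omegaD_of_odd (x : M) :
    (h.realizationD hℓ).f (omega b (α j) x) = turn ℓ (-t) t ((h.realizationD hℓ).f x) := by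
  have ht : t = 1 ∨ t = -1 := hj.imp And.right And.right
  have ht' : -t = 1 ∨ -t = -1 := by rcases ht with rfl | rfl <;> simp
  exact (h.realizationD hℓ).f_omega (actsD_turn_of_odd h hℓ hodd ht) ⟨by omega, by omega⟩
    (fun i hi => turn_a h hℓ ht' ht hj hi) x

omit [P.IsRootSystem] [P.IsCrystallographic] [Finite ι] [P.IsReduced] hodd in
theorem turn_neg_turn (hℓ : 4 ≤ ℓ) (v : ℕ → ℝ) :
    turn ℓ (-t) t (turn ℓ (-t) t v) = negPair 1 ℓ v := by
  funext r
  rw [turn_turn (by omega), negPair]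
  rcases hj with ⟨-, rfl⟩ | ⟨-, rfl⟩ <;> norm_num

omit [P.IsRootSystem] [P.IsCrystallographic] [Finite ι] [P.IsReduced] hodd in
theorem turn_iterate_four (hℓ : 4 ≤ ℓ) (v : ℕ → ℝ) : (turn ℓ (-t) t)^[4] v = v := by
  change turn ℓ (-t) t (turn ℓ (-t) t (turn ℓ (-t) t (turn ℓ (-t) t v))) = v
  rw [turn_neg_turn hj hℓ, turn_neg_turn hj hℓ, negPair_involutive]

-- On the end coordinates the square is `-1`, so the four terms cancel; the inner coordinates see
-- each value of an involution twice.
omit [P.IsRootSystem] [P.IsCrystallographic] [Finite ι] [P.IsReduced] hodd in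
theorem sum_turn (hℓ : 4 ≤ ℓ) (v : ℕ → ℝ) (r : ℕ) :
    (∑ k ∈ Finset.range 4, (turn ℓ (-t) t)^[k] v) r =
      if r = 1 ∨ r = ℓ then 0 else if 1 < r ∧ r < ℓ then 2 * (v r - v (ℓ + 1 - r)) else 4 * v r := by
  have : ∑ k ∈ Finset.range 4, (turn ℓ (-t) t)^[k] v =
      v + turn ℓ (-t) t v + negPair 1 ℓ v + turn ℓ (-t) t (negPair 1 ℓ v) := by
    rw [← turn_neg_turn hj hℓ]
    simp only [Finset.sum_range_succ, Finset.sum_range_zero, zero_add]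
    rfl
  rw [this]
  simp only [Pi.add_apply, turn, negPair]
  split_ifs <;> first | omega | (simp_all; done) | ring

/-- Neither the ends nor the midpoint, which is its own mirror image, satisfy any condition. So all
roots supported on `{1, (ℓ + 1) / 2, ℓ}` disappear, a subsystem of type `D₃ = A₃`, along with the
inner mirrored pairs. -/
theorem mem_disappearing_D_of_odd {x : M} :
    x ∈ disappearing b (omega b (α j)) ↔
      (∃ s : ℝ, (s = 1 ∨ s = -1) ∧ ((h.realizationD hℓ).f x = ε 1 + s • ε ((ℓ + 1) / 2) ∨
        (h.realizationD hℓ).f x = ε ((ℓ + 1) / 2) + s • ε ℓ ∨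
        (h.realizationD hℓ).f x = ε 1 + s • ε ℓ)) ∨
      ∃ i ∈ Icc 2 ((ℓ - 1) / 2), (h.realizationD hℓ).f x = ε i + ε (ℓ - i + 1) := by
  rw [(h.realizationD hℓ).mem_disappearing_iff (m := 4) (f_omegaD_of_odd h hℓ hodd hj) four_pos
    (fun x => turn_iterate_four hj hℓ _), ← and_assoc, realizationD_pos_iff]
  generalize (h.realizationD hℓ).f x = v
  obtain ⟨n, hn⟩ := hodd
  have hz0 : ∑ k ∈ Finset.range 4, (turn ℓ (-t) t)^[k] v = 0 ↔
      ∀ r, (if r = 1 ∨ r = ℓ then 0 else if 1 < r ∧ r < ℓ then 2 * (v r - v (ℓ + 1 - r))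
        else 4 * v r) = 0 := by
    rw [funext_iff]
    exact forall_congr' fun r => by rw [sum_turn hj hℓ]; rfl
  rw [hz0]
  constructor
  · rintro ⟨⟨p, hp, q, hq, hpq, s, hs, rfl⟩, hz⟩
    have hz' : ∀ r, 1 < r → r < ℓ → (ε p + s • ε q) r = (ε p + s • ε q) (ℓ + 1 - r) := by
      intro r h1 h2
      have := hz r
      rw [if_neg (by omega), if_pos ⟨h1, h2⟩] at this
      linarith
    rcases eq_of_pair_symmetric hp hq hpq hs hz' with ⟨h1, h2, rfl⟩ | ⟨h1, h2⟩
    · right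
      exact ⟨p, ⟨h1, by omega⟩, by rw [one_smul, (by omega : ℓ - p + 1 = q)]⟩
    · left
      refine ⟨s, hs, ?_⟩
      rcases h1 with rfl | h1 <;> rcases h2 with rfl | h2
      · exact .inr (.inr rfl)
      · rw [(by omega : (ℓ + 1) / 2 = q)]
        exact .inl rfl
      · rw [(by omega : (q + 1) / 2 = p)]
        exact .inr (.inl rfl)
      · omega
  · have h1ℓ : 1 ∈ Icc 1 ℓ := ⟨le_rfl, by omega⟩
    have hℓ' : ℓ ∈ Icc 1 ℓ := ⟨by omega, le_rfl⟩
    have hmid : (ℓ + 1) / 2 ∈ Icc 1 ℓ := ⟨by omega, by omega⟩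
    rintro (⟨s, hs, rfl | rfl | rfl⟩ | ⟨i, ⟨hi, hi'⟩, rfl⟩)
    · refine ⟨⟨1, h1ℓ, _, hmid, by omega, s, hs, rfl⟩, fun r => ?_⟩
      simp only [Pi.add_apply, Pi.smul_apply, ε_apply, smul_eq_mul]
      split_ifs <;> first | omega | (norm_num; done)
    · refine ⟨⟨_, hmid, ℓ, hℓ', by omega, s, hs, rfl⟩, fun r => ?_⟩
      simp only [Pi.add_apply, Pi.smul_apply, ε_apply, smul_eq_mul]
      split_ifs <;> first | omega | (norm_num; done)
    · refine ⟨⟨1, h1ℓ, ℓ, hℓ', by omega, s, hs, rfl⟩, fun r => ?_⟩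
      simp only [Pi.add_apply, Pi.smul_apply, ε_apply, smul_eq_mul]
      split_ifs <;> first | omega | (norm_num; done)
    · refine ⟨⟨i, ⟨by omega, by omega⟩, ℓ - i + 1, ⟨by omega, by omega⟩, by omega, 1,
        .inl rfl, by module⟩, fun r => ?_⟩
      simp only [Pi.add_apply, ε_apply]
      split_ifs <;> first | omega | (norm_num; done)

end Odd

end TypeD

end Folding

namespace Folding

open Set

/-! ### Type D: disappearing roots in terms of simple roots, and `P(0)` -/

section TypeD

variable {ι M N : Type*} [AddCommGroup M] [Module ℝ M] [AddCommGroup N] [Module ℝ N]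
variable {P : RootPairing ι ℝ M N} {b : P.Base} {α : ℕ → ι} {ℓ : ℕ}
variable [P.IsRootSystem] [P.IsCrystallographic] [Finite ι] [P.IsReduced]

section Even

theorem disappearing_D_of_even (h : IsLabelling b (CartanMatrix.D ℓ) α) (hℓ : 4 ≤ ℓ) (hev : Even ℓ)
    {j : ℕ} (hj : j = ℓ - 1 ∨ j = ℓ) :
    disappearing b (omega b (α j)) = {str P α 1 (ℓ - 2) + P.root (α j)} ∪
      {x | ∃ i ∈ Icc 2 (ℓ / 2), x = str P α i (ℓ - i) + (2 : ℝ) • str P α (ℓ - i + 1) (ℓ - 2)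
        + P.root (α (ℓ - 1)) + P.root (α ℓ)} := by
  obtain ⟨t, hj⟩ : ∃ t : ℝ, j = ℓ - 1 ∧ t = 1 ∨ j = ℓ ∧ t = -1 := by
    rcases hj with rfl | rfl
    exacts [⟨1, .inl ⟨rfl, rfl⟩⟩, ⟨-1, .inr ⟨rfl, rfl⟩⟩]
  ext x
  rw [mem_disappearing_D_of_even h hℓ hev hj]
  refine or_congr ?_ (exists_congr fun i => and_congr_right fun hi => ?_)
  · rw [mem_singleton_iff, ← (h.realizationD hℓ).f_injective.eq_iff]
    rcases hj with ⟨rfl, rfl⟩ | ⟨rfl, rfl⟩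
    · rw [map_strD_pred (u := ε) hℓ (fun i => realizationD_f_root h hℓ) ⟨le_rfl, by omega⟩, one_smul]
    · rw [map_strD_last (u := ε) hℓ (fun i => realizationD_f_root h hℓ)
        (realizationD_f_root_last h hℓ) ⟨le_rfl, by omega⟩, neg_smul, one_smul, sub_neg_eq_add]
  · have h1 := hi.1
    have h2 := hi.2
    rw [← (h.realizationD hℓ).f_injective.eq_iff, map_strD (u := ε) hℓ
      (fun i => realizationD_f_root h hℓ) (realizationD_f_root_last h hℓ) (by omega) (by omega)
      (by omega)]

variable {W : Type*} [AddCommGroup W] [Module ℝ W] {g : M →ₗ[ℝ] W} {u : ℕ → W}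

theorem image_disappearing_D_of_even (h : IsLabelling b (CartanMatrix.D ℓ) α) (hℓ : 4 ≤ ℓ)
    (hev : Even ℓ) {j : ℕ} (hj : j = ℓ - 1 ∨ j = ℓ)
    (h1 : ∀ i ∈ Icc 1 (ℓ - 1), g (P.root (α i)) = u i - u (i + 1))
    (h2 : g (P.root (α ℓ)) = u (ℓ - 1) + u ℓ) :
    g '' disappearing b (omega b (α j)) = {g (str P α 1 (ℓ - 2) + P.root (α j))} ∪
      {x | ∃ i ∈ Icc 2 (ℓ / 2), x = u i + u (ℓ - i + 1)} := by
  rw [disappearing_D_of_even h hℓ hev hj, image_union, image_singleton]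
  congr 1
  have key : ∀ i ∈ Icc 2 (ℓ / 2), g (str P α i (ℓ - i) + (2 : ℝ) • str P α (ℓ - i + 1) (ℓ - 2)
      + P.root (α (ℓ - 1)) + P.root (α ℓ)) = u i + u (ℓ - i + 1) := by
    rintro i ⟨hi, hi'⟩
    exact map_strD hℓ h1 h2 (by omega) (by omega) (by omega)
  ext x
  constructor
  · rintro ⟨-, ⟨i, hi, rfl⟩, rfl⟩
    exact ⟨i, hi, key i hi⟩
  · rintro ⟨i, hi, rfl⟩
    exact ⟨_, ⟨i, hi, rfl⟩, key i hi⟩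

theorem isDisjointUnion_D_of_even (h : IsLabelling b (CartanMatrix.D ℓ) α) (hℓ : 4 ≤ ℓ)
    (hev : Even ℓ) {j : ℕ} (hj : j = ℓ - 1 ∨ j = ℓ) :
    IsDisjointUnion (disappearing b (omega b (α j)))
      [{str P α 1 (ℓ - 2) + P.root (α j)},
        {x | ∃ i ∈ Icc 2 (ℓ / 2), x = str P α i (ℓ - i) + (2 : ℝ) • str P α (ℓ - i + 1) (ℓ - 2)
          + P.root (α (ℓ - 1)) + P.root (α ℓ)}] := by
  have h1 : ∀ i ∈ Icc 1 (ℓ - 1), (coordAt 1 ∘ₗ (h.realizationD hℓ).f) (P.root (α i)) =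
      ε i 1 - ε (i + 1) 1 := fun i hi => by
    rw [LinearMap.comp_apply, realizationD_f_root h hℓ hi]
    rfl
  have h2 : (coordAt 1 ∘ₗ (h.realizationD hℓ).f) (P.root (α ℓ)) = ε (ℓ - 1) 1 + ε ℓ 1 := by
    rw [LinearMap.comp_apply, realizationD_f_root_last h hℓ]
    rfl
  -- The first coordinate is 1 on the root supported at the ends and 0 on the inner pairs.
  refine isDisjointUnion_of_forall (φ := coordAt 1 ∘ₗ (h.realizationD hℓ).f) (c := [1, 0])
    (by simp) (.cons ?_ (.cons ?_ .nil)) ?_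
  · rintro - rfl
    rcases hj with rfl | rfl
    · rw [map_strD_pred (u := fun p => ε p 1) hℓ h1 ⟨le_rfl, by omega⟩, ε_apply, ε_apply, if_pos rfl,
        if_neg (by omega), sub_zero]
    · rw [map_strD_last (u := fun p => ε p 1) hℓ h1 h2 ⟨le_rfl, by omega⟩, ε_apply, ε_apply,
        if_pos rfl, if_neg (by omega), add_zero]
  · rintro - ⟨i, ⟨hi, hi'⟩, rfl⟩
    rw [map_strD (u := fun p => ε p 1) hℓ h1 h2 (by omega) (by omega) (by omega), ε_apply, ε_apply,
      if_neg (by omega), if_neg (by omega), add_zero]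
  · rw [disappearing_D_of_even h hℓ hev hj]
    ext x
    simp

theorem extraSet_D_of_even [Nonempty ι] (h : IsLabelling b (CartanMatrix.D ℓ) α) (hℓ : 4 ≤ ℓ)
    (hev : Even ℓ) {j : ℕ} (hj : j = ℓ - 1 ∨ j = ℓ) :
    extraSet b (omega b (α j)) 0 = {1, -1} := by
  apply extraSet_zero_eq_of_forall
  · rw [disappearing_D_of_even h hℓ hev hj]
    exact ⟨_, .inl rfl⟩
  obtain ⟨t, hj⟩ : ∃ t : ℝ, j = ℓ - 1 ∧ t = 1 ∨ j = ℓ ∧ t = -1 := by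
    rcases hj with rfl | rfl
    exacts [⟨1, .inl ⟨rfl, rfl⟩⟩, ⟨-1, .inr ⟨rfl, rfl⟩⟩]
  intro x hx
  rw [(h.realizationD hℓ).pairingPiZero_of_involutive (f_omegaD_of_even h hℓ hev hj)
    (turn_involutive hj hℓ) (f_highestRootD h hℓ) ⟨by omega, by omega⟩ (turn_neg_highest h hℓ hj)]
  have hx := (mem_disappearing_D_of_even h hℓ hev hj).mp hx
  generalize (h.realizationD hℓ).f x = v at hx
  rcases hj with ⟨rfl, rfl⟩ | ⟨rfl, rfl⟩
  · rw [realizationD_k_pred]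
    rcases hx with rfl | ⟨i, ⟨hi, hi'⟩, rfl⟩
    · simp only [map_sub, map_smul, coordSum_ε, Pi.sub_apply, Pi.smul_apply, ε_apply, smul_eq_mul]
      split_ifs <;> first | omega | norm_num
    · simp only [map_add, coordSum_ε, Pi.add_apply, ε_apply]
      split_ifs <;> first | omega | norm_num
  · rw [realizationD_k_last]
    rcases hx with rfl | ⟨i, ⟨hi, hi'⟩, rfl⟩
    · simp only [map_sub, map_smul, coordSum_ε, smul_eq_mul]
      split_ifs <;> first | omega | norm_num
    · simp only [map_add, coordSum_ε]
      split_ifs <;> first | omega | norm_num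

end Even

theorem image_setOf_exists_mem {X Y : Type*} {g : X → Y} {L : List (Set X)} {L' : List (Set Y)}
    (h : List.Forall₂ (fun T T' => g '' T = T') L L') :
    g '' {x | ∃ T ∈ L, x ∈ T} = {y | ∃ T ∈ L', y ∈ T} := by
  obtain rfl : L' = L.map (g '' ·) := by
    induction h with
    | nil => rfl
    | cons h _ ih => rw [List.map_cons, h, ih]
  ext y
  constructor
  · rintro ⟨x, ⟨T, hT, hx⟩, rfl⟩
    exact ⟨_, List.mem_map_of_mem hT, x, hx, rfl⟩
  · rintro ⟨T', hT', hy⟩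
    obtain ⟨T, hT, rfl⟩ := List.mem_map.mp hT'
    obtain ⟨x, hx, rfl⟩ := hy
    exact ⟨x, ⟨T, hT, hx⟩, rfl⟩

section Odd

variable {W : Type*} [AddCommGroup W] [Module ℝ W] {g : M →ₗ[ℝ] W} {u : ℕ → W}

-- The families are matched one by one, so that membership, disjointness and images can all be read
-- off from the same list.
omit [P.IsRootSystem] [P.IsCrystallographic] [Finite ι] [P.IsReduced] in
theorem map_setsD_of_odd (hℓ : 4 ≤ ℓ) (hodd : Odd ℓ)
    (h1 : ∀ i ∈ Icc 1 (ℓ - 1), g (P.root (α i)) = u i - u (i + 1))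
    (h2 : g (P.root (α ℓ)) = u (ℓ - 1) + u ℓ) :
    List.Forall₂ (fun T T' => g '' T = T')
      [{str P α 1 ((ℓ - 1) / 2)},
        {x | ∃ p ∈ ({ℓ - 1, ℓ} : Set ℕ), x = str P α ((ℓ + 1) / 2) (ℓ - 2) + P.root (α p)},
        {x | ∃ p ∈ ({ℓ - 1, ℓ} : Set ℕ), x = str P α 1 (ℓ - 2) + P.root (α p)},
        {x | ∃ i ∈ Icc 2 ((ℓ - 1) / 2),
          x = str P α i (ℓ - i) + (2 : ℝ) • str P α (ℓ - i + 1) (ℓ - 2)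
            + P.root (α (ℓ - 1)) + P.root (α ℓ)},
        {str P α 1 ((ℓ - 1) / 2) + (2 : ℝ) • str P α ((ℓ + 1) / 2) (ℓ - 2)
            + P.root (α (ℓ - 1)) + P.root (α ℓ)}]
      [{u 1 - u ((ℓ + 1) / 2)}, {u ((ℓ + 1) / 2) - u ℓ, u ((ℓ + 1) / 2) + u ℓ},
        {u 1 - u ℓ, u 1 + u ℓ}, {x | ∃ i ∈ Icc 2 ((ℓ - 1) / 2), x = u i + u (ℓ - i + 1)},
        {u 1 + u ((ℓ + 1) / 2)}] := by
  obtain ⟨n, hn⟩ := hodd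
  have hmid : (ℓ + 1) / 2 = (ℓ - 1) / 2 + 1 := by omega
  have key : ∀ i, {x | ∃ p ∈ ({ℓ - 1, ℓ} : Set ℕ), x = str P α i (ℓ - 2) + P.root (α p)} =
      {str P α i (ℓ - 2) + P.root (α (ℓ - 1)), str P α i (ℓ - 2) + P.root (α ℓ)} := by
    intro i
    ext x
    simp
  refine .cons ?_ (.cons ?_ (.cons ?_ (.cons ?_ (.cons ?_ .nil))))
  · rw [image_singleton, map_str g u (by omega) fun j hj hj' => h1 j ⟨by omega, by omega⟩, hmid]
  · rw [key, image_insert_eq, image_singleton, map_strD_pred hℓ h1 ⟨by omega, by omega⟩,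
      map_strD_last hℓ h1 h2 ⟨by omega, by omega⟩]
  · rw [key, image_insert_eq, image_singleton, map_strD_pred hℓ h1 ⟨by omega, by omega⟩,
      map_strD_last hℓ h1 h2 ⟨by omega, by omega⟩]
  · have key : ∀ i ∈ Icc 2 ((ℓ - 1) / 2), g (str P α i (ℓ - i)
        + (2 : ℝ) • str P α (ℓ - i + 1) (ℓ - 2) + P.root (α (ℓ - 1)) + P.root (α ℓ))
          = u i + u (ℓ - i + 1) := by
      rintro i ⟨hi, hi'⟩
      exact map_strD hℓ h1 h2 (by omega) (by omega) (by omega)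
    ext x
    constructor
    · rintro ⟨-, ⟨i, hi, rfl⟩, rfl⟩
      exact ⟨i, hi, key i hi⟩
    · rintro ⟨i, hi, rfl⟩
      exact ⟨_, ⟨i, hi, rfl⟩, key i hi⟩
  · rw [image_singleton, hmid, map_strD hℓ h1 h2 le_rfl (by omega) (by omega)]

theorem isDisjointUnion_D_of_odd (h : IsLabelling b (CartanMatrix.D ℓ) α) (hℓ : 4 ≤ ℓ)
    (hodd : Odd ℓ) {j : ℕ} (hj : j = ℓ - 1 ∨ j = ℓ) :
    IsDisjointUnion (disappearing b (omega b (α j)))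
      [{str P α 1 ((ℓ - 1) / 2)},
        {x | ∃ p ∈ ({ℓ - 1, ℓ} : Set ℕ), x = str P α ((ℓ + 1) / 2) (ℓ - 2) + P.root (α p)},
        {x | ∃ p ∈ ({ℓ - 1, ℓ} : Set ℕ), x = str P α 1 (ℓ - 2) + P.root (α p)},
        {x | ∃ i ∈ Icc 2 ((ℓ - 1) / 2),
          x = str P α i (ℓ - i) + (2 : ℝ) • str P α (ℓ - i + 1) (ℓ - 2)
            + P.root (α (ℓ - 1)) + P.root (α ℓ)},
        {str P α 1 ((ℓ - 1) / 2) + (2 : ℝ) • str P α ((ℓ + 1) / 2) (ℓ - 2)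
            + P.root (α (ℓ - 1)) + P.root (α ℓ)}] := by
  obtain ⟨t, hj⟩ : ∃ t : ℝ, j = ℓ - 1 ∧ t = 1 ∨ j = ℓ ∧ t = -1 := by
    rcases hj with rfl | rfl
    exacts [⟨1, .inl ⟨rfl, rfl⟩⟩, ⟨-1, .inr ⟨rfl, rfl⟩⟩]
  have hF := map_setsD_of_odd (g := (h.realizationD hℓ).f) (u := ε) hℓ hodd
    (fun i => realizationD_f_root h hℓ) (realizationD_f_root_last h hℓ)
  have hF' := hF
  have hinj := (h.realizationD hℓ).f_injective
  have hmem := fun x => mem_disappearing_D_of_odd h hℓ hodd hj (x := x)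
  obtain ⟨n, hn⟩ := hodd
  simp only [List.forall₂_cons, List.forall₂_nil_left_iff, and_true] at hF'
  obtain ⟨h1, h2, h3, h4, h5⟩ := hF'
  -- The functional `x_1 + 3 x_{(ℓ+1)/2}` takes the distinct values `1 - 3`, `3`, `1`, `0`, `1 + 3`
  -- on the five families.
  refine isDisjointUnion_of_forall
    (φ := fun x => (coordAt 1 + (3 : ℝ) • coordAt ((ℓ + 1) / 2)) ((h.realizationD hℓ).f x))
    (c := [-2, 3, 1, 0, 4]) (by norm_num)
    (.cons ?_ (.cons ?_ (.cons ?_ (.cons ?_ (.cons ?_ .nil))))) ?_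
  · intro x hx
    have := h1 ▸ mem_image_of_mem _ hx
    rw [mem_singleton_iff.mp this]
    simp only [LinearMap.add_apply, LinearMap.smul_apply, coordAt_apply, Pi.sub_apply, ε_apply,
      smul_eq_mul]
    split_ifs <;> first | omega | norm_num
  · intro x hx
    have := h2 ▸ mem_image_of_mem _ hx
    rcases this with e | e <;> rw [e] <;>
      simp only [LinearMap.add_apply, LinearMap.smul_apply, coordAt_apply, Pi.sub_apply,
        Pi.add_apply, ε_apply, smul_eq_mul] <;>
      split_ifs <;> first | omega | norm_num
  · intro x hx
    have := h3 ▸ mem_image_of_mem _ hx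
    rcases this with e | e <;> rw [e] <;>
      simp only [LinearMap.add_apply, LinearMap.smul_apply, coordAt_apply, Pi.sub_apply,
        Pi.add_apply, ε_apply, smul_eq_mul] <;>
      split_ifs <;> first | omega | norm_num
  · intro x hx
    obtain ⟨i, ⟨hi, hi'⟩, e⟩ := h4 ▸ mem_image_of_mem _ hx
    rw [e]
    simp only [LinearMap.add_apply, LinearMap.smul_apply, coordAt_apply, Pi.add_apply, ε_apply,
      smul_eq_mul]
    split_ifs <;> first | omega | norm_num
  · intro x hx
    have := h5 ▸ mem_image_of_mem _ hx
    rw [mem_singleton_iff.mp this]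
    simp only [LinearMap.add_apply, LinearMap.smul_apply, coordAt_apply, Pi.add_apply, ε_apply,
      smul_eq_mul]
    split_ifs <;> first | omega | norm_num
  · ext x
    rw [hmem, ← hinj.mem_set_image, image_setOf_exists_mem hF]
    generalize (h.realizationD hℓ).f x = v
    simp only [List.mem_cons, List.not_mem_nil, or_false, exists_eq_or_imp, exists_eq_left,
      mem_insert_iff, mem_singleton_iff, mem_ofPred_eq, one_smul, neg_one_smul, ← sub_eq_add_neg]
    simp only [or_assoc, or_comm, or_left_comm]

theorem image_disappearing_D_of_odd (h : IsLabelling b (CartanMatrix.D ℓ) α) (hℓ : 4 ≤ ℓ)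
    (hodd : Odd ℓ) {j : ℕ} (hj : j = ℓ - 1 ∨ j = ℓ)
    (h1 : ∀ i ∈ Icc 1 (ℓ - 1), g (P.root (α i)) = u i - u (i + 1))
    (h2 : g (P.root (α ℓ)) = u (ℓ - 1) + u ℓ) :
    g '' disappearing b (omega b (α j)) =
      {u 1 + u ((ℓ + 1) / 2), u 1 - u ((ℓ + 1) / 2), u ((ℓ + 1) / 2) + u ℓ,
        u ((ℓ + 1) / 2) - u ℓ, u 1 + u ℓ, u 1 - u ℓ} ∪
      {x | ∃ i ∈ Icc 2 ((ℓ - 1) / 2), x = u i + u (ℓ - i + 1)} := by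
  rw [(isDisjointUnion_D_of_odd h hℓ hodd hj).2,
    image_setOf_exists_mem (map_setsD_of_odd hℓ hodd h1 h2)]
  ext x
  simp only [List.mem_cons, List.not_mem_nil, or_false, exists_eq_or_imp, exists_eq_left,
    mem_union, mem_insert_iff, mem_singleton_iff, mem_ofPred_eq]
  simp only [or_assoc, or_comm, or_left_comm]

/-- The same functional separates here: it is nonzero on the six vectors and zero on the mirrored
pairs. Only its values on the `u p` matter. -/
theorem isDisjointUnion_image_D_of_odd (h : IsLabelling b (CartanMatrix.D ℓ) α) (hℓ : 4 ≤ ℓ)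
    (hodd : Odd ℓ) {j : ℕ} (hj : j = ℓ - 1 ∨ j = ℓ)
    (h1 : ∀ i ∈ Icc 1 (ℓ - 1), g (P.root (α i)) = u i - u (i + 1))
    (h2 : g (P.root (α ℓ)) = u (ℓ - 1) + u ℓ)
    {φ : W →ₗ[ℝ] ℝ} (hφ : ∀ p ∈ Icc 1 ℓ, φ (u p) = ε p 1 + 3 * ε p ((ℓ + 1) / 2)) :
    IsDisjointUnion (g '' disappearing b (omega b (α j)))
      [{u 1 + u ((ℓ + 1) / 2), u 1 - u ((ℓ + 1) / 2), u ((ℓ + 1) / 2) + u ℓ,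
        u ((ℓ + 1) / 2) - u ℓ, u 1 + u ℓ, u 1 - u ℓ},
        {x | ∃ i ∈ Icc 2 ((ℓ - 1) / 2), x = u i + u (ℓ - i + 1)}] := by
  rw [image_disappearing_D_of_odd h hℓ hodd hj h1 h2]
  obtain ⟨n, hn⟩ := hodd
  have e1 : φ (u 1) = 1 := by
    rw [hφ _ ⟨le_rfl, by omega⟩, ε_apply, ε_apply, if_pos rfl, if_neg (by omega)]
    norm_num
  have e2 : φ (u ((ℓ + 1) / 2)) = 3 := by
    rw [hφ _ ⟨by omega, by omega⟩, ε_apply, ε_apply, if_neg (by omega), if_pos rfl]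
    norm_num
  have e3 : φ (u ℓ) = 0 := by
    rw [hφ _ ⟨by omega, le_rfl⟩, ε_apply, ε_apply, if_neg (by omega), if_neg (by omega)]
    norm_num
  refine ⟨?_, ?_⟩
  · rw [List.pairwise_pair, disjoint_left]
    rintro x hx ⟨i, ⟨hi, hi'⟩, rfl⟩
    have hz : φ (u i + u (ℓ - i + 1)) = 0 := by
      rw [map_add, hφ i ⟨by omega, by omega⟩, hφ (ℓ - i + 1) ⟨by omega, by omega⟩]
      simp only [ε_apply]
      split_ifs <;> first | omega | norm_num
    rcases hx with hx | hx | hx | hx | hx | hx <;> rw [hx] at hz <;>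
      simp only [map_add, map_sub, e1, e2, e3] at hz <;> norm_num at hz
  · ext x
    simp

/-- The orbit is `α_0 ↦ α_j ↦ α_1 ↦ α_{j'} ↦ α_0` with `{j, j'} = {ℓ - 1, ℓ}`. In the sum of the
last two coefficients `x_ℓ` cancels, which leaves `x_1 + (x_1 + ⋯ + x_{ℓ-1})`. -/
theorem pairingPiZero_D_of_odd [Nonempty ι] (h : IsLabelling b (CartanMatrix.D ℓ) α) (hℓ : 4 ≤ ℓ)
    (hodd : Odd ℓ) {t : ℝ} {j : ℕ} (hj : j = ℓ - 1 ∧ t = 1 ∨ j = ℓ ∧ t = -1) (x : M) :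
    pairingPiZero b (omega b (α j)) x = (coordAt 1 + coordSum (ℓ - 1)) ((h.realizationD hℓ).f x) := by
  have hr := realizationD_isClassical h hℓ
  have hv1 : turn ℓ (-t) t (-(ε 1 + ε 2)) = (h.realizationD hℓ).a j := turn_neg_highest h hℓ hj
  have hv2 : (turn ℓ (-t) t)^[2] (-(ε 1 + ε 2)) = (h.realizationD hℓ).a 1 := by
    change turn ℓ (-t) t (turn ℓ (-t) t (-(ε 1 + ε 2))) = _
    rw [turn_neg_turn hj hℓ, hr.a_eq 1 le_rfl (by omega)]
    funext r
    simp only [negPair, Pi.sub_apply, Pi.add_apply, Pi.neg_apply, ε_apply]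
    split_ifs <;> first | omega | norm_num
  have hv3 : (turn ℓ (-t) t)^[3] (-(ε 1 + ε 2)) =
      (h.realizationD hℓ).a (if j = ℓ then ℓ - 1 else ℓ) := by
    rw [Function.iterate_succ_apply', hv2, hr.a_eq 1 le_rfl (by omega)]
    rcases hj with ⟨rfl, rfl⟩ | ⟨rfl, rfl⟩
    · rw [if_neg (by omega), realizationD_a_last]
      funext r
      simp only [turn, Pi.sub_apply, Pi.add_apply, ε_apply]
      split_ifs <;> first | omega | norm_num
    · rw [if_pos rfl, hr.a_eq (j - 1) (by omega) (by omega)]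
      funext r
      simp only [turn, Pi.sub_apply, ε_apply]
      split_ifs <;> first | omega | norm_num
  have hinj := (h.realizationD hℓ).a_injOn
  rw [(h.realizationD hℓ).pairingPiZero_apply (m := 4) (f_omegaD_of_odd h hℓ hodd hj) four_pos
    (fun x => turn_iterate_four hj hℓ _) (f_highestRootD h hℓ) (S := {1, ℓ - 1, ℓ})]
  · rw [Finset.sum_insert (by simp; omega), Finset.sum_insert (by simp; omega),
      Finset.sum_singleton, realizationD_k_pred, realizationD_k_last, realizationD_k h hℓ (by omega)]
    have e1 : coordSum ℓ = coordSum (ℓ - 1) + coordAt ℓ := by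
      obtain ⟨n, rfl⟩ : ∃ n, ℓ = n + 1 := ⟨ℓ - 1, by omega⟩
      exact Finset.sum_Icc_succ_top (by omega) _
    have e2 : coordSum 1 = coordAt 1 := by simp [coordSum]
    rw [e1, e2, LinearMap.add_apply, LinearMap.add_apply, coordAt_apply, coordAt_apply]
    ring
  · intro s
    simp only [Finset.mem_insert, Finset.mem_singleton]
    constructor
    · intro hs
      refine ⟨⟨by omega, by omega⟩, ?_⟩
      by_cases h1 : s = 1
      · exact ⟨2, by norm_num, by rw [hv2, h1]⟩
      by_cases h2 : s = j
      · exact ⟨1, by norm_num, by rw [Function.iterate_one, hv1, h2]⟩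
      · refine ⟨3, by norm_num, ?_⟩
        rw [hv3]
        congr 1
        split_ifs <;> omega
    · rintro ⟨hs, k, hk, hks⟩
      interval_cases k
      · exfalso
        have h1 := (h.realizationD hℓ).ht_a hs
        rw [← hks, Function.iterate_zero, id, map_neg, map_add,
          realizationD_ht_ε h hℓ ⟨le_rfl, by omega⟩,
          realizationD_ht_ε h hℓ ⟨by omega, by omega⟩] at h1
        have h2 : (4 : ℝ) ≤ ℓ := by exact_mod_cast hℓ
        push_cast at h1
        linarith
      · rw [Function.iterate_one, hv1] at hks
        have := hinj ⟨by omega, by omega⟩ hs hks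
        omega
      · rw [hv2] at hks
        have := hinj ⟨by omega, by omega⟩ hs hks
        omega
      · rw [hv3] at hks
        have := hinj (by split_ifs <;> constructor <;> omega) hs hks
        split_ifs at this <;> omega

-- With values 2, 1, 0 at the indices `1`, `(ℓ + 1) / 2`, `ℓ`, the six vectors already give 1, 2 and
-- 3. The mirrored pairs only repeat the value 2, so an inclusion is enough for them.
omit [P.IsRootSystem] [P.IsCrystallographic] [Finite ι] [P.IsReduced] in
theorem image_values_D_of_odd {φ : (ℕ → ℝ) →ₗ[ℝ] ℝ} (e1 : φ (ε 1) = 2)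
    (e2 : φ (ε ((ℓ + 1) / 2)) = 1) (e3 : φ (ε ℓ) = 0)
    (e4 : ∀ i ∈ Icc 2 ((ℓ - 1) / 2), φ (ε i + ε (ℓ - i + 1)) = 2) :
    φ '' ({ε 1 + ε ((ℓ + 1) / 2), ε 1 - ε ((ℓ + 1) / 2), ε ((ℓ + 1) / 2) + ε ℓ,
        ε ((ℓ + 1) / 2) - ε ℓ, ε 1 + ε ℓ, ε 1 - ε ℓ} ∪
      {x | ∃ i ∈ Icc 2 ((ℓ - 1) / 2), x = ε i + ε (ℓ - i + 1)}) = {1, 2, 3} := by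
  have e4' : φ '' {x | ∃ i ∈ Icc 2 ((ℓ - 1) / 2), x = ε i + ε (ℓ - i + 1)} ⊆ {2} := by
    rintro - ⟨-, ⟨i, hi, rfl⟩, rfl⟩
    exact e4 i hi
  have e5 : (2 : ℝ) + 1 = 3 ∧ (2 : ℝ) - 1 = 1 ∧ (1 : ℝ) + 0 = 1 ∧ (1 : ℝ) - 0 = 1 ∧ (2 : ℝ) + 0 = 2 ∧
      (2 : ℝ) - 0 = 2 := by norm_num
  rw [image_union]
  simp only [image_insert_eq, image_singleton, map_add, map_sub, e1, e2, e3, e5]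
  refine subset_antisymm (union_subset ?_ (e4'.trans ?_)) (subset_union_of_subset_left ?_ _) <;>
    intro x <;> simp only [mem_insert_iff, mem_singleton_iff] <;> tauto

omit [P.IsCrystallographic] [P.IsReduced] in
theorem extraSet_zero_eq_of_image [Nonempty ι] {ω : M ≃ₗ[ℝ] M} {φ : M → ℝ}
    (hφ : ∀ x, pairingPiZero b ω x = φ x) (hval : φ '' disappearing b ω = {1, 2, 3}) :
    extraSet b ω 0 = {1, -1, 2, -2, 3, -3} := by
  ext p
  have hp : p ∈ extraSet b ω 0 ↔ (p : ℝ) ∈ ({1, 2, 3} : Set ℝ) ∨ (-p : ℝ) ∈ ({1, 2, 3} : Set ℝ) := by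
    rw [mem_extraSet_zero_iff, ← hval]
    simp only [hφ, mem_image, ← exists_or, ← and_or_left]
  rw [hp]
  simp only [mem_insert_iff, mem_singleton_iff, neg_eq_iff_eq_neg]
  norm_cast
  omega

theorem extraSet_D_of_odd [Nonempty ι] (h : IsLabelling b (CartanMatrix.D ℓ) α) (hℓ : 4 ≤ ℓ)
    (hodd : Odd ℓ) {j : ℕ} (hj : j = ℓ - 1 ∨ j = ℓ) :
    extraSet b (omega b (α j)) 0 = {1, -1, 2, -2, 3, -3} := by
  obtain ⟨t, hj'⟩ : ∃ t : ℝ, j = ℓ - 1 ∧ t = 1 ∨ j = ℓ ∧ t = -1 := by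
    rcases hj with rfl | rfl
    exacts [⟨1, .inl ⟨rfl, rfl⟩⟩, ⟨-1, .inr ⟨rfl, rfl⟩⟩]
  have hF := image_disappearing_D_of_odd h hℓ hodd hj (u := ε)
    (fun i => realizationD_f_root h hℓ) (realizationD_f_root_last h hℓ)
  obtain ⟨n, hn⟩ := id hodd
  have e1 : (coordAt 1 + coordSum (ℓ - 1)) (ε 1) = 2 := by
    rw [LinearMap.add_apply, coordSum_ε, coordAt_apply, ε_apply, if_pos rfl,
      if_pos ⟨le_rfl, by omega⟩]
    norm_num
  have e2 : (coordAt 1 + coordSum (ℓ - 1)) (ε ((ℓ + 1) / 2)) = 1 := by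
    rw [LinearMap.add_apply, coordSum_ε, coordAt_apply, ε_apply, if_neg (by omega),
      if_pos ⟨by omega, by omega⟩]
    norm_num
  have e3 : (coordAt 1 + coordSum (ℓ - 1)) (ε ℓ) = 0 := by
    rw [LinearMap.add_apply, coordSum_ε, coordAt_apply, ε_apply, if_neg (by omega),
      if_neg (by omega)]
    norm_num
  have e4 : ∀ i ∈ Icc 2 ((ℓ - 1) / 2),
      (coordAt 1 + coordSum (ℓ - 1)) (ε i + ε (ℓ - i + 1)) = 2 := by
    rintro i ⟨hi, hi'⟩
    simp only [LinearMap.add_apply, map_add, coordSum_ε, coordAt_apply, ε_apply]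
    split_ifs <;> first | omega | norm_num
  refine extraSet_zero_eq_of_image (φ := (coordAt 1 + coordSum (ℓ - 1)) ∘ (h.realizationD hℓ).f)
    (pairingPiZero_D_of_odd h hℓ hodd hj') ?_
  rw [image_comp, hF]
  exact image_values_D_of_odd e1 e2 e3 e4

end Odd

end TypeD

end Folding

namespace Folding

open Set

/-! ### Cyclic coordinates for type A -/

section Cyclic

variable {ℓ : ℕ}

/-- The standard basis vectors of `ℝ^{ℓ+1}`, indexed cyclically. -/
noncomputable def δ (x : ZMod (ℓ + 1)) : ZMod (ℓ + 1) → ℝ := Pi.single x 1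

theorem δ_apply (x y : ZMod (ℓ + 1)) : δ x y = if y = x then 1 else 0 := Pi.single_apply x 1 y

theorem δ_comp (σ : Equiv.Perm (ZMod (ℓ + 1))) (x : ZMod (ℓ + 1)) : δ x ∘ σ = δ (σ.symm x) :=
  Pi.single_comp_equiv σ x 1

/-- The representatives are `1, …, ℓ + 1`, in accordance with `e_1, …, e_{ℓ+1}`; the last one is the
residue 0. -/
theorem natCast_zmod_inj {p q : ℕ} (hp : p ∈ Icc 1 (ℓ + 1)) (hq : q ∈ Icc 1 (ℓ + 1)) :
    (p : ZMod (ℓ + 1)) = q ↔ p = q := by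
  refine ⟨fun h => ?_, fun h => by rw [h]⟩
  rw [ZMod.natCast_eq_natCast_iff, Nat.ModEq] at h
  have hp' := hp.1
  have hq' := hq.1
  rcases hp.2.lt_or_eq with h1 | rfl <;> rcases hq.2.lt_or_eq with h2 | rfl
  · rwa [Nat.mod_eq_of_lt h1, Nat.mod_eq_of_lt h2] at h
  · rw [Nat.mod_eq_of_lt h1, Nat.mod_self] at h
    omega
  · rw [Nat.mod_eq_of_lt h2, Nat.mod_self] at h
    omega
  · rfl

theorem exists_natCast_zmod_eq (x : ZMod (ℓ + 1)) : ∃ p ∈ Icc 1 (ℓ + 1), (p : ZMod (ℓ + 1)) = x := by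
  rcases Nat.eq_zero_or_pos x.val with h | h
  · refine ⟨ℓ + 1, ⟨by omega, le_rfl⟩, ?_⟩
    rw [ZMod.natCast_self, (ZMod.val_eq_zero x).mp h]
  · exact ⟨x.val, ⟨h, (ZMod.val_lt x).le⟩, ZMod.natCast_zmod_val x⟩

theorem δ_natCast_apply {p q : ℕ} (hp : p ∈ Icc 1 (ℓ + 1)) (hq : q ∈ Icc 1 (ℓ + 1)) :
    δ (p : ZMod (ℓ + 1)) q = if q = p then 1 else 0 := by
  rw [δ_apply]
  simp only [natCast_zmod_inj hq hp]

/-- The coordinate at `x`. -/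
def cyclicCoord (x : ZMod (ℓ + 1)) : (ZMod (ℓ + 1) → ℝ) →ₗ[ℝ] ℝ := LinearMap.proj x

theorem cyclicCoord_apply (x : ZMod (ℓ + 1)) (v : ZMod (ℓ + 1) → ℝ) : cyclicCoord x v = v x := rfl

/-- The sum of the coordinates from `1` to `i`. -/
noncomputable def cyclicSum (ℓ i : ℕ) : (ZMod (ℓ + 1) → ℝ) →ₗ[ℝ] ℝ :=
  ∑ p ∈ Finset.Icc 1 i, cyclicCoord (p : ZMod (ℓ + 1))

theorem cyclicSum_δ {i p : ℕ} (hi : i ≤ ℓ) (hp : p ∈ Icc 1 (ℓ + 1)) :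
    cyclicSum ℓ i (δ p) = if p ≤ i then 1 else 0 := by
  have : ∀ q ∈ Finset.Icc 1 i, cyclicCoord (q : ZMod (ℓ + 1)) (δ (p : ZMod (ℓ + 1))) =
      if q = p then 1 else 0 := by
    intro q hq
    rw [Finset.mem_Icc] at hq
    exact δ_natCast_apply hp ⟨hq.1, by omega⟩
  rw [cyclicSum, LinearMap.sum_apply, Finset.sum_congr rfl this, Finset.sum_ite_eq']
  simp only [Finset.mem_Icc, hp.1, true_and]

/-- At `x` the left side is 1, while for `x ≠ y` the right side is at most 0. -/
theorem eq_of_δ_sub_eq (hℓ : 1 ≤ ℓ) {x y : ZMod (ℓ + 1)}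
    (h : δ x - δ (x + 1) = δ y - δ (y + 1)) : x = y := by
  by_contra hne
  have h1 := congrFun h x
  have : (1 : ZMod (ℓ + 1)) ≠ 0 := by
    have : Fact (1 < ℓ + 1) := ⟨by omega⟩
    exact one_ne_zero
  simp only [Pi.sub_apply, δ_apply, if_true, if_neg hne, left_eq_add, if_neg this] at h1
  split_ifs at h1 <;> norm_num at h1

/-- The rotation by `j`. -/
def rotate (j : ZMod (ℓ + 1)) (v : ZMod (ℓ + 1) → ℝ) (x : ZMod (ℓ + 1)) : ℝ := v (x - j)

theorem rotate_δ (j x : ZMod (ℓ + 1)) : rotate j (δ x) = δ (x + j) := by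
  funext y
  simp only [rotate, δ_apply, sub_eq_iff_eq_add]

theorem rotate_sub (j : ZMod (ℓ + 1)) (v w : ZMod (ℓ + 1) → ℝ) :
    rotate j (v - w) = rotate j v - rotate j w := rfl

theorem rotate_iterate (j : ZMod (ℓ + 1)) (t : ℕ) (v : ZMod (ℓ + 1) → ℝ) :
    (rotate j)^[t] v = rotate ((t : ZMod (ℓ + 1)) * j) v := by
  induction t with
  | zero =>
    funext x
    simp [rotate]
  | succ t ih =>
    rw [Function.iterate_succ_apply', ih]
    funext x
    simp only [rotate]
    congr 1
    push_cast
    ring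

theorem rotate_iterate_card (j : ZMod (ℓ + 1)) (v : ZMod (ℓ + 1) → ℝ) :
    (rotate j)^[ℓ + 1] v = v := by
  rw [rotate_iterate, ZMod.natCast_self, zero_mul]
  funext x
  simp [rotate]

theorem sum_rotate_apply (j x : ZMod (ℓ + 1)) (v : ZMod (ℓ + 1) → ℝ) :
    (∑ t ∈ Finset.range (ℓ + 1), (rotate j)^[t] v) x = ∑ z : ZMod (ℓ + 1), v (x - z * j) := by
  rw [Finset.sum_apply, Finset.sum_range]
  refine Finset.sum_congr rfl fun z _ => ?_
  rw [rotate_iterate, rotate]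
  congr 3
  exact ZMod.natCast_zmod_val (n := ℓ + 1) z

/-- The orbit sum of `δ x` depends only on the coset of `x` modulo the subgroup generated by `j`,
and different cosets have disjoint supports. -/
theorem sum_rotate_eq_zero_iff (j x y : ZMod (ℓ + 1)) :
    ∑ t ∈ Finset.range (ℓ + 1), (rotate j)^[t] (δ x - δ y) = 0 ↔ ∃ z, y - x = z * j := by
  rw [funext_iff]
  simp only [sum_rotate_apply, Pi.zero_apply, Pi.sub_apply, Finset.sum_sub_distrib, sub_eq_zero]
  constructor
  · intro h
    by_contra! hcon
    -- At `y` the orbit of `δ x` contributes nothing, while that of `δ y` contributes a positive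
    -- amount.
    have h1 := h y
    have h2 : ∑ z, δ x (y - z * j) = 0 := Finset.sum_eq_zero fun z _ => by
      rw [δ_apply, if_neg]
      intro e
      exact hcon z (by rw [← e]; ring)
    have h3 : 0 < ∑ z, δ y (y - z * j) := by
      refine Finset.sum_pos' (fun z _ => ?_) ⟨0, Finset.mem_univ _, ?_⟩
      · rw [δ_apply]
        split_ifs <;> norm_num
      · simp [δ_apply]
    rw [← h1, h2] at h3
    exact h3.false
  · rintro ⟨w, hw⟩ r
    -- For `y = x + w * j`, shifting the summation index by `w` turns one orbit sum into the other.
    refine Fintype.sum_equiv (Equiv.subRight w) _ _ fun z => ?_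
    simp only [δ_apply, Equiv.subRight_apply]
    congr 1
    rw [eq_iff_iff, sub_mul, ← hw]
    constructor <;> intro e
    · rw [← sub_add, e]
      ring
    · linear_combination e

/-- By Bézout the multiples of `j` modulo `ℓ + 1` are the multiples of the gcd. -/
theorem exists_intCast_eq_mul_iff (a : ℤ) (j : ℕ) :
    (∃ z : ZMod (ℓ + 1), (a : ZMod (ℓ + 1)) = z * j) ↔ (Nat.gcd (ℓ + 1) j : ℤ) ∣ a := by
  constructor
  · rintro ⟨z, hz⟩
    obtain ⟨w, rfl⟩ := ZMod.intCast_surjective z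
    have h1 : ((w * j : ℤ) : ZMod (ℓ + 1)) = (a : ℤ) := by rw [hz]; push_cast; rfl
    rw [ZMod.intCast_eq_intCast_iff_dvd_sub] at h1
    have h2 : (Nat.gcd (ℓ + 1) j : ℤ) ∣ ((ℓ + 1 : ℕ) : ℤ) := by
      exact_mod_cast Nat.gcd_dvd_left _ _
    have h3 : (Nat.gcd (ℓ + 1) j : ℤ) ∣ (j : ℤ) := by exact_mod_cast Nat.gcd_dvd_right _ _
    have h4 := dvd_add (h2.trans h1) (h3.mul_left w)
    rwa [sub_add_cancel] at h4
  · rintro ⟨c, rfl⟩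
    refine ⟨(Nat.gcdB (ℓ + 1) j * c : ℤ), ?_⟩
    rw [Nat.gcd_eq_gcd_ab]
    push_cast
    have : ((ℓ : ZMod (ℓ + 1)) + 1) = 0 := by exact_mod_cast ZMod.natCast_self (ℓ + 1)
    rw [this]
    ring

end Cyclic

/-! ### Type A: realization, roots and `ω_j` -/

section TypeA

variable {ι M N : Type*} [AddCommGroup M] [Module ℝ M] [AddCommGroup N] [Module ℝ N]
variable {P : RootPairing ι ℝ M N} {b : P.Base} {α : ℕ → ι} {ℓ : ℕ}
variable [P.IsRootSystem] [P.IsCrystallographic]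

/-- The realization of type `A`. -/
noncomputable def IsLabelling.realizationA (h : IsLabelling b (CartanMatrix.A ℓ) α) :
    Realization b ℓ α (ZMod (ℓ + 1) → ℝ) :=
  h.realization (fun i => δ (i : ZMod (ℓ + 1)) - δ ((i + 1 : ℕ) : ZMod (ℓ + 1))) (cyclicSum ℓ)
    (fun i => cyclicCoord (i : ZMod (ℓ + 1)) - cyclicCoord ((i + 1 : ℕ) : ZMod (ℓ + 1)))
    (by
      rintro i ⟨hi, hi'⟩ j ⟨hj, hj'⟩
      rw [map_sub, cyclicSum_δ hi' ⟨hj, by omega⟩, cyclicSum_δ hi' ⟨by omega, by omega⟩]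
      split_ifs <;> first | omega | norm_num)
    (by
      rintro ⟨i, hi⟩ ⟨j, hj⟩
      have hi1 : i + 1 ∈ Icc 1 (ℓ + 1) := ⟨by omega, by omega⟩
      have hi2 : i + 1 + 1 ∈ Icc 1 (ℓ + 1) := ⟨by omega, by omega⟩
      have hj1 : j + 1 ∈ Icc 1 (ℓ + 1) := ⟨by omega, by omega⟩
      have hj2 : j + 1 + 1 ∈ Icc 1 (ℓ + 1) := ⟨by omega, by omega⟩
      simp only [CartanMatrix.A, Matrix.of_apply, Fin.mk.injEq, LinearMap.sub_apply,
        cyclicCoord_apply, Pi.sub_apply]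
      rw [δ_natCast_apply hi1 hj1, δ_natCast_apply hi2 hj1, δ_natCast_apply hi1 hj2,
        δ_natCast_apply hi2 hj2]
      split_ifs <;> first | omega | norm_num)

variable (h : IsLabelling b (CartanMatrix.A ℓ) α)

theorem realizationA_a (i : ℕ) :
    h.realizationA.a i = δ (i : ZMod (ℓ + 1)) - δ ((i : ZMod (ℓ + 1)) + 1) := by
  rw [← Nat.cast_succ]
  rfl

theorem realizationA_k (i : ℕ) : h.realizationA.k i = cyclicSum ℓ i := rfl

/-- The vector with index `ℓ + 1` has height 0, since no coefficient functional involves it; the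
others follow by telescoping. -/
theorem realizationA_ht_δ {p : ℕ} (hp : p ∈ Icc 1 (ℓ + 1)) :
    h.realizationA.ht (δ (p : ZMod (ℓ + 1))) = (ℓ : ℝ) + 1 - p := by
  obtain ⟨h1, h2⟩ := hp
  induction h2 using Nat.decreasingInduction with
  | self =>
    rw [Realization.ht, LinearMap.sum_apply, Finset.sum_eq_zero]
    · push_cast
      ring
    · intro i hi
      rw [Finset.mem_Icc] at hi
      rw [realizationA_k, cyclicSum_δ hi.2 ⟨by omega, le_rfl⟩, if_neg (by omega)]
  | of_succ p hpℓ ih =>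
    have h3 := h.realizationA.ht_a (i := p) ⟨h1, by omega⟩
    rw [realizationA_a, map_sub, ← Nat.cast_succ, ih (by omega)] at h3
    push_cast at h3
    linarith

/-- Transpositions generate all permutations, in particular the rotations. -/
theorem actsA (σ : Equiv.Perm (ZMod (ℓ + 1))) : h.realizationA.Acts fun v => v ∘ σ := by
  induction σ using Equiv.Perm.swap_induction_on with
  | one => exact Realization.acts_id
  | swap_mul f x y hxy ih =>
    obtain ⟨p, hp, rfl⟩ := exists_natCast_zmod_eq x
    obtain ⟨q, hq, rfl⟩ := exists_natCast_zmod_eq y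
    exact ih.comp (h.realizationA.acts_swap (n := ℓ + 1) (u := Nat.cast)
      (fun p hp q hq => (natCast_zmod_inj hp hq).mp) le_rfl (fun _ _ _ => rfl)
      (fun _ _ _ _ => rfl) hp hq)

theorem actsA_rotate (j : ZMod (ℓ + 1)) : h.realizationA.Acts (rotate j) :=
  actsA h (Equiv.subRight j)

variable [Finite ι] [P.IsReduced]

theorem realizationA_roots (hℓ : 1 ≤ ℓ) :
    h.realizationA.roots = {v | ∃ x y : ZMod (ℓ + 1), x ≠ y ∧ v = δ x - δ y} := by
  have h01 : (1 : ZMod (ℓ + 1)) ≠ 0 := by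
    have : Fact (1 < ℓ + 1) := ⟨by omega⟩
    exact one_ne_zero
  apply subset_antisymm
  · refine h.realizationA.roots_subset ?_ ?_ ?_
    · intro i _
      exact ⟨_, _, by simpa using h01, realizationA_a h i⟩
    · rintro - ⟨x, y, hxy, rfl⟩
      exact ⟨y, x, hxy.symm, neg_sub _ _⟩
    · rintro i hi - ⟨x, y, hxy, rfl⟩
      have key : ∀ x, δ x - h.realizationA.c i (δ x) • h.realizationA.a i =
          δ (Equiv.swap (i : ZMod (ℓ + 1)) (i + 1) x) := by
        intro x
        rw [realizationA_a]
        change δ x - (δ x (i : ZMod (ℓ + 1)) - δ x ((i + 1 : ℕ) : ZMod (ℓ + 1))) • _ = _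
        rw [Nat.cast_succ]
        have hne : (i : ZMod (ℓ + 1)) ≠ i + 1 := by simpa using h01
        generalize (i : ZMod (ℓ + 1)) + 1 = i' at hne ⊢
        by_cases h1 : x = i
        · rw [h1, Equiv.swap_apply_left, δ_apply, δ_apply, if_pos rfl, if_neg hne.symm]
          module
        by_cases h2 : x = i'
        · rw [h2, Equiv.swap_apply_right, δ_apply, δ_apply, if_neg hne, if_pos rfl]
          module
        · rw [Equiv.swap_apply_of_ne_of_ne h1 h2, δ_apply, δ_apply, if_neg (Ne.symm h1),
            if_neg (Ne.symm h2)]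
          module
      refine ⟨_, _, (Equiv.swap (i : ZMod (ℓ + 1)) (i + 1)).injective.ne hxy, ?_⟩
      rw [← key, ← key, map_sub]
      module
  · rintro - ⟨x, y, hxy, rfl⟩
    have h1 := h.realizationA.a_mem_roots (i := 1) ⟨le_rfl, hℓ⟩
    rw [realizationA_a, Nat.cast_one] at h1
    -- The first transposition takes index 1 to `x`; the second takes the new position of index 2 to
    -- `y` and leaves `x` in place.
    have h2 := (actsA h (Equiv.swap 1 x)).mem_roots h1
    have h3 := (actsA h (Equiv.swap (Equiv.swap 1 x (1 + 1)) y)).mem_roots h2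
    convert h3 using 1
    change δ x - δ y = (δ 1 ∘ _) ∘ _ - (δ (1 + 1) ∘ _) ∘ _
    rw [δ_comp, δ_comp, δ_comp, δ_comp, Equiv.symm_swap, Equiv.symm_swap, Equiv.swap_apply_left,
      Equiv.swap_apply_left, Equiv.swap_apply_of_ne_of_ne _ hxy]
    intro e
    rw [eq_comm, Equiv.swap_apply_eq_iff, Equiv.swap_apply_right] at e
    exact h01 (by simpa using e)

theorem realizationA_pos_iff (hℓ : 1 ≤ ℓ) (v : ZMod (ℓ + 1) → ℝ) :
    v ∈ h.realizationA.roots ∧ 0 < h.realizationA.ht v ↔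
      ∃ p ∈ Icc 1 (ℓ + 1), ∃ q ∈ Icc 1 (ℓ + 1), p < q ∧
        v = δ (p : ZMod (ℓ + 1)) - δ (q : ZMod (ℓ + 1)) := by
  rw [realizationA_roots h hℓ]
  constructor
  · rintro ⟨⟨x, y, hxy, rfl⟩, hpos⟩
    obtain ⟨p, hp, rfl⟩ := exists_natCast_zmod_eq x
    obtain ⟨q, hq, rfl⟩ := exists_natCast_zmod_eq y
    rw [map_sub, realizationA_ht_δ h hp, realizationA_ht_δ h hq] at hpos
    exact ⟨p, hp, q, hq, by exact_mod_cast (by linarith : (p : ℝ) < q), rfl⟩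
  · rintro ⟨p, hp, q, hq, hpq, rfl⟩
    refine ⟨⟨_, _, fun e => hpq.ne ((natCast_zmod_inj hp hq).mp e), rfl⟩, ?_⟩
    rw [map_sub, realizationA_ht_δ h hp, realizationA_ht_δ h hq]
    have : (p : ℝ) < q := by exact_mod_cast hpq
    linarith

/-- The rotation sends `α_i` to `α_{i+j}`, with indices modulo `ℓ + 1`. The result is never `α_j`,
and for `i + j = ℓ + 1` it is `α_0 = δ 0 - δ 1`, all of whose coefficients are `-1`. -/
theorem f_omegaA {j : ℕ} (hj : j ∈ Icc 1 ℓ) (x : M) :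
    h.realizationA.f (omega b (α j) x) = rotate j (h.realizationA.f x) := by
  refine h.realizationA.f_omega (actsA_rotate h j) hj ?_ x
  rintro i ⟨hi, hi'⟩
  have h1 : rotate j (h.realizationA.a i) =
      δ ((i + j : ℕ) : ZMod (ℓ + 1)) - δ (((i + j : ℕ) : ZMod (ℓ + 1)) + 1) := by
    rw [realizationA_a, rotate_sub, rotate_δ, rotate_δ, Nat.cast_add]
    congr 2
    ring
  obtain ⟨hj, hj'⟩ := hj
  rcases lt_trichotomy (i + j) (ℓ + 1) with hlt | heq | hgt
  · left
    refine ⟨i + j, ⟨by omega, by omega⟩, by omega, ?_⟩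
    rw [h1, realizationA_a]
  · right
    rw [h1, heq, ZMod.natCast_self, zero_add, map_sub, realizationA_k]
    have e1 := cyclicSum_δ hj' (p := 1) ⟨le_rfl, by omega⟩
    have e2 := cyclicSum_δ hj' (p := ℓ + 1) ⟨by omega, le_rfl⟩
    rw [Nat.cast_one, if_pos hj] at e1
    rw [ZMod.natCast_self, if_neg (by omega)] at e2
    rw [e1, e2]
    norm_num
  · left
    refine ⟨i + j - (ℓ + 1), ⟨by omega, by omega⟩, by omega, ?_⟩
    rw [h1, realizationA_a, Nat.cast_sub hgt.le, ZMod.natCast_self, sub_zero]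

variable [Nonempty ι]

theorem f_highestRootA (hℓ : 1 ≤ ℓ) :
    h.realizationA.f (P.root (highestRoot b)) = δ 1 - δ 0 := by
  have h1 : (1 : ℕ) ∈ Icc 1 (ℓ + 1) := ⟨le_rfl, by omega⟩
  have h2 : ℓ + 1 ∈ Icc 1 (ℓ + 1) := ⟨by omega, le_rfl⟩
  have h3 : (δ 1 - δ 0 : ZMod (ℓ + 1) → ℝ) = δ ((1 : ℕ) : ZMod (ℓ + 1)) - δ ((ℓ + 1 : ℕ)) := by
    rw [ZMod.natCast_self, Nat.cast_one]
  have h4 := (realizationA_pos_iff h hℓ _).mpr ⟨1, h1, ℓ + 1, h2, by omega, rfl⟩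
  rw [h3]
  refine h.realizationA.f_highestRoot h4.1 fun v hv => ?_
  by_cases hpos : 0 < h.realizationA.ht v
  · obtain ⟨p, hp, q, hq, hpq, rfl⟩ := (realizationA_pos_iff h hℓ v).mp ⟨hv, hpos⟩
    by_cases heq : p = 1 ∧ q = ℓ + 1
    · left
      rw [heq.1, heq.2]
    · right
      rw [map_sub, map_sub, realizationA_ht_δ h hp, realizationA_ht_δ h hq, realizationA_ht_δ h h1,
        realizationA_ht_δ h h2]
      have h5 : q + 1 < ℓ + 1 + p := by
        have := hp.1
        have := hq.2
        omega
      have : (q : ℝ) + 1 < ((ℓ + 1 : ℕ) : ℝ) + p := by exact_mod_cast h5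
      push_cast at this ⊢
      linarith
  · right
    exact (not_lt.mp hpos).trans_lt h4.2

theorem minuscule_A (h : IsLabelling b (CartanMatrix.A ℓ) α) (hℓ : 1 ≤ ℓ) :
    minuscule b = α '' Icc 1 ℓ := by
  rw [h.realizationA.minuscule_eq (f_highestRootA h hℓ)]
  congr 1
  refine sep_eq_self_iff_mem_true.mpr ?_
  rintro j ⟨hj, hj'⟩
  have e1 := cyclicSum_δ hj' (p := 1) ⟨le_rfl, by omega⟩
  have e2 := cyclicSum_δ hj' (p := ℓ + 1) ⟨by omega, le_rfl⟩
  rw [Nat.cast_one, if_pos hj] at e1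
  rw [ZMod.natCast_self, if_neg (by omega)] at e2
  rw [realizationA_k, map_sub, e1, e2, sub_zero]

end TypeA

end Folding

namespace Folding

open Set

/-! ### Type A: disappearing roots, order of `ω_j` and `P(0)` -/

section TypeA

variable {ι M N : Type*} [AddCommGroup M] [Module ℝ M] [AddCommGroup N] [Module ℝ N]
variable {P : RootPairing ι ℝ M N} {b : P.Base} {α : ℕ → ι} {ℓ : ℕ}
variable [P.IsRootSystem] [P.IsCrystallographic] [Finite ι] [P.IsReduced]

theorem mem_disappearing_A (h : IsLabelling b (CartanMatrix.A ℓ) α) {j : ℕ} (hj : j ∈ Icc 1 ℓ)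
    {x : M} :
    x ∈ disappearing b (omega b (α j)) ↔
      ∃ p ∈ Icc 1 (ℓ + 1), ∃ q ∈ Icc 1 (ℓ + 1),
        (∃ k : ℕ, 0 < k ∧ (q : ℤ) - p = Nat.gcd (ℓ + 1) j * k) ∧
        h.realizationA.f x = δ (p : ZMod (ℓ + 1)) - δ (q : ZMod (ℓ + 1)) := by
  rw [h.realizationA.mem_disappearing_iff (m := ℓ + 1) (f_omegaA h hj) (by omega)
    (fun x => rotate_iterate_card _ _), ← and_assoc,
    realizationA_pos_iff h (hj.1.trans hj.2)]
  have hg : 0 < Nat.gcd (ℓ + 1) j := Nat.gcd_pos_of_pos_left _ (by omega)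
  have key : ∀ p q : ℕ, (∑ t ∈ Finset.range (ℓ + 1), (rotate (j : ZMod (ℓ + 1)))^[t]
      (δ (p : ZMod (ℓ + 1)) - δ (q : ZMod (ℓ + 1))) = 0) ↔
        (Nat.gcd (ℓ + 1) j : ℤ) ∣ (q : ℤ) - p := by
    intro p q
    rw [sum_rotate_eq_zero_iff, ← exists_intCast_eq_mul_iff]
    push_cast
    rfl
  constructor
  · rintro ⟨⟨p, hp, q, hq, hpq, hx⟩, hz⟩
    rw [hx, key] at hz
    obtain ⟨k, hk⟩ := hz
    have hk0 : 0 < k := by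
      have : 0 < (Nat.gcd (ℓ + 1) j : ℤ) * k := by omega
      exact pos_of_mul_pos_right this (by positivity)
    exact ⟨p, hp, q, hq, ⟨k.toNat, by omega, by rw [hk, Int.toNat_of_nonneg hk0.le]⟩, hx⟩
  · rintro ⟨p, hp, q, hq, ⟨k, hk0, hk⟩, hx⟩
    rw [hx, key]
    have : 0 < (Nat.gcd (ℓ + 1) j : ℤ) * k := by positivity
    exact ⟨⟨p, hp, q, hq, by omega, rfl⟩, k, hk⟩

theorem f_strA (h : IsLabelling b (CartanMatrix.A ℓ) α) {p q : ℕ} (hp : 1 ≤ p) (hpq : p ≤ q + 1)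
    (hq : q ≤ ℓ) :
    h.realizationA.f (str P α p q) = δ (p : ZMod (ℓ + 1)) - δ ((q + 1 : ℕ) : ZMod (ℓ + 1)) :=
  map_str _ (fun i => δ (i : ZMod (ℓ + 1))) hpq fun i hi hi' =>
    h.realizationA.map_root i ⟨by omega, by omega⟩

theorem disappearing_A (h : IsLabelling b (CartanMatrix.A ℓ) α) {j : ℕ} (hj : j ∈ Icc 1 ℓ) :
    disappearing b (omega b (α j)) =
      {x | ∃ i₁ ∈ Icc 1 ℓ, ∃ i₂ ∈ Icc 1 ℓ,
        (∃ k : ℕ, 0 < k ∧ (i₂ : ℤ) - i₁ + 1 = Nat.gcd (ℓ + 1) j * k) ∧ x = str P α i₁ i₂} := by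
  have hg : 0 < Nat.gcd (ℓ + 1) j := Nat.gcd_pos_of_pos_left _ (by omega)
  ext x
  rw [mem_disappearing_A h hj]
  constructor
  · rintro ⟨p, ⟨hp, hp'⟩, q, ⟨hq, hq'⟩, ⟨k, hk0, hk⟩, hx⟩
    have : 0 < (Nat.gcd (ℓ + 1) j : ℤ) * k := by positivity
    obtain ⟨q, rfl⟩ : ∃ q', q = q' + 1 := ⟨q - 1, by omega⟩
    refine ⟨p, ⟨hp, by omega⟩, q, ⟨by omega, by omega⟩, ⟨k, hk0, ?_⟩, ?_⟩
    · rw [← hk]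
      push_cast
      ring
    · apply h.realizationA.f_injective
      rw [hx, f_strA h hp (by omega) (by omega)]
  · rintro ⟨p, ⟨hp, hp'⟩, q, ⟨hq, hq'⟩, ⟨k, hk0, hk⟩, rfl⟩
    have : 0 < (Nat.gcd (ℓ + 1) j : ℤ) * k := by positivity
    refine ⟨p, ⟨hp, by omega⟩, q + 1, ⟨by omega, by omega⟩, ⟨k, hk0, ?_⟩,
      f_strA h hp (by omega) hq'⟩
    rw [← hk]
    push_cast
    ring

theorem image_disappearing_A (h : IsLabelling b (CartanMatrix.A ℓ) α) {j : ℕ} (hj : j ∈ Icc 1 ℓ)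
    {W : Type*} [AddCommGroup W] [Module ℝ W] {g : M →ₗ[ℝ] W} {u : ℕ → W}
    (h1 : ∀ i ∈ Icc 1 ℓ, g (P.root (α i)) = u i - u (i + 1)) :
    g '' disappearing b (omega b (α j)) =
      {x | ∃ p₁ ∈ Icc 1 (ℓ + 1), ∃ p₂ ∈ Icc 1 (ℓ + 1),
        (∃ k : ℕ, 0 < k ∧ (p₂ : ℤ) - p₁ = Nat.gcd (ℓ + 1) j * k) ∧ x = u p₁ - u p₂} := by
  have hg : 0 < Nat.gcd (ℓ + 1) j := Nat.gcd_pos_of_pos_left _ (by omega)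
  have key : ∀ p q : ℕ, 1 ≤ p → p ≤ q + 1 → q ≤ ℓ → g (str P α p q) = u p - u (q + 1) :=
    fun p q hp hpq hq => map_str g u hpq fun i hi hi' => h1 i ⟨by omega, by omega⟩
  rw [disappearing_A h hj]
  ext y
  constructor
  · rintro ⟨-, ⟨p, ⟨hp, hp'⟩, q, ⟨hq, hq'⟩, ⟨k, hk0, hk⟩, rfl⟩, rfl⟩
    have : 0 < (Nat.gcd (ℓ + 1) j : ℤ) * k := by positivity
    refine ⟨p, ⟨hp, by omega⟩, q + 1, ⟨by omega, by omega⟩, ⟨k, hk0, ?_⟩,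
      key p q hp (by omega) hq'⟩
    rw [← hk]
    push_cast
    ring
  · rintro ⟨p, ⟨hp, hp'⟩, q, ⟨hq, hq'⟩, ⟨k, hk0, hk⟩, rfl⟩
    have : 0 < (Nat.gcd (ℓ + 1) j : ℤ) * k := by positivity
    obtain ⟨q, rfl⟩ : ∃ q', q = q' + 1 := ⟨q - 1, by omega⟩
    refine ⟨_, ⟨p, ⟨hp, by omega⟩, q, ⟨by omega, by omega⟩, ⟨k, hk0, ?_⟩, rfl⟩,
      key p q hp (by omega) (by omega)⟩
    rw [← hk]
    push_cast
    ring

/-- A power of the rotation is trivial exactly when the multiple of `j` is 0 modulo `ℓ + 1`; its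
effect on `α_1` already decides this. -/
theorem orderOf_omegaA (h : IsLabelling b (CartanMatrix.A ℓ) α) {j : ℕ} (hj : j ∈ Icc 1 ℓ) :
    orderOf (omega b (α j)) = (ℓ + 1) / Nat.gcd (ℓ + 1) j := by
  rw [← ZMod.addOrderOf_coe j (by omega : ℓ + 1 ≠ 0), ← orderOf_ofAdd_eq_addOrderOf,
    orderOf_eq_orderOf_iff]
  intro t
  rw [← ofAdd_nsmul, ofAdd_eq_one, nsmul_eq_mul]
  have hℓ : 1 ≤ ℓ := hj.1.trans hj.2
  constructor
  · intro ht
    have h1 := h.realizationA.f_pow (f_omegaA h hj) t (P.root (α 1))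
    rw [ht] at h1
    change h.realizationA.f (P.root (α 1)) = _ at h1
    rw [h.realizationA.map_root 1 ⟨le_rfl, hℓ⟩, rotate_iterate,
      realizationA_a, rotate_sub, rotate_δ, rotate_δ, add_right_comm] at h1
    simpa using eq_of_δ_sub_eq hℓ h1
  · intro ht
    refine h.realizationA.pow_eq_one (f_omegaA h hj) fun x => ?_
    rw [rotate_iterate, ht]
    funext y
    rw [rotate, sub_zero]

variable [Nonempty ι]

/-- The orbit of `α_0` consists of the `α_s` with `s` a multiple of `j` modulo `ℓ + 1`, that is,
divisible by the gcd. -/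
theorem pairingPiZero_A (h : IsLabelling b (CartanMatrix.A ℓ) α) {j : ℕ} (hj : j ∈ Icc 1 ℓ)
    (x : M) :
    pairingPiZero b (omega b (α j)) x =
      ∑ s ∈ Finset.Icc 1 ℓ with Nat.gcd (ℓ + 1) j ∣ s, cyclicSum ℓ s (h.realizationA.f x) := by
  have hℓ : 1 ≤ ℓ := hj.1.trans hj.2
  refine h.realizationA.pairingPiZero_apply (m := ℓ + 1) (f_omegaA h hj) (by omega)
    (fun x => rotate_iterate_card _ _) (f_highestRootA h hℓ) (fun s => ?_) x
  rw [Finset.mem_filter, Finset.mem_Icc]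
  refine and_congr_right fun hs => ?_
  have key : ∀ t : ℕ, (rotate (j : ZMod (ℓ + 1)))^[t] (-(δ 1 - δ 0)) = h.realizationA.a s ↔
      (t * j : ZMod (ℓ + 1)) = s := by
    intro t
    rw [rotate_iterate, realizationA_a, neg_sub, rotate_sub, rotate_δ, rotate_δ, zero_add, add_comm 1]
    exact ⟨eq_of_δ_sub_eq hℓ, fun h => by rw [h]⟩
  simp only [key]
  rw [← Int.natCast_dvd_natCast, ← exists_intCast_eq_mul_iff, Int.cast_natCast]
  constructor
  · rintro ⟨z, hz⟩
    exact ⟨z.val, ZMod.val_lt z, by rw [ZMod.natCast_zmod_val, hz]⟩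
  · rintro ⟨t, -, ht⟩
    exact ⟨t, ht.symm⟩

-- The coefficient of `e_p - e_q` at `α_s` is 1 for `p ≤ s < q` and 0 otherwise, so the sum counts
-- the multiples of `g` in an interval of length `g * k`.
omit [P.IsRootSystem] [P.IsCrystallographic] [Finite ι] [P.IsReduced] [Nonempty ι] in
theorem sum_cyclicSum {g p q k : ℕ} (hg : 0 < g) (hp : p ∈ Icc 1 (ℓ + 1)) (hq : q ∈ Icc 1 (ℓ + 1))
    (hpq : q = p + g * k) :
    ∑ s ∈ Finset.Icc 1 ℓ with g ∣ s,
      cyclicSum ℓ s (δ (p : ZMod (ℓ + 1)) - δ (q : ZMod (ℓ + 1))) = k := by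
  have h1 : ∀ s ∈ (Finset.Icc 1 ℓ).filter (g ∣ ·),
      cyclicSum ℓ s (δ (p : ZMod (ℓ + 1)) - δ (q : ZMod (ℓ + 1))) =
        if s ∈ Finset.Ico p q then 1 else 0 := by
    intro s hs
    rw [Finset.mem_filter, Finset.mem_Icc] at hs
    have : p ≤ q := by omega
    rw [map_sub, cyclicSum_δ hs.1.2 hp, cyclicSum_δ hs.1.2 hq]
    simp only [Finset.mem_Ico]
    split_ifs <;> first | omega | norm_num
  have h2 : (Finset.Icc 1 ℓ).filter (g ∣ ·) ∩ Finset.Ico p q =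
      (Finset.Ico p q).filter (fun s => s ≡ 0 [MOD g]) := by
    ext s
    have := hp.1
    have := hq.2
    simp only [Finset.mem_inter, Finset.mem_filter, Finset.mem_Icc, Finset.mem_Ico,
      Nat.modEq_zero_iff_dvd]
    constructor
    · tauto
    · rintro ⟨h3, h4⟩
      exact ⟨⟨by omega, h4⟩, h3⟩
  have h3 := Nat.Ico_filter_modEq_card p q hg 0
  have hg' : (g : ℚ) ≠ 0 := by positivity
  -- The count is a difference of ceilings whose arguments differ by the integer `k`.
  have h4 : ((q : ℚ) - (0 : ℕ)) / g = ((p : ℚ) - (0 : ℕ)) / g + (k : ℕ) := by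
    rw [hpq]
    push_cast
    field_simp
    ring
  rw [h4, Int.ceil_add_natCast, add_sub_cancel_left, max_eq_left (by positivity)] at h3
  rw [Finset.sum_congr rfl h1, Finset.sum_ite_mem, h2, Finset.sum_const, nsmul_eq_mul, mul_one]
  exact_mod_cast h3

/-- Put `ℓ + 1 = g * o`, where `o` is the order. A disappearing root has `q - p = g * k` and pairing
`k`, and `q - p ≤ ℓ` means `k < o`. -/
theorem extraSet_A (h : IsLabelling b (CartanMatrix.A ℓ) α) {j : ℕ} (hj : j ∈ Icc 1 ℓ) :
    extraSet b (omega b (α j)) 0 =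
      {p | 1 ≤ |p| ∧ |p| ≤ (orderOf (omega b (α j)) : ℤ) - 1} := by
  have hg : 0 < Nat.gcd (ℓ + 1) j := Nat.gcd_pos_of_pos_left _ (by omega)
  obtain ⟨o, ho⟩ := Nat.gcd_dvd_left (ℓ + 1) j
  have hord : orderOf (omega b (α j)) = o := by
    rw [orderOf_omegaA h hj]
    exact Nat.div_eq_of_eq_mul_right hg ho
  have hpair : ∀ p ∈ Icc 1 (ℓ + 1), ∀ q ∈ Icc 1 (ℓ + 1), ∀ k : ℕ,
      (q : ℤ) - p = Nat.gcd (ℓ + 1) j * k → ∀ x,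
      h.realizationA.f x = δ (p : ZMod (ℓ + 1)) - δ (q : ZMod (ℓ + 1)) →
        pairingPiZero b (omega b (α j)) x = k := by
    intro p hp q hq k hk x hx
    rw [pairingPiZero_A h hj, hx]
    refine sum_cyclicSum hg hp hq ?_
    zify
    linarith
  rw [hord]
  ext p
  rw [mem_extraSet_zero_iff, mem_ofPred_eq]
  constructor
  · rintro ⟨x, hx, hp⟩
    obtain ⟨p', hp', q', hq', ⟨k, hk0, hk⟩, hx⟩ := (mem_disappearing_A h hj).mp hx
    rw [hpair p' hp' q' hq' k hk x hx] at hp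
    have hpk : |p| = k := by
      rcases hp with hp | hp
      · have : (k : ℤ) = p := by exact_mod_cast hp
        rw [← this, Nat.abs_cast]
      · have : (k : ℤ) = -p := by exact_mod_cast hp
        rw [← abs_neg, ← this, Nat.abs_cast]
    have h1 : Nat.gcd (ℓ + 1) j * k < Nat.gcd (ℓ + 1) j * o := by
      have := hp'.1
      have := hq'.2
      zify
      rw [← hk]
      omega
    have := Nat.lt_of_mul_lt_mul_left h1
    omega
  · rintro ⟨h1, h2⟩
    obtain ⟨k, hk⟩ : ∃ k : ℕ, |p| = k := ⟨p.natAbs, Int.abs_eq_natAbs p⟩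
    have hko : Nat.gcd (ℓ + 1) j * (k + 1) ≤ Nat.gcd (ℓ + 1) j * o :=
      Nat.mul_le_mul_left _ (by omega)
    have hk0 : 0 < Nat.gcd (ℓ + 1) j * k := Nat.mul_pos hg (by omega)
    rw [mul_add] at hko
    -- Every `k` from 1 to `o - 1` is attained by the root `e_1 - e_{1 + g k}`.
    have hf := f_strA h (p := 1) (q := Nat.gcd (ℓ + 1) j * k) le_rfl (by omega) (by omega)
    have h3 : ((Nat.gcd (ℓ + 1) j * k + 1 : ℕ) : ℤ) - (1 : ℕ) = Nat.gcd (ℓ + 1) j * k := by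
      push_cast
      ring
    have hp1 : 1 ∈ Icc 1 (ℓ + 1) := ⟨le_rfl, by omega⟩
    have hq1 : Nat.gcd (ℓ + 1) j * k + 1 ∈ Icc 1 (ℓ + 1) := ⟨by omega, by omega⟩
    refine ⟨_, (mem_disappearing_A h hj).mpr ⟨1, hp1, _, hq1, ⟨k, by omega, h3⟩, hf⟩, ?_⟩
    rw [hpair 1 hp1 _ hq1 k h3 _ hf]
    rcases abs_eq_abs.mp (hk.trans (Nat.abs_cast k).symm) with rfl | rfl
    · exact .inl (by push_cast; rfl)
    · exact .inr (by push_cast; ring)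

end TypeA

end Folding

/-! ### Type D: disjoint unions in `ℝ^ℓ` -/

namespace Folding

open Set

/-- The coordinates of a vector of `ℝⁿ`, numbered from `1` to `n`. -/
noncomputable def coords (n : ℕ) : EuclideanSpace ℝ (Fin n) →ₗ[ℝ] ℕ → ℝ where
  toFun x r := if h : 1 ≤ r ∧ r ≤ n then x ⟨r - 1, by omega⟩ else 0
  map_add' x y := by
    funext r
    by_cases h : 1 ≤ r ∧ r ≤ n <;> simp [h]
  map_smul' c x := by
    funext r
    by_cases h : 1 ≤ r ∧ r ≤ n <;> simp [h]

theorem coords_e {n p : ℕ} (hp : p ∈ Icc 1 n) : coords n (e n p) = ε p := by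
  obtain ⟨hp, hp'⟩ := hp
  funext r
  rw [ε_apply]
  change (if h : 1 ≤ r ∧ r ≤ n then (if r - 1 + 1 = p then (1 : ℝ) else 0) else 0) = _
  split_ifs <;> first | omega | rfl

section TypeD

variable {ι M N : Type*} [AddCommGroup M] [Module ℝ M] [AddCommGroup N] [Module ℝ N]
variable {P : RootPairing ι ℝ M N} {b : P.Base} {α : ℕ → ι} {ℓ : ℕ}
variable [P.IsRootSystem] [P.IsCrystallographic] [Finite ι] [P.IsReduced]

theorem isDisjointUnion_image_D_pred_of_even (h : IsLabelling b (CartanMatrix.D ℓ) α) (hℓ : 4 ≤ ℓ)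
    (hev : Even ℓ) {f : M →ₗ[ℝ] EuclideanSpace ℝ (Fin ℓ)}
    (h1 : ∀ i ∈ Icc 1 (ℓ - 1), f (P.root (α i)) = e ℓ i - e ℓ (i + 1))
    (h2 : f (P.root (α ℓ)) = e ℓ (ℓ - 1) + e ℓ ℓ) :
    IsDisjointUnion (f '' disappearing b (omega b (α (ℓ - 1))))
      [{e ℓ 1 - e ℓ ℓ}, {x | ∃ i ∈ Icc 2 (ℓ / 2), x = e ℓ i + e ℓ (ℓ - i + 1)}] := by
  rw [image_disappearing_D_of_even h hℓ hev (.inl rfl) h1 h2,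
    map_strD_pred hℓ h1 ⟨le_rfl, by omega⟩]
  refine isDisjointUnion_of_forall (φ := fun x => coords ℓ x 1) (c := [1, 0]) (by simp)
    (.cons ?_ (.cons ?_ .nil)) ?_
  · rintro - rfl
    rw [map_sub, coords_e ⟨le_rfl, by omega⟩, coords_e ⟨by omega, le_rfl⟩, Pi.sub_apply, ε_apply,
      ε_apply, if_pos rfl, if_neg (by omega), sub_zero]
  · rintro - ⟨i, ⟨hi, hi'⟩, rfl⟩
    rw [map_add, coords_e ⟨by omega, by omega⟩, coords_e ⟨by omega, by omega⟩, Pi.add_apply,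
      ε_apply, ε_apply, if_neg (by omega), if_neg (by omega), add_zero]
  · ext x
    simp

/-- The separate root `e_1 + e_ℓ` is the member `i = 1` of the family of mirrored pairs, so the two
pieces merge. -/
theorem image_disappearing_D_last_of_even (h : IsLabelling b (CartanMatrix.D ℓ) α) (hℓ : 4 ≤ ℓ)
    (hev : Even ℓ) {W : Type*} [AddCommGroup W] [Module ℝ W] {g : M →ₗ[ℝ] W} {u : ℕ → W}
    (h1 : ∀ i ∈ Icc 1 (ℓ - 1), g (P.root (α i)) = u i - u (i + 1))
    (h2 : g (P.root (α ℓ)) = u (ℓ - 1) + u ℓ) :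
    g '' disappearing b (omega b (α ℓ)) =
      {x | ∃ i ∈ Icc 1 (ℓ / 2), x = u i + u (ℓ - i + 1)} := by
  rw [image_disappearing_D_of_even h hℓ hev (.inr rfl) h1 h2,
    map_strD_last hℓ h1 h2 ⟨le_rfl, by omega⟩]
  ext x
  constructor
  · rintro (rfl | ⟨i, ⟨hi, hi'⟩, rfl⟩)
    · exact ⟨1, ⟨le_rfl, by omega⟩, by rw [(by omega : ℓ - 1 + 1 = ℓ)]⟩
    · exact ⟨i, ⟨by omega, hi'⟩, rfl⟩
  · rintro ⟨i, ⟨hi, hi'⟩, rfl⟩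
    rcases hi.eq_or_lt with rfl | hlt
    · left
      rw [(by omega : ℓ - 1 + 1 = ℓ)]
      rfl
    · exact .inr ⟨i, ⟨hlt, hi'⟩, rfl⟩

theorem isDisjointUnion_image_D_of_odd_euclidean (h : IsLabelling b (CartanMatrix.D ℓ) α)
    (hℓ : 4 ≤ ℓ) (hodd : Odd ℓ) {j : ℕ} (hj : j = ℓ - 1 ∨ j = ℓ)
    {f : M →ₗ[ℝ] EuclideanSpace ℝ (Fin ℓ)}
    (h1 : ∀ i ∈ Icc 1 (ℓ - 1), f (P.root (α i)) = e ℓ i - e ℓ (i + 1))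
    (h2 : f (P.root (α ℓ)) = e ℓ (ℓ - 1) + e ℓ ℓ) :
    IsDisjointUnion (f '' disappearing b (omega b (α j)))
      [{e ℓ 1 + e ℓ ((ℓ + 1) / 2), e ℓ 1 - e ℓ ((ℓ + 1) / 2), e ℓ ((ℓ + 1) / 2) + e ℓ ℓ,
        e ℓ ((ℓ + 1) / 2) - e ℓ ℓ, e ℓ 1 + e ℓ ℓ, e ℓ 1 - e ℓ ℓ},
        {x | ∃ i ∈ Icc 2 ((ℓ - 1) / 2), x = e ℓ i + e ℓ (ℓ - i + 1)}] :=
  isDisjointUnion_image_D_of_odd h hℓ hodd hj h1 h2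
    (φ := (coordAt 1 + (3 : ℝ) • coordAt ((ℓ + 1) / 2)) ∘ₗ coords ℓ) fun p hp => by
      rw [LinearMap.comp_apply, coords_e hp]
      rfl

end TypeD

end Folding

/-! ### The main theorem, type by type -/

open Folding in
theorem mainTheorem10 {ι M N : Type*} [Finite ι] [Nonempty ι]
    [AddCommGroup M] [Module ℝ M] [AddCommGroup N] [Module ℝ N]
    (P : RootPairing ι ℝ M N) [P.IsCrystallographic] [P.IsReduced] [P.IsIrreducible]
    (b : P.Base) (α : ℕ → ι) :
    -- type `A_ℓ`
    (∀ ℓ : ℕ, 1 ≤ ℓ → IsLabelling b (CartanMatrix.A ℓ) α →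
      minuscule b = α '' Set.Icc 1 ℓ ∧
      ∀ j ∈ Set.Icc 1 ℓ,
        disappearing b (omega b (α j)) =
          {x | ∃ i₁ ∈ Set.Icc 1 ℓ, ∃ i₂ ∈ Set.Icc 1 ℓ,
            (∃ k : ℕ, 0 < k ∧ (i₂ : ℤ) - i₁ + 1 = Nat.gcd (ℓ + 1) j * k) ∧
            x = str P α i₁ i₂} ∧
        (∀ f : M →ₗ[ℝ] EuclideanSpace ℝ (Fin (ℓ + 1)),
          (∀ i ∈ Set.Icc 1 ℓ, f (P.root (α i)) = e (ℓ + 1) i - e (ℓ + 1) (i + 1)) →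
          f '' disappearing b (omega b (α j)) =
            {x | ∃ p₁ ∈ Set.Icc 1 (ℓ + 1), ∃ p₂ ∈ Set.Icc 1 (ℓ + 1),
              (∃ k : ℕ, 0 < k ∧ (p₂ : ℤ) - p₁ = Nat.gcd (ℓ + 1) j * k) ∧
              x = e (ℓ + 1) p₁ - e (ℓ + 1) p₂}) ∧
        extraSet b (omega b (α j)) 0 = {p | 1 ≤ |p| ∧ |p| ≤ (orderOf (omega b (α j)) : ℤ) - 1}) ∧
    -- type `B_ℓ`
    (∀ ℓ : ℕ, 2 ≤ ℓ → IsLabelling b (CartanMatrix.B ℓ) α →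
      minuscule b = {α 1} ∧
      disappearing b (omega b (α 1)) = {str P α 1 ℓ} ∧
      (∀ f : M →ₗ[ℝ] EuclideanSpace ℝ (Fin ℓ),
        (∀ i ∈ Set.Icc 1 (ℓ - 1), f (P.root (α i)) = e ℓ i - e ℓ (i + 1)) →
        f (P.root (α ℓ)) = e ℓ ℓ →
        f '' disappearing b (omega b (α 1)) = {e ℓ 1}) ∧
      extraSet b (omega b (α 1)) 0 = {1, -1}) ∧
    -- type `C_ℓ`
    (∀ ℓ : ℕ, 3 ≤ ℓ → IsLabelling b (CartanMatrix.C ℓ) α →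
      minuscule b = {α ℓ} ∧
      disappearing b (omega b (α ℓ)) =
        {x | ∃ i ∈ Set.Icc 1 ((ℓ + 1) / 2),
          x = str P α i (ℓ - i) + (2 : ℝ) • str P α (ℓ - i + 1) (ℓ - 1) + P.root (α ℓ)} ∧
      (∀ f : M →ₗ[ℝ] EuclideanSpace ℝ (Fin ℓ),
        (∀ i ∈ Set.Icc 1 (ℓ - 1), f (P.root (α i)) = e ℓ i - e ℓ (i + 1)) →
        f (P.root (α ℓ)) = (2 : ℝ) • e ℓ ℓ →
        f '' disappearing b (omega b (α ℓ)) =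
          {x | ∃ p ∈ Set.Icc 1 ((ℓ + 1) / 2), x = e ℓ p + e ℓ (ℓ - p + 1)}) ∧
      extraSet b (omega b (α ℓ)) 0 = {1, -1}) ∧
    -- type `D_ℓ`
    (∀ ℓ : ℕ, 4 ≤ ℓ → IsLabelling b (CartanMatrix.D ℓ) α →
      minuscule b = {α 1, α (ℓ - 1), α ℓ} ∧
      -- `j = 1`
      (disappearing b (omega b (α 1)) =
          {str P α 1 (ℓ - 1), str P α 1 (ℓ - 2) + P.root (α ℓ)} ∧
        (∀ f : M →ₗ[ℝ] EuclideanSpace ℝ (Fin ℓ),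
          (∀ i ∈ Set.Icc 1 (ℓ - 1), f (P.root (α i)) = e ℓ i - e ℓ (i + 1)) →
          f (P.root (α ℓ)) = e ℓ (ℓ - 1) + e ℓ ℓ →
          f '' disappearing b (omega b (α 1)) = {e ℓ 1 - e ℓ ℓ, e ℓ 1 + e ℓ ℓ}) ∧
        extraSet b (omega b (α 1)) 0 = {1, -1}) ∧
      -- `ℓ` even, `j ∈ {ℓ - 1, ℓ}`
      (Even ℓ → ∀ j : ℕ, j = ℓ - 1 ∨ j = ℓ →
        IsDisjointUnion (disappearing b (omega b (α j)))
          [{str P α 1 (ℓ - 2) + P.root (α j)},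
            {x | ∃ i ∈ Set.Icc 2 (ℓ / 2),
              x = str P α i (ℓ - i) + (2 : ℝ) • str P α (ℓ - i + 1) (ℓ - 2)
                + P.root (α (ℓ - 1)) + P.root (α ℓ)}] ∧
        (∀ f : M →ₗ[ℝ] EuclideanSpace ℝ (Fin ℓ),
          (∀ i ∈ Set.Icc 1 (ℓ - 1), f (P.root (α i)) = e ℓ i - e ℓ (i + 1)) →
          f (P.root (α ℓ)) = e ℓ (ℓ - 1) + e ℓ ℓ →
          (j = ℓ - 1 → IsDisjointUnion (f '' disappearing b (omega b (α j)))
            [{e ℓ 1 - e ℓ ℓ}, {x | ∃ i ∈ Set.Icc 2 (ℓ / 2), x = e ℓ i + e ℓ (ℓ - i + 1)}]) ∧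
          (j = ℓ → f '' disappearing b (omega b (α j)) =
            {x | ∃ i ∈ Set.Icc 1 (ℓ / 2), x = e ℓ i + e ℓ (ℓ - i + 1)})) ∧
        extraSet b (omega b (α j)) 0 = {1, -1}) ∧
      -- `ℓ` odd, `j ∈ {ℓ - 1, ℓ}`
      (Odd ℓ → ∀ j : ℕ, j = ℓ - 1 ∨ j = ℓ →
        IsDisjointUnion (disappearing b (omega b (α j)))
          [{str P α 1 ((ℓ - 1) / 2)},
            {x | ∃ p ∈ ({ℓ - 1, ℓ} : Set ℕ),
              x = str P α ((ℓ + 1) / 2) (ℓ - 2) + P.root (α p)},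
            {x | ∃ p ∈ ({ℓ - 1, ℓ} : Set ℕ), x = str P α 1 (ℓ - 2) + P.root (α p)},
            {x | ∃ i ∈ Set.Icc 2 ((ℓ - 1) / 2),
              x = str P α i (ℓ - i) + (2 : ℝ) • str P α (ℓ - i + 1) (ℓ - 2)
                + P.root (α (ℓ - 1)) + P.root (α ℓ)},
            {str P α 1 ((ℓ - 1) / 2) + (2 : ℝ) • str P α ((ℓ + 1) / 2) (ℓ - 2)
                + P.root (α (ℓ - 1)) + P.root (α ℓ)}] ∧
        (∀ f : M →ₗ[ℝ] EuclideanSpace ℝ (Fin ℓ),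
          (∀ i ∈ Set.Icc 1 (ℓ - 1), f (P.root (α i)) = e ℓ i - e ℓ (i + 1)) →
          f (P.root (α ℓ)) = e ℓ (ℓ - 1) + e ℓ ℓ →
          IsDisjointUnion (f '' disappearing b (omega b (α j)))
            [{e ℓ 1 + e ℓ ((ℓ + 1) / 2), e ℓ 1 - e ℓ ((ℓ + 1) / 2),
                e ℓ ((ℓ + 1) / 2) + e ℓ ℓ, e ℓ ((ℓ + 1) / 2) - e ℓ ℓ,
                e ℓ 1 + e ℓ ℓ, e ℓ 1 - e ℓ ℓ},
              {x | ∃ i ∈ Set.Icc 2 ((ℓ - 1) / 2), x = e ℓ i + e ℓ (ℓ - i + 1)}]) ∧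
        extraSet b (omega b (α j)) 0 = {1, -1, 2, -2, 3, -3})) ∧
    -- type `E_6`
    (IsLabelling b CartanMatrix.E₆ α →
      minuscule b = {α 1, α 6} ∧
      ∀ j : ℕ, j = 1 ∨ j = 6 →
        disappearing b (omega b (α j)) =
          {P.root (α 1) + P.root (α 2) + P.root (α 3) + P.root (α 4),
            P.root (α 1) + P.root (α 3) + P.root (α 4) + P.root (α 5),
            P.root (α 2) + P.root (α 4) + P.root (α 5) + P.root (α 6),
            P.root (α 3) + P.root (α 4) + P.root (α 5) + P.root (α 6),
            P.root (α 1) + P.root (α 2) + (2 : ℝ) • P.root (α 3) + (2 : ℝ) • P.root (α 4)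
              + P.root (α 5) + P.root (α 6),
            P.root (α 1) + P.root (α 2) + P.root (α 3) + (2 : ℝ) • P.root (α 4)
              + (2 : ℝ) • P.root (α 5) + P.root (α 6)} ∧
        (∀ f : M →ₗ[ℝ] EuclideanSpace ℝ (Fin 8),
          f (P.root (α 1)) =
            (1 / 2 : ℝ) • (e 8 1 - e 8 2 - e 8 3 - e 8 4 - e 8 5 - e 8 6 - e 8 7 + e 8 8) →
          f (P.root (α 2)) = e 8 1 + e 8 2 →
          f (P.root (α 3)) = e 8 2 - e 8 1 →
          f (P.root (α 4)) = e 8 3 - e 8 2 →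
          f (P.root (α 5)) = e 8 4 - e 8 3 →
          f (P.root (α 6)) = e 8 5 - e 8 4 →
          f '' disappearing b (omega b (α j)) =
            {(1 / 2 : ℝ) • (e 8 1 + e 8 2 + e 8 3 - e 8 4 - e 8 5 - e 8 6 - e 8 7 + e 8 8),
              (1 / 2 : ℝ) • (-e 8 1 - e 8 2 - e 8 3 + e 8 4 - e 8 5 - e 8 6 - e 8 7 + e 8 8),
              e 8 5 + e 8 1,
              e 8 5 - e 8 1,
              (1 / 2 : ℝ) • (-e 8 1 + e 8 2 + e 8 3 - e 8 4 + e 8 5 - e 8 6 - e 8 7 + e 8 8),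
              (1 / 2 : ℝ) • (e 8 1 - e 8 2 - e 8 3 + e 8 4 + e 8 5 - e 8 6 - e 8 7 + e 8 8)}) ∧
        extraSet b (omega b (α j)) 0 = {1, -1, 2, -2}) ∧
    -- type `E_7`
    (IsLabelling b CartanMatrix.E₇ α →
      minuscule b = {α 7} ∧
      disappearing b (omega b (α 7)) =
        {P.root (α 2) + P.root (α 3) + (2 : ℝ) • P.root (α 4) + (2 : ℝ) • P.root (α 5)
            + (2 : ℝ) • P.root (α 6) + P.root (α 7),
          P.root (α 1) + P.root (α 2) + (2 : ℝ) • P.root (α 3) + (2 : ℝ) • P.root (α 4)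
            + P.root (α 5) + P.root (α 6) + P.root (α 7),
          P.root (α 1) + P.root (α 2) + P.root (α 3) + (2 : ℝ) • P.root (α 4)
            + (2 : ℝ) • P.root (α 5) + P.root (α 6) + P.root (α 7)} ∧
      (∀ f : M →ₗ[ℝ] EuclideanSpace ℝ (Fin 8),
        f (P.root (α 1)) =
          (1 / 2 : ℝ) • (e 8 1 - e 8 2 - e 8 3 - e 8 4 - e 8 5 - e 8 6 - e 8 7 + e 8 8) →
        f (P.root (α 2)) = e 8 2 + e 8 1 →
        f (P.root (α 3)) = e 8 2 - e 8 1 →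
        f (P.root (α 4)) = e 8 3 - e 8 2 →
        f (P.root (α 5)) = e 8 4 - e 8 3 →
        f (P.root (α 6)) = e 8 5 - e 8 4 →
        f (P.root (α 7)) = e 8 6 - e 8 5 →
        f '' disappearing b (omega b (α 7)) =
          {e 8 6 + e 8 5,
            (1 / 2 : ℝ) • (-e 8 1 + e 8 2 + e 8 3 - e 8 4 - e 8 5 + e 8 6 - e 8 7 + e 8 8),
            (1 / 2 : ℝ) • (e 8 1 - e 8 2 - e 8 3 + e 8 4 - e 8 5 + e 8 6 - e 8 7 + e 8 8)}) ∧
      extraSet b (omega b (α 7)) 0 = {1, -1}) := by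
  refine ⟨?_, ?_, ?_, ?_, ?_, ?_⟩
  · intro ℓ hℓ h
    exact ⟨minuscule_A h hℓ, fun j hj => ⟨disappearing_A h hj, fun f hf => image_disappearing_A h hj hf,
      extraSet_A h hj⟩⟩
  · intro ℓ hℓ h
    refine ⟨minuscule_B h hℓ, disappearing_B h hℓ, fun f h1 h2 => ?_, extraSet_B h hℓ⟩
    rw [disappearing_B h hℓ, Set.image_singleton, map_strB (by omega) h1 h2]
  · intro ℓ hℓ h
    exact ⟨minuscule_C h hℓ, disappearing_C h hℓ, fun f h1 h2 => image_disappearing_C h hℓ h1 h2,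
      extraSet_C h hℓ⟩
  · intro ℓ hℓ h
    refine ⟨minuscule_D h hℓ, ⟨disappearing_D_first h hℓ,
      fun f h1 h2 => image_disappearing_D_first h hℓ h1 h2, extraSet_D_first h hℓ⟩, ?_, ?_⟩
    · intro hev j hj
      refine ⟨isDisjointUnion_D_of_even h hℓ hev hj, fun f h1 h2 => ⟨?_, ?_⟩,
        extraSet_D_of_even h hℓ hev hj⟩
      · rintro rfl
        exact isDisjointUnion_image_D_pred_of_even h hℓ hev h1 h2
      · rintro rfl
        exact image_disappearing_D_last_of_even h hℓ hev h1 h2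
    · intro hodd j hj
      exact ⟨isDisjointUnion_D_of_odd h hℓ hodd hj,
        fun f h1 h2 => isDisjointUnion_image_D_of_odd_euclidean h hℓ hodd hj h1 h2,
        extraSet_D_of_odd h hℓ hodd hj⟩
  · intro h
    exact ⟨minuscule_E₆ h, fun j hj => ⟨disappearing_E₆ h hj,
      fun f h1 h2 h3 h4 h5 h6 => image_disappearing_E₆ h hj h1 h2 h3 h4 h5 h6, extraSet_E₆ h hj⟩⟩
  · intro h
    exact ⟨minuscule_E₇ h, disappearing_E₇ h,
      fun f h1 h2 h3 h4 h5 h6 h7 => image_disappearing_E₇ h h1 h2 h3 h4 h5 h6 h7, extraSet_E₇ h⟩
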